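/- Let $N\ge 1$ be an integer, $s\in(0,1)$ with $N>2s$, and $2^*_s=\frac{2N}{N-2s}$. Put $$c_{N,s}=2^{2s-1}\pi^{-N/2}\frac{\Gamma(\frac{N+2s}{2})}{|\Gamma(-s)|},\qquad \Gamma_{N,s}=2^{2s}\frac{\Gamma^2(\frac{N+2s}{4})}{\Gamma^2(\frac{N-2s}{4})},$$ $$\langle u,\phi\rangle_s=c_{N,s}\int_{\mathbb R^{2N}}\frac{(u(x)-u(y))(\phi(x)-\phi(y))}{|x-y|^{N+2s}}\,dx\,dy .$$ Let $H^s(\mathbb R^N)$ be the space of real $u\in L^2(\mathbb R^N)$ with $\langle u,u\rangle_s<\infty$. Let $\Omega\subset\mathbb R^N$ be open and bounded, and let $X_0=\{u\in H^s(\mathbb R^N): u=0 \text{ a.e. in } \mathbb R^N\setminus\Omega\}$. Let $0<\mu<\Gamma_{N,s}$ and $$S=\inf_{u\in H^s(\mathbb R^N)\setminus\{0\}}\frac{\langle u,u\rangle_s-\mu\int_{\mathbb R^N}\frac{|u|^2}{|x|^{2s}}dx}{\big(\int_{\mathbb R^N}|u|^{2^*_s}dx\big)^{2/2^*_s}},\qquad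 \lambda_{1,\mu}=\inf_{u\in X_0\setminus\{0\}}\frac{\langle u,u\rangle_s-\mu\int_{\Omega}\frac{|u|^2}{|x|^{2s}}dx}{\int_{\Omega}|u|^{2}dx},$$ and let $0<\lambda<\lambda_{1,\mu}$. Let $f:\Omega\times\mathbb R\to\mathbb R$ be a Carathéodory function ($f(\cdot,t)$ is measurable for every $t$, and $f(x,\cdot)$ is continuous for a.e. $x\in\Omega$) which is essentially bounded on $\Omega\times[-M,M]$ for every $M>0$ (there is $C_M$ such that for a.e. $x\in\Omega$, $|f(x,t)|\le C_M$ for all $|t|\le M$), and such that $$\lim_{t\to0}\frac{f(x,t)}{t}=0\quad\text{and}\quad \lim_{|t|\to\infty}\frac{f(x,t)}{|t|^{2^*_s-1}}=0\qquad\text{uniformly in }x\in\Omega .$$ With $F(x,t)=\int_0^tf(x,\tau)\,d\tau$, define on $X_0$ $$J_\lambda(u)=\frac12\Big(\langle u,u\rangle_s-\lambda\int_\Omega|u|^2dx-\mu\int_\Omega\frac{|u|^2}{|x|^{2s}}dx\Big)-\frac1{2^*_s}\int_\Omega|u|^{2^*_s}dx-\int_\Omega F(x,u)\,dx .$$ Suppose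 that there is $u_0\in X_0\setminus\{0\}$ with $u_0\ge0$ a.e. in $\Omega$ and $$\sup_{t\ge0}J_\lambda(tu_0)<\frac sN S^{\frac N{2s}} .$$ Then the problem $$(-\Delta)^su-\mu\frac{u}{|x|^{2s}}-\lambda u=|u|^{2^*_s-2}u+f(x,u)\ \text{ in }\Omega,\qquad u=0\ \text{ in }\mathbb R^N\setminus\Omega,$$ has a weak solution that is not identically zero: there is $u\in X_0$, $u\neq0$, such that for every $\phi\in X_0$ all the integrals below converge and $$\langle u,\phi\rangle_s-\mu\int_\Omega\frac{u\phi}{|x|^{2s}}dx-\lambda\int_\Omega u\phi\,dx=\int_\Omega|u|^{2^*_s-2}u\,\phi\,dx+\int_\Omega f(x,u)\,\phi\,dx .$$ -/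

import Mathlib

open MeasureTheory Set Filter Topology

/-- The fractional critical Sobolev exponent `2N / (N - 2s)`. -/
noncomputable def critExp (N : ℕ) (s : ℝ) : ℝ := 2 * (N : ℝ) / ((N : ℝ) - 2 * s)

/-- The normalising constant `c_{N,s} = 2^{2s-1} π^{-N/2} Γ((N+2s)/2) / |Γ(-s)|`. -/
noncomputable def cNs (N : ℕ) (s : ℝ) : ℝ :=
  (2 : ℝ) ^ (2 * s - 1) * Real.pi ^ (-((N : ℝ) / 2)) *
    (Real.Gamma (((N : ℝ) + 2 * s) / 2) / |Real.Gamma (-s)|)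

/-- The fractional Hardy constant `Γ_{N,s} = 2^{2s} Γ((N+2s)/4)^2 / Γ((N-2s)/4)^2`. -/
noncomputable def hardyConst (N : ℕ) (s : ℝ) : ℝ :=
  (2 : ℝ) ^ (2 * s) * (Real.Gamma (((N : ℝ) + 2 * s) / 4) ^ 2 /
    Real.Gamma (((N : ℝ) - 2 * s) / 4) ^ 2)

/-- The integrand `(u(x) - u(y)) (φ(x) - φ(y)) / |x - y|^{N+2s}` on `ℝ^N × ℝ^N`. -/
noncomputable def gagliardoKernel {N : ℕ} (s : ℝ) (u φ : EuclideanSpace ℝ (Fin N) → ℝ)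
    (p : EuclideanSpace ℝ (Fin N) × EuclideanSpace ℝ (Fin N)) : ℝ :=
  (u p.1 - u p.2) * (φ p.1 - φ p.2) / ‖p.1 - p.2‖ ^ ((N : ℝ) + 2 * s)

/-- `c_{N,s} ∫∫ (u(x) - u(y)) (φ(x) - φ(y)) / |x - y|^{N+2s} dx dy`. -/
noncomputable def gagliardoForm {N : ℕ} (s : ℝ) (u φ : EuclideanSpace ℝ (Fin N) → ℝ) : ℝ :=
  cNs N s * ∫ p : EuclideanSpace ℝ (Fin N) × EuclideanSpace ℝ (Fin N), gagliardoKernel s u φ p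

/-- Membership in `H^s(ℝ^N)`: square integrable, with finite Gagliardo seminorm. Functions are
considered up to equality almost everywhere. -/
def MemHs {N : ℕ} (s : ℝ) (u : EuclideanSpace ℝ (Fin N) → ℝ) : Prop :=
  MemLp u 2 volume ∧ Integrable (gagliardoKernel s u u) volume

/-- Membership in `X_0 = {u ∈ H^s(ℝ^N) : u = 0 a.e. in ℝ^N \ Ω}`. -/
def MemX0 {N : ℕ} (s : ℝ) (Ω : Set (EuclideanSpace ℝ (Fin N)))
    (u : EuclideanSpace ℝ (Fin N) → ℝ) : Prop :=
  MemHs s u ∧ ∀ᵐ x ∂(volume.restrict Ωᶜ), u x = 0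

/-- The quadratic form `c_{N,s} ∫∫ |u(x) - u(y)|^2 / |x - y|^{N+2s} - μ ∫_A |u|^2 / |x|^{2s}`. -/
noncomputable def hardyEnergy {N : ℕ} (s μ : ℝ) (A : Set (EuclideanSpace ℝ (Fin N)))
    (u : EuclideanSpace ℝ (Fin N) → ℝ) : ℝ :=
  gagliardoForm s u u - μ * ∫ x in A, |u x| ^ 2 / ‖x‖ ^ (2 * s)

/-- The best constant `S`: the infimum over `u ∈ H^s(ℝ^N) \ {0}` of
`(c_{N,s} ∫∫ |u(x) - u(y)|^2 / |x - y|^{N+2s} - μ ∫ |u|^2 / |x|^{2s}) / ‖u‖_{2^*_s}^2`. -/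
noncomputable def bestS (N : ℕ) (s μ : ℝ) : ℝ :=
  sInf {q : ℝ | ∃ u : EuclideanSpace ℝ (Fin N) → ℝ,
    MemHs s u ∧ ¬ (u =ᵐ[volume] 0) ∧
      q = hardyEnergy s μ univ u / (∫ x, |u x| ^ critExp N s) ^ (2 / critExp N s)}

/-- The first Dirichlet eigenvalue `λ_{1,μ}` of `(-Δ)^s - μ |x|^{-2s}` in `Ω`, given by its
Rayleigh quotient. -/
noncomputable def firstEigenvalue {N : ℕ} (s μ : ℝ) (Ω : Set (EuclideanSpace ℝ (Fin N))) : ℝ :=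
  sInf {q : ℝ | ∃ u : EuclideanSpace ℝ (Fin N) → ℝ,
    MemX0 s Ω u ∧ ¬ (u =ᵐ[volume] 0) ∧
      q = hardyEnergy s μ Ω u / ∫ x in Ω, |u x| ^ 2}

/-- A Carathéodory function `f : Ω × ℝ → ℝ`, bounded on `Ω × [-M, M]` for each `M`, that is a
lower order perturbation of the critical nonlinearity. -/
structure IsLowerOrderPerturbation {N : ℕ} (s : ℝ) (Ω : Set (EuclideanSpace ℝ (Fin N)))
    (f : EuclideanSpace ℝ (Fin N) → ℝ → ℝ) : Prop where
  aemeasurable : ∀ t : ℝ, AEMeasurable (fun x => f x t) (volume.restrict Ω)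
  continuous : ∀ᵐ x ∂(volume.restrict Ω), Continuous (f x)
  locally_bounded : ∀ M : ℝ, ∃ C : ℝ, ∀ᵐ x ∂(volume.restrict Ω), ∀ t : ℝ, |t| ≤ M → |f x t| ≤ C
  at_zero : TendstoUniformlyOn (fun (t : ℝ) x => f x t / t) (fun _ => 0) (𝓝[≠] 0) Ω
  at_infinity : TendstoUniformlyOn (fun (t : ℝ) x => f x t / |t| ^ (critExp N s - 1))
    (fun _ => 0) (Bornology.cobounded ℝ) Ω

/-- The functional `J_λ`, with `F(x, t) = ∫_0^t f(x, τ) dτ`. -/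
noncomputable def energyJ {N : ℕ} (s μ lam : ℝ) (Ω : Set (EuclideanSpace ℝ (Fin N)))
    (f : EuclideanSpace ℝ (Fin N) → ℝ → ℝ) (u : EuclideanSpace ℝ (Fin N) → ℝ) : ℝ :=
  1 / 2 * (gagliardoForm s u u - lam * (∫ x in Ω, |u x| ^ 2)
      - μ * ∫ x in Ω, |u x| ^ 2 / ‖x‖ ^ (2 * s))
    - 1 / critExp N s * (∫ x in Ω, |u x| ^ critExp N s)
    - ∫ x in Ω, ∫ τ in (0 : ℝ)..(u x), f x τ

/-- Weak solutions of `(-Δ)^s u - μ u / |x|^{2s} - λ u = |u|^{2^*_s - 2} u + f(x, u)` in `Ω`,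
`u = 0` in `ℝ^N \ Ω`, tested against all of `X_0`. All the integrals are required to exist. -/
def IsWeakSolution {N : ℕ} (s μ lam : ℝ) (Ω : Set (EuclideanSpace ℝ (Fin N)))
    (f : EuclideanSpace ℝ (Fin N) → ℝ → ℝ) (u : EuclideanSpace ℝ (Fin N) → ℝ) : Prop :=
  MemX0 s Ω u ∧ ∀ φ : EuclideanSpace ℝ (Fin N) → ℝ, MemX0 s Ω φ →
    Integrable (gagliardoKernel s u φ) volume ∧
    IntegrableOn (fun x => u x * φ x / ‖x‖ ^ (2 * s)) Ω volume ∧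
    IntegrableOn (fun x => u x * φ x) Ω volume ∧
    IntegrableOn (fun x => |u x| ^ (critExp N s - 2) * u x * φ x) Ω volume ∧
    IntegrableOn (fun x => f x (u x) * φ x) Ω volume ∧
    gagliardoForm s u φ - μ * (∫ x in Ω, u x * φ x / ‖x‖ ^ (2 * s))
        - lam * (∫ x in Ω, u x * φ x)
      = (∫ x in Ω, |u x| ^ (critExp N s - 2) * u x * φ x) + ∫ x in Ω, f x (u x) * φ x

/-!
# A mountain pass solution of a critical fractional Hardy problem

The solution is a critical point of the functional `energyJ` on the Hilbert space `X_0`, found by the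
mountain pass theorem.

*The quadratic part.* The sharp fractional Hardy inequality `MemHs.hardy`, together with
`lam < firstEigenvalue s μ Ω`, makes the quadratic form coercive (`exists_coercive`); with the
Sobolev inequality `MemHs.sobolev` it also gives `0 < bestS N s μ` (`bestS_pos`). Hardy's inequality
with the constant `hardyConst` comes from the heat semigroup: `|z|^{-N-2s}` is an average over `t` of
heat kernels `p_t(z)`, and for each `t` a Schur test with the weight `∫_{r₀}^∞ r^{β-1} p_r dr`,
`β = (N+2s)/4`, bounds the Dirichlet form of `p_t` from below. Integration in `t` and the limit
`r₀ → 0` leave a Beta integral, which is the quotient of Gamma functions in `hardyConst`. Sobolev's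
inequality and Rellich's theorem both follow from the elementary comparison of `u(x)` with the
average of `u` over a ball (`MemHs.sq_le_average`).

*The nonlinear part.* The perturbation `f` agrees almost everywhere on `Ω` with a jointly measurable
`g` that satisfies `|g(x, t)| ≤ ε |t| + C |t|^{p-1}` and `|g(x, t)| ≤ C |t| + ε |t|^{p-1}`, where
`p = critExp N s`. Its superposition operator is a continuous gradient field on `X_0`.

*Mountain pass.* The functional is positive on a small sphere and nonpositive far away on the ray
through `u₀`. Ekeland's principle on the space of paths gives a sequence `u_n` with `J(u_n) → c > 0`
and `J'(u_n) → 0` (`exists_palaisSmale_seq`), where `c` is at most the supremum of `J` along the ray,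
hence `c < (s/N) S^{N/(2s)}`. Since `J(u_n) - ½ J'(u_n) u_n` controls `∫ |u_n|^p`, the sequence is
bounded. A weak limit `u` solves the equation, because `u_n → u` almost everywhere along
a subsequence. If `u` were zero, all terms of lower order would vanish in the limit, so that the
Hardy energy of `u_n` and `∫ |u_n|^p` would have the same limit `c N / s`; the definition of `S` would
then force `c ≥ (s/N) S^{N/(2s)}` (`le_of_vanishing_palaisSmale`).

The analysis on `X_0` is written for any Hilbert space that realizes it (`IsEnergySpace`); the
concrete one, `energySpace`, is a closed subspace of a product of two `L²` spaces.
-/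

/-! ### Ekeland's principle and the mountain pass theorem -/

/-- **Ekeland's variational principle**: almost minimal points can be replaced by points that
minimize a slightly perturbed functional. -/
theorem exists_ekeland {X : Type*} [MetricSpace X] [CompleteSpace X] {Φ : X → ℝ}
    (hΦ : LowerSemicontinuous Φ) (hb : BddBelow (range Φ)) (x₀ : X) {ε : ℝ} (hε : 0 < ε) :
    ∃ x, Φ x ≤ Φ x₀ ∧ ∀ y, Φ x ≤ Φ y + ε * dist x y := by
  classical
  -- points improving on `x` by at least `ε` times the distance; the sequence below picks, in the
  -- improvement set of the current point, an almost minimal point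
  set S : X → Set X := fun x => {y | Φ y + ε * dist x y ≤ Φ x} with hS
  have hself : ∀ x, x ∈ S x := fun x => by simp [hS]
  have hclosed : ∀ x, IsClosed (S x) := fun x => by
    have : LowerSemicontinuous fun y => Φ y + ε * dist x y :=
      hΦ.add (Continuous.lowerSemicontinuous (by fun_prop))
    exact this.isClosed_preimage (Φ x)
  have htrans : ∀ {x y z}, y ∈ S x → z ∈ S y → z ∈ S x := fun {x y z} h1 h2 => by
    simp only [hS, mem_ofPred_eq] at h1 h2 ⊢
    nlinarith [dist_triangle x y z]
  have hbS : ∀ x, BddBelow (Φ '' S x) := fun x => hb.mono (image_subset_range _ _)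
  have hpick : ∀ (n : ℕ) (x : X), ∃ y ∈ S x, ∀ z ∈ S x, Φ y ≤ Φ z + (1 / 2) ^ n := fun n x => by
    have hpos : (0 : ℝ) < (1 / 2) ^ n := by positivity
    obtain ⟨_, ⟨y, hy, rfl⟩, hlt⟩ := Real.lt_sInf_add_pos (Set.Nonempty.image Φ ⟨x, hself x⟩) hpos
    exact ⟨y, hy, fun z hz => by linarith [csInf_le (hbS x) (mem_image_of_mem Φ hz)]⟩
  choose g hgS hgmin using hpick
  set x : ℕ → X := fun n => Nat.rec x₀ (fun k y => g k y) n with hx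
  have hxs : ∀ n, x (n + 1) = g n (x n) := fun n => rfl
  have hmem : ∀ n m, n ≤ m → x m ∈ S (x n) := fun n m hnm => by
    induction m, hnm using Nat.le_induction with
    | base => exact hself _
    | succ m _ ih => exact htrans ih (by rw [hxs]; exact hgS m (x m))
  have hdist : ∀ n m, n + 1 ≤ m → ε * dist (x (n + 1)) (x m) ≤ (1 / 2) ^ n := fun n m hnm => by
    have h1 : Φ (x m) + ε * dist (x (n + 1)) (x m) ≤ Φ (x (n + 1)) := hmem (n + 1) m hnm
    have h2 := hgmin n (x n) (x m) (hmem n m (by omega))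
    rw [← hxs] at h2
    linarith
  have hcauchy : CauchySeq x := by
    rw [Metric.cauchySeq_iff']
    intro δ hδ
    obtain ⟨n, hn⟩ := exists_pow_lt_of_lt_one (mul_pos hε hδ) (by norm_num : (1 / 2 : ℝ) < 1)
    refine ⟨n + 1, fun m hm => ?_⟩
    have := (hdist n m hm).trans_lt hn
    rw [dist_comm]
    exact lt_of_mul_lt_mul_left this hε.le
  obtain ⟨a, ha⟩ := cauchySeq_tendsto_of_complete hcauchy
  have haS : ∀ n, a ∈ S (x n) := fun n =>
    (hclosed (x n)).mem_of_tendsto ha (eventually_atTop.2 ⟨n, fun m hm => hmem n m hm⟩)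
  refine ⟨a, ?_, fun y => ?_⟩
  · have : Φ a + ε * dist x₀ a ≤ Φ x₀ := haS 0
    nlinarith [dist_nonneg (x := x₀) (y := a)]
  · by_contra hlt
    push Not at hlt
    have hy : y ∈ S a := hlt.le
    have hle : ∀ n : ℕ, Φ a ≤ Φ y + (1 / 2) ^ n := fun n => by
      have h1 := hgmin n (x n) y (htrans (haS n) hy)
      rw [← hxs] at h1
      have h2 : Φ a + ε * dist (x (n + 1)) a ≤ Φ (x (n + 1)) := haS (n + 1)
      nlinarith [dist_nonneg (x := x (n + 1)) (y := a)]
    have hlim : Tendsto (fun n : ℕ => Φ y + (1 / 2 : ℝ) ^ n) atTop (𝓝 (Φ y + 0)) :=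
      tendsto_const_nhds.add (tendsto_pow_atTop_nhds_zero_of_lt_one (by norm_num) (by norm_num))
    have := ge_of_tendsto' hlim hle
    nlinarith [dist_nonneg (x := a) (y := y)]

section MountainPass

variable {H : Type*} [NormedAddCommGroup H] [InnerProductSpace ℝ H]

theorem exists_mean_value {J : H → ℝ} {G : H → H}
    (hJ : ∀ u v, HasDerivAt (fun h : ℝ => J (u + h • v)) (inner ℝ (G u) v) 0) (u v : H) {h : ℝ}
    (hh : 0 < h) : ∃ θ ∈ Ioo (0 : ℝ) h, J (u + h • v) = J u + h * inner ℝ (G (u + θ • v)) v := by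
  have hd : ∀ t : ℝ, HasDerivAt (fun h : ℝ => J (u + h • v)) (inner ℝ (G (u + t • v)) v) t :=
    fun t => by
      have h1 := hJ (u + t • v) v
      rw [← sub_self t] at h1
      have h2 := h1.comp_sub_const t t
      refine h2.congr_of_eventuallyEq (Eventually.of_forall fun x => ?_)
      simp only [sub_smul]
      congr 1
      abel
  obtain ⟨θ, hθ, he⟩ := exists_hasDerivAt_eq_slope (fun h : ℝ => J (u + h • v)) _ hh
    (fun t _ => (hd t).continuousAt.continuousWithinAt) (fun t _ => hd t)
  refine ⟨θ, hθ, ?_⟩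
  simp only [zero_smul, add_zero, sub_zero] at he
  rw [he]
  field_simp
  ring

theorem continuous_of_gateaux {J : H → ℝ} {G : H → H} (hG : Continuous G)
    (hJ : ∀ u v, HasDerivAt (fun h : ℝ => J (u + h • v)) (inner ℝ (G u) v) 0) :
    Continuous J := by
  rw [continuous_iff_continuousAt]
  intro u
  obtain ⟨δ, hδ, hball⟩ := Metric.continuousAt_iff.1 (hG.continuousAt (x := u)) 1 one_pos
  rw [ContinuousAt, tendsto_iff_dist_tendsto_zero]
  have hlim : Tendsto (fun w => (‖G u‖ + 1) * dist w u) (𝓝 u) (𝓝 0) := by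
    have : Continuous fun w => (‖G u‖ + 1) * dist w u := by fun_prop
    simpa using this.tendsto u
  refine squeeze_zero' (Eventually.of_forall fun _ => dist_nonneg) ?_ hlim
  filter_upwards [Metric.ball_mem_nhds u hδ] with w hw
  obtain ⟨θ, hθ, he⟩ := exists_mean_value hJ u (w - u) one_pos
  have hd : dist (u + θ • (w - u)) u < δ := by
    rw [dist_eq_norm, add_sub_cancel_left, norm_smul, Real.norm_eq_abs, abs_of_pos hθ.1]
    rw [Metric.mem_ball, dist_eq_norm] at hw
    nlinarith [norm_nonneg (w - u), hθ.2]
  have hGn : ‖G (u + θ • (w - u))‖ ≤ ‖G u‖ + 1 := by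
    have h1 := hball hd
    rw [dist_eq_norm] at h1
    have h2 := norm_sub_norm_le (G (u + θ • (w - u))) (G u)
    linarith
  rw [one_smul, add_sub_cancel, one_mul] at he
  rw [Real.dist_eq, he, add_sub_cancel_left, dist_eq_norm]
  exact (abs_real_inner_le_norm _ _).trans (by gcongr)

/-- The deformation step of the mountain pass theorem: a path that is almost minimal, in the
sense of Ekeland, for the maximum of `J` passes near an almost critical point. -/
theorem exists_almost_critical {J : H → ℝ} {G : H → H} (hG : Continuous G)
    (hJ : ∀ u v, HasDerivAt (fun h : ℝ => J (u + h • v)) (inner ℝ (G u) v) 0)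
    (γ : C(unitInterval, H)) {m ε : ℝ} (hε : 0 < ε)
    (hle : ∀ t, J (γ t) ≤ m) (h0 : J (γ 0) ≤ m - ε) (h1 : J (γ 1) ≤ m - ε)
    (hek : ∀ η : C(unitInterval, H), η 0 = γ 0 → η 1 = γ 1 → ∀ m', (∀ t, J (η t) ≤ m') →
      m ≤ m' + ε * dist γ η) :
    ∃ t, m - ε ≤ J (γ t) ∧ ‖G (γ t)‖ ≤ 2 * ε := by
  by_contra hcon
  push Not at hcon
  have hJc := continuous_of_gateaux hG hJ
  -- the cutoff vanishes at the end points and equals one where `J ∘ γ` is nearly maximal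
  set χ : unitInterval → ℝ := fun t => max 0 (min 1 ((J (γ t) - (m - ε)) / (ε / 2))) with hχ
  have hχc : Continuous χ := by fun_prop
  have hχ0 : ∀ t, 0 ≤ χ t := fun t => le_max_left _ _
  have hχ1 : ∀ t, χ t ≤ 1 := fun t => max_le zero_le_one (min_le_left _ _)
  have hχz : ∀ t, J (γ t) ≤ m - ε → χ t = 0 := fun t ht => by
    refine max_eq_left ((min_le_right _ _).trans ?_)
    exact div_nonpos_of_nonpos_of_nonneg (by linarith) (by linarith)
  have hχo : ∀ t, m - ε / 2 ≤ J (γ t) → χ t = 1 := fun t ht => by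
    have : 1 ≤ (J (γ t) - (m - ε)) / (ε / 2) := by
      rw [le_div_iff₀ (by linarith)]; linarith
    simp only [hχ, min_eq_left this]
    exact max_eq_right zero_le_one
  have hmax : ∀ t, 0 < max ‖G (γ t)‖ (2 * ε) := fun t => lt_max_of_lt_right (by linarith)
  -- descent direction of norm at most one, along which `J` decreases at rate at least `2 ε` where
  -- the cutoff is one
  set v : unitInterval → H := fun t => (-(χ t / max ‖G (γ t)‖ (2 * ε))) • G (γ t) with hv
  have hvc : Continuous v := by
    have : Continuous fun t => max ‖G (γ t)‖ (2 * ε) := by fun_prop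
    exact ((hχc.div this fun t => (hmax t).ne').neg).smul (hG.comp γ.continuous)
  have hvn : ∀ t, ‖v t‖ ≤ 1 := fun t => by
    rw [hv]
    simp only [norm_smul, norm_neg, norm_div, Real.norm_eq_abs, abs_of_nonneg (hχ0 t),
      abs_of_pos (hmax t)]
    rw [div_mul_eq_mul_div, div_le_one (hmax t)]
    calc χ t * ‖G (γ t)‖ ≤ 1 * ‖G (γ t)‖ := by gcongr; exact hχ1 t
      _ ≤ _ := by rw [one_mul]; exact le_max_left _ _
  have hin : ∀ t, inner ℝ (G (γ t)) (v t) = -(χ t / max ‖G (γ t)‖ (2 * ε)) * ‖G (γ t)‖ ^ 2 :=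
    fun t => by rw [hv]; simp only [inner_smul_right, real_inner_self_eq_norm_sq]
  have hunif : ∃ δ > 0, ∀ t : unitInterval, ∀ θ : ℝ, 0 ≤ θ → θ ≤ 1 → θ < δ →
      ‖G (γ t + θ • v t) - G (γ t)‖ ≤ ε / 2 := by
    have hc : Continuous fun q : unitInterval × unitInterval => G (γ q.1 + (q.2 : ℝ) • v q.1) := by
      fun_prop
    obtain ⟨δ, hδ, hd⟩ := Metric.uniformContinuous_iff.1
      (CompactSpace.uniformContinuous_of_continuous hc) (ε / 2) (by linarith)
    refine ⟨δ, hδ, fun t θ hθ0 hθ1 hθ => ?_⟩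
    have := hd (a := (t, ⟨θ, hθ0, hθ1⟩)) (b := (t, 0)) (by
      rw [Prod.dist_eq, dist_self, Subtype.dist_eq, Real.dist_eq]
      simpa [abs_of_nonneg hθ0] using ⟨hδ, hθ⟩)
    rw [dist_eq_norm] at this
    simpa using this.le
  obtain ⟨δ, hδ, hclose⟩ := hunif
  set h : ℝ := min (δ / 2) (1 / 4) with hh
  have hhpos : 0 < h := lt_min (by linarith) (by norm_num)
  have hh4 : h ≤ 1 / 4 := min_le_right _ _
  have hhδ : h < δ := (min_le_left _ _).trans_lt (by linarith)
  set η : C(unitInterval, H) := ⟨fun t => γ t + h • v t, by fun_prop⟩ with hη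
  have hdist : dist γ η ≤ h := by
    rw [ContinuousMap.dist_le hhpos.le]
    intro t
    have : dist (γ t) (η t) = h * ‖v t‖ := by
      change dist (γ t) (γ t + h • v t) = _
      rw [dist_eq_norm, sub_add_cancel_left, norm_neg, norm_smul, Real.norm_eq_abs,
        abs_of_pos hhpos]
    rw [this]
    exact mul_le_of_le_one_right hhpos.le (hvn t)
  have hv0 : ∀ t, J (γ t) ≤ m - ε → η t = γ t := fun t ht => by
    simp [hη, hv, hχz t ht]
  -- the drop `5/4 h ε` exceeds `ε * dist γ η ≤ ε h`, which contradicts the Ekeland property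
  have hup : ∀ t, J (η t) ≤ m - 5 / 4 * h * ε := fun t => by
    obtain ⟨θ, hθ, he⟩ := exists_mean_value hJ (γ t) (v t) hhpos
    have hθc := hclose t θ hθ.1.le (by linarith [hθ.2]) (hθ.2.trans hhδ)
    have hinner : inner ℝ (G (γ t + θ • v t)) (v t) ≤ inner ℝ (G (γ t)) (v t) + ε / 2 := by
      have h2 : inner ℝ (G (γ t + θ • v t) - G (γ t)) (v t) ≤ ε / 2 :=
        (real_inner_le_norm _ _).trans (by nlinarith [hvn t, norm_nonneg (v t)])
      rw [inner_sub_left] at h2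
      linarith
    have heq : J (η t) = J (γ t) + h * inner ℝ (G (γ t + θ • v t)) (v t) := he
    rw [heq]
    rcases le_or_gt (m - ε / 2) (J (γ t)) with hbig | hsmall
    · have hGt := hcon t (by linarith)
      have : inner ℝ (G (γ t)) (v t) ≤ -(2 * ε) := by
        rw [hin, hχo t hbig, max_eq_left hGt.le]
        have hGp : 0 < ‖G (γ t)‖ := by linarith
        have : -(1 / ‖G (γ t)‖) * ‖G (γ t)‖ ^ 2 = -‖G (γ t)‖ := by field_simp
        linarith
      nlinarith [hle t]
    · have : inner ℝ (G (γ t)) (v t) ≤ 0 := by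
        rw [hin]
        have : 0 ≤ χ t / max ‖G (γ t)‖ (2 * ε) := div_nonneg (hχ0 t) (hmax t).le
        nlinarith [sq_nonneg ‖G (γ t)‖]
      nlinarith
  have := hek η (hv0 0 h0) (hv0 1 h1) _ hup
  nlinarith [dist_nonneg (x := γ) (y := η)]

/-- **Mountain pass theorem**, without the Palais-Smale condition: there is a Palais-Smale sequence
at a level between `α` and the maximum of `J` along the segment from `0` to `e`. -/
theorem exists_palaisSmale_seq [CompleteSpace H] {J : H → ℝ} {G : H → H} (hG : Continuous G)
    (hJ : ∀ u v, HasDerivAt (fun h : ℝ => J (u + h • v)) (inner ℝ (G u) v) 0)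
    {ρ α : ℝ} {e : H} (h0 : J 0 ≤ 0) (he : J e ≤ 0) (hρ : 0 < ρ) (hρe : ρ < ‖e‖) (hα : 0 < α)
    (hs : ∀ u, ‖u‖ = ρ → α ≤ J u) :
    ∃ (c : ℝ) (u : ℕ → H), α ≤ c ∧ (∃ t : ℝ, 0 ≤ t ∧ c ≤ J (t • e)) ∧
      Tendsto (fun n => J (u n)) atTop (𝓝 c) ∧ Tendsto (fun n => G (u n)) atTop (𝓝 0) := by
  have hJc := continuous_of_gateaux hG hJ
  set Γ : Set C(unitInterval, H) := {γ | γ 0 = 0 ∧ γ 1 = e} with hΓ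
  have hΓc : IsClosed Γ :=
    (isClosed_eq (by fun_prop) continuous_const).inter (isClosed_eq (by fun_prop) continuous_const)
  have : CompleteSpace Γ := hΓc.completeSpace_coe
  have hbdd : ∀ γ : C(unitInterval, H), BddAbove (range fun t => J (γ t)) := fun γ =>
    (isCompact_range (hJc.comp γ.continuous)).bddAbove
  set Φ : Γ → ℝ := fun γ => ⨆ t, J (γ.1 t) with hΦ
  have hΦle : ∀ (γ : Γ) t, J (γ.1 t) ≤ Φ γ := fun γ t => le_ciSup (hbdd γ.1) t
  have hΦα : ∀ γ, α ≤ Φ γ := fun γ => by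
    have hcn : Continuous fun t : unitInterval => ‖γ.1 t‖ := by fun_prop
    have hmem : ρ ∈ Icc ‖γ.1 0‖ ‖γ.1 1‖ := by
      rw [γ.2.1, γ.2.2, norm_zero]; exact ⟨hρ.le, hρe.le⟩
    obtain ⟨t, ht⟩ := mem_range_of_exists_le_of_exists_ge hcn ⟨0, hmem.1⟩ ⟨1, hmem.2⟩
    exact (hs _ ht).trans (hΦle γ t)
  have hlsc : LowerSemicontinuous Φ := by
    refine lowerSemicontinuous_ciSup (fun γ => hbdd γ.1) fun t => ?_
    exact (hJc.comp ((ContinuousEvalConst.continuous_eval_const t).comp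
      continuous_subtype_val)).lowerSemicontinuous
  have hbelow : BddBelow (range Φ) := ⟨α, by rintro _ ⟨γ, rfl⟩; exact hΦα γ⟩
  set γ₀ : Γ := ⟨⟨fun t => (t : ℝ) • e, by fun_prop⟩, by simp [hΓ]⟩ with hγ₀
  have : Nonempty Γ := ⟨γ₀⟩
  set c : ℝ := ⨅ γ, Φ γ with hc
  have hcα : α ≤ c := le_ciInf hΦα
  have hcΦ : ∀ γ, c ≤ Φ γ := fun γ => ciInf_le hbelow γ
  have hstep : ∀ n : ℕ, ∃ u : H, |J u - c| ≤ 2 * (α / 4 * (1 / 2) ^ n) ∧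
      ‖G u‖ ≤ 2 * (α / 4 * (1 / 2) ^ n) := fun n => by
    set ε : ℝ := α / 4 * (1 / 2) ^ n with hε
    have hεpos : 0 < ε := by positivity
    have hεα : ε ≤ α / 4 := mul_le_of_le_one_right (by linarith)
      (pow_le_one₀ (by norm_num) (by norm_num))
    obtain ⟨γ₁, hγ₁⟩ := exists_lt_of_ciInf_lt (show ⨅ γ, Φ γ < c + ε by linarith)
    obtain ⟨γ, hγ, hek⟩ := exists_ekeland hlsc hbelow γ₁ hεpos
    have hend : (0 : ℝ) ≤ Φ γ - ε := by linarith [hΦα γ]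
    obtain ⟨t, ht1, ht2⟩ := exists_almost_critical hG hJ γ.1 (m := Φ γ) hεpos (hΦle γ)
      (by rw [γ.2.1]; linarith) (by rw [γ.2.2]; linarith) (fun η hη0 hη1 m' hm' => by
        have h2 := hek ⟨η, hη0.trans γ.2.1, hη1.trans γ.2.2⟩
        have h3 : Φ ⟨η, hη0.trans γ.2.1, hη1.trans γ.2.2⟩ ≤ m' := ciSup_le hm'
        rw [Subtype.dist_eq] at h2
        linarith)
    refine ⟨γ.1 t, abs_le.2 ⟨?_, ?_⟩, ht2⟩
    · linarith [hcΦ γ]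
    · linarith [hΦle γ t]
  choose u hu1 hu2 using hstep
  have hlim : Tendsto (fun n : ℕ => 2 * (α / 4 * (1 / 2 : ℝ) ^ n)) atTop (𝓝 0) := by
    have := (tendsto_pow_atTop_nhds_zero_of_lt_one (r := (1 / 2 : ℝ)) (by norm_num)
      (by norm_num)).const_mul (α / 4) |>.const_mul 2
    simpa using this
  refine ⟨c, u, hcα, ?_, ?_, squeeze_zero_norm hu2 hlim⟩
  · obtain ⟨t, -, ht⟩ := isCompact_univ.exists_isMaxOn (univ_nonempty (α := unitInterval))
      (hJc.comp γ₀.1.continuous).continuousOn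
    refine ⟨t, t.2.1, (hcΦ γ₀).trans (ciSup_le fun r => ht (mem_univ r))⟩
  · rw [tendsto_iff_dist_tendsto_zero]
    exact squeeze_zero (fun _ => dist_nonneg) hu1 hlim

end MountainPass

/-! ### The critical exponent and the Gagliardo kernel -/

section CritExp

variable {N : ℕ} {s : ℝ}

theorem two_lt_critExp (hs : 0 < s) (hN : 2 * s < N) : 2 < critExp N s := by
  have h : 0 < (N : ℝ) - 2 * s := by linarith
  rw [critExp, lt_div_iff₀ h]
  linarith

theorem two_mul_div_eq (hs : 0 < s) (hN : 2 * s < N) : 2 * s / N = 1 - 2 / critExp N s := by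
  have h : 0 < (N : ℝ) - 2 * s := by linarith
  have hN0 : (0 : ℝ) < N := by linarith
  rw [critExp]
  field_simp
  ring

theorem div_eq_half_sub (hs : 0 < s) (hN : 2 * s < N) : s / N = 1 / 2 - 1 / critExp N s := by
  have := two_mul_div_eq hs hN
  rw [mul_div_assoc] at this
  rw [show 2 / critExp N s = 2 * (1 / critExp N s) by ring] at this
  linarith

end CritExp

section Kernel

variable {N : ℕ} {s : ℝ} {u v φ ψ : EuclideanSpace ℝ (Fin N) → ℝ}

theorem gagliardoKernel_self_nonneg (p : EuclideanSpace ℝ (Fin N) × EuclideanSpace ℝ (Fin N)) :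
    0 ≤ gagliardoKernel s u u p :=
  div_nonneg (mul_self_nonneg _) (by positivity)

theorem gagliardoKernel_congr (hu : u =ᵐ[volume] v) (hφ : φ =ᵐ[volume] ψ) :
    gagliardoKernel s u φ =ᵐ[volume] gagliardoKernel s v ψ := by
  have hu1 := (Measure.quasiMeasurePreserving_fst
    (μ := (volume : Measure (EuclideanSpace ℝ (Fin N))))
    (ν := (volume : Measure (EuclideanSpace ℝ (Fin N))))).ae_eq_comp hu
  have hu2 := (Measure.quasiMeasurePreserving_snd
    (μ := (volume : Measure (EuclideanSpace ℝ (Fin N))))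
    (ν := (volume : Measure (EuclideanSpace ℝ (Fin N))))).ae_eq_comp hu
  have hφ1 := (Measure.quasiMeasurePreserving_fst
    (μ := (volume : Measure (EuclideanSpace ℝ (Fin N))))
    (ν := (volume : Measure (EuclideanSpace ℝ (Fin N))))).ae_eq_comp hφ
  have hφ2 := (Measure.quasiMeasurePreserving_snd
    (μ := (volume : Measure (EuclideanSpace ℝ (Fin N))))
    (ν := (volume : Measure (EuclideanSpace ℝ (Fin N))))).ae_eq_comp hφ
  rw [Measure.volume_eq_prod]
  filter_upwards [hu1, hu2, hφ1, hφ2] with p h1 h2 h3 h4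
  simp only [Function.comp_apply] at h1 h2 h3 h4
  simp only [gagliardoKernel, h1, h2, h3, h4]

theorem gagliardoForm_congr (hu : u =ᵐ[volume] v) (hφ : φ =ᵐ[volume] ψ) :
    gagliardoForm s u φ = gagliardoForm s v ψ := by
  rw [gagliardoForm, gagliardoForm, integral_congr_ae (gagliardoKernel_congr hu hφ)]

theorem MemHs.congr (h : MemHs s u) (huv : u =ᵐ[volume] v) : MemHs s v :=
  ⟨(memLp_congr_ae huv).1 h.1, h.2.congr (gagliardoKernel_congr huv huv)⟩

theorem measurable_gagliardoKernel (hu : Measurable u) (hφ : Measurable φ) :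
    Measurable (gagliardoKernel s u φ) := by
  unfold gagliardoKernel
  fun_prop

/-- On the diagonal the kernel is `0 / 0 = 0`, and the inequality still holds there. -/
theorem sq_sub_le_mul_gagliardoKernel (hs : 0 < s) {x y : EuclideanSpace ℝ (Fin N)} {r : ℝ}
    (hr : ‖x - y‖ ≤ r) :
    (u x - u y) ^ 2 ≤ r ^ ((N : ℝ) + 2 * s) * gagliardoKernel s u u (x, y) := by
  have he : 0 < (N : ℝ) + 2 * s := by positivity
  rcases eq_or_ne x y with rfl | hxy
  · simp [gagliardoKernel]
  · have hpos : 0 < ‖x - y‖ := norm_pos_iff.2 (sub_ne_zero.2 hxy)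
    have h1 : ‖x - y‖ ^ ((N : ℝ) + 2 * s) ≤ r ^ ((N : ℝ) + 2 * s) :=
      Real.rpow_le_rpow hpos.le hr he.le
    have h2 : (u x - u y) ^ 2 = ‖x - y‖ ^ ((N : ℝ) + 2 * s) * gagliardoKernel s u u (x, y) := by
      have := (Real.rpow_pos_of_pos hpos ((N : ℝ) + 2 * s)).ne'
      simp only [gagliardoKernel]
      field_simp
    rw [h2]
    exact mul_le_mul_of_nonneg_right h1 (gagliardoKernel_self_nonneg _)

end Kernel

/-! ### Local averages, the Sobolev inequality and Rellich's theorem -/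

section Averages

variable {N : ℕ} {s : ℝ} {u : EuclideanSpace ℝ (Fin N) → ℝ}

theorem volume_real_ball (x : EuclideanSpace ℝ (Fin N)) {r : ℝ} (hr : 0 < r) :
    volume.real (Metric.ball x r) =
      r ^ N * volume.real (Metric.ball (0 : EuclideanSpace ℝ (Fin N)) 1) := by
  rw [measureReal_def, Measure.addHaar_ball_of_pos _ _ hr, ENNReal.toReal_mul,
    ENNReal.toReal_ofReal (by positivity), measureReal_def]
  simp

theorem volume_real_unitBall_pos :
    0 < volume.real (Metric.ball (0 : EuclideanSpace ℝ (Fin N)) 1) :=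
  ENNReal.toReal_pos (Metric.measure_ball_pos _ _ one_pos).ne' measure_ball_lt_top.ne

/-- The value of a function of finite Gagliardo seminorm is controlled by its integrals over
balls: integrate `u x ^ 2 - 2 * u x * u y ≤ (u x - u y) ^ 2` over the ball of radius `r`. -/
theorem MemHs.sq_le_average (hs : 0 < s) (hu : MemHs s u) :
    ∀ᵐ x, ∀ r : ℝ, 0 < r →
      volume.real (Metric.ball x r) * u x ^ 2 - 2 * u x * ∫ y in Metric.ball x r, u y ≤
        r ^ ((N : ℝ) + 2 * s) * ∫ y, gagliardoKernel s u u (x, y) := by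
  have hk := hu.2
  rw [Measure.volume_eq_prod] at hk
  filter_upwards [hk.prod_right_ae] with x hx r hr
  have hloc : IntegrableOn u (Metric.ball x r) :=
    (hu.1.locallyIntegrable one_le_two).integrableOn_isCompact
      (isCompact_closedBall x r) |>.mono_set Metric.ball_subset_closedBall
  have hc : IntegrableOn (fun _ => u x ^ 2) (Metric.ball x r) :=
    integrableOn_const measure_ball_lt_top.ne
  calc volume.real (Metric.ball x r) * u x ^ 2 - 2 * u x * ∫ y in Metric.ball x r, u y
      = ∫ y in Metric.ball x r, (u x ^ 2 - 2 * u x * u y) := by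
        rw [integral_sub hc (hloc.const_mul _), integral_const_mul, setIntegral_const,
          smul_eq_mul]
    _ ≤ ∫ y in Metric.ball x r, r ^ ((N : ℝ) + 2 * s) * gagliardoKernel s u u (x, y) := by
        refine setIntegral_mono_on (hc.sub (hloc.const_mul _)) (hx.integrableOn.const_mul _)
          measurableSet_ball fun y hy => ?_
        have hy' : ‖x - y‖ ≤ r := by
          rw [← dist_eq_norm, dist_comm]; exact (Metric.mem_ball.1 hy).le
        exact le_trans (by nlinarith [sq_nonneg (u y)]) (sq_sub_le_mul_gagliardoKernel hs hy')
    _ = r ^ ((N : ℝ) + 2 * s) * ∫ y in Metric.ball x r, gagliardoKernel s u u (x, y) :=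
        integral_const_mul _ _
    _ ≤ _ := by
        refine mul_le_mul_of_nonneg_left ?_ (by positivity)
        exact setIntegral_le_integral hx
          (Eventually.of_forall fun y => gagliardoKernel_self_nonneg _)

/-- Hölder's inequality against the constant function on a set of finite measure. -/
theorem abs_setIntegral_le_rpow {α : Type*} [MeasurableSpace α] {m : Measure α} {u : α → ℝ} {p : ℝ}
    (hp : 1 < p) (hum : AEStronglyMeasurable u m) (hup : Integrable (fun x => |u x| ^ p) m)
    {A : Set α} (hA : m A ≠ ⊤) :
    |∫ x in A, u x ∂m| ≤ (∫ x, |u x| ^ p ∂m) ^ (1 / p) * m.real A ^ (1 - 1 / p) := by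
  have hpq : p.HolderConjugate p.conjExponent := Real.HolderConjugate.conjExponent hp
  have hf : MemLp u (ENNReal.ofReal p) m := by
    rw [← integrable_norm_rpow_iff hum (by simpa using hpq.pos) ENNReal.ofReal_ne_top,
      ENNReal.toReal_ofReal hpq.nonneg]
    simpa using hup
  have : Fact (m A < ⊤) := ⟨hA.lt_top⟩
  have hg : MemLp (fun _ : α => (1 : ℝ)) (ENNReal.ofReal p.conjExponent) (m.restrict A) :=
    memLp_const _
  have h := integral_mul_le_Lp_mul_Lq_of_nonneg hpq (μ := m.restrict A) (f := fun x => |u x|)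
    (g := fun _ => (1 : ℝ)) (Eventually.of_forall fun x => abs_nonneg (u x))
    (Eventually.of_forall fun _ => zero_le_one) (hf.restrict A).abs hg
  have hq : 1 / p.conjExponent = 1 - 1 / p := by
    have := hpq.inv_add_inv_eq_one
    rw [one_div, one_div]; linarith
  simp only [mul_one, Real.one_rpow, hq, integral_const, smul_eq_mul,
    measureReal_restrict_apply_univ] at h
  refine (norm_integral_le_integral_norm u).trans (h.trans ?_)
  have hpos := hpq.pos
  refine mul_le_mul_of_nonneg_right (Real.rpow_le_rpow (integral_nonneg fun x => ?_) ?_ ?_) ?_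
  · positivity
  · exact integral_mono_measure Measure.restrict_le_self
      (Eventually.of_forall fun x => by positivity) hup
  · positivity
  · positivity

/-- The optimal choice of the radius in `MemHs.sq_le_average`. -/
theorem rpow_le_of_forall_radius (hs : 0 < s) (hN : 2 * s < N) {ω a g M : ℝ} (hω : 0 < ω)
    (ha : 0 < a) (hM : 0 < M)
    (h : ∀ r : ℝ, 0 < r → r ^ N * ω * a ^ 2 -
      2 * a * (M ^ (1 / critExp N s) * (r ^ N * ω) ^ (1 - 1 / critExp N s)) ≤
        r ^ ((N : ℝ) + 2 * s) * g) :
    a ^ critExp N s ≤ 2 * 4 ^ (critExp N s - 2) / ω ^ (1 + 2 * s / N) *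
      M ^ (1 - 2 / critExp N s) * g := by
  have hp2 := two_lt_critExp hs hN
  have hsN := two_mul_div_eq hs hN
  set p := critExp N s with hp
  have hN0 : (0 : ℝ) < N := by linarith
  have hp0 : 0 < p := by linarith
  -- the radius for which the average term is half of the left-hand side
  set V : ℝ := 4 ^ p * M / a ^ p with hV
  have hVpos : 0 < V := by positivity
  set r : ℝ := (V / ω) ^ (1 / (N : ℝ)) with hr
  have hrpos : 0 < r := by positivity
  have hrN : r ^ N * ω = V := by
    rw [hr, ← Real.rpow_natCast, ← Real.rpow_mul (by positivity), one_div_mul_cancel hN0.ne',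
      Real.rpow_one, div_mul_cancel₀ _ hω.ne']
  have hrs : r ^ ((N : ℝ) + 2 * s) = V / ω * (V / ω) ^ (2 * s / N) := by
    rw [hr, ← Real.rpow_mul (by positivity)]
    rw [show 1 / (N : ℝ) * (N + 2 * s) = 1 + 2 * s / N by field_simp, Real.rpow_add (by positivity),
      Real.rpow_one]
  have hVp : M ^ (1 / p) = V ^ (1 / p) * (a / 4) := by
    rw [hV, Real.div_rpow (by positivity) (by positivity), Real.mul_rpow (by positivity) hM.le,
      ← Real.rpow_mul (by norm_num), ← Real.rpow_mul ha.le, mul_one_div_cancel hp0.ne',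
      Real.rpow_one, Real.rpow_one]
    field_simp
  have hVV : V ^ (1 / p) * V ^ (1 - 1 / p) = V := by
    rw [← Real.rpow_add hVpos]; simp
  have h1 := h r hrpos
  rw [hrN, hrs, hVp] at h1
  have h2 : V * a ^ 2 - 2 * a * (V ^ (1 / p) * (a / 4) * V ^ (1 - 1 / p)) = V * (a ^ 2 / 2) := by
    rw [show V ^ (1 / p) * (a / 4) * V ^ (1 - 1 / p) = V ^ (1 / p) * V ^ (1 - 1 / p) * (a / 4) by
      ring, hVV]
    ring
  rw [h2, show V / ω * (V / ω) ^ (2 * s / N) * g = V * ((V / ω) ^ (2 * s / N) * g / ω) by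
    field_simp] at h1
  have h3 := le_of_mul_le_mul_left h1 hVpos
  have hVe : (V / ω) ^ (2 * s / N) = 4 ^ (p - 2) * M ^ (1 - 2 / p) / a ^ (p - 2) /
      ω ^ (2 * s / N) := by
    rw [Real.div_rpow hVpos.le hω.le, hV, Real.div_rpow (by positivity) (by positivity),
      Real.mul_rpow (by positivity) hM.le, ← Real.rpow_mul (by norm_num), ← Real.rpow_mul ha.le,
      hsN, show p * (1 - 2 / p) = p - 2 by field_simp]
  rw [hVe] at h3
  have hap : a ^ p = a ^ (p - 2) * a ^ 2 := by
    rw [← Real.rpow_natCast a 2, ← Real.rpow_add ha]; norm_num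
  have hωe : ω ^ (1 + 2 * s / N) = ω * ω ^ (2 * s / N) := by
    rw [Real.rpow_add hω, Real.rpow_one]
  have ha2 : 0 < a ^ (p - 2) := by positivity
  have hω2 : 0 < ω ^ (2 * s / N) := by positivity
  rw [hap, hωe]
  calc a ^ (p - 2) * a ^ 2 = 2 * a ^ (p - 2) * (a ^ 2 / 2) := by ring
    _ ≤ 2 * a ^ (p - 2) *
          (4 ^ (p - 2) * M ^ (1 - 2 / p) / a ^ (p - 2) / ω ^ (2 * s / N) * g / ω) := by
        gcongr
    _ = _ := by field_simp

/-- The (not optimal) constant that the averaging argument gives in the fractional Sobolev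
inequality. -/
noncomputable def sobolevConst (N : ℕ) (s : ℝ) : ℝ :=
  2 * 4 ^ (critExp N s - 2) /
    volume.real (Metric.ball (0 : EuclideanSpace ℝ (Fin N)) 1) ^ (1 + 2 * s / N)

theorem sobolevConst_pos : 0 < sobolevConst N s := by
  have := volume_real_unitBall_pos (N := N)
  unfold sobolevConst
  positivity

/-- The fractional Sobolev inequality for functions already known to be in `L^p`. -/
theorem MemHs.sobolev_of_integrable (hs : 0 < s) (hN : 2 * s < N) (hu : MemHs s u)
    (hup : Integrable fun x => |u x| ^ critExp N s) :
    (∫ x, |u x| ^ critExp N s) ^ (2 / critExp N s) ≤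
      sobolevConst N s * ∫ q, gagliardoKernel s u u q := by
  have hp2 := two_lt_critExp hs hN
  have hIk : 0 ≤ ∫ q, gagliardoKernel s u u q :=
    integral_nonneg fun q => gagliardoKernel_self_nonneg q
  set p := critExp N s with hp
  set M : ℝ := ∫ x, |u x| ^ p with hM
  have hM0 : 0 ≤ M := integral_nonneg fun x => by positivity
  rcases hM0.eq_or_lt with hMz | hMpos
  · rw [← hMz, Real.zero_rpow (by positivity)]
    exact mul_nonneg sobolevConst_pos.le hIk
  have hk := hu.2
  rw [Measure.volume_eq_prod] at hk
  have hpt : ∀ᵐ x, |u x| ^ p ≤ sobolevConst N s * M ^ (1 - 2 / p) *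
      ∫ y, gagliardoKernel s u u (x, y) := by
    filter_upwards [hu.sq_le_average hs] with x hx
    have hg : 0 ≤ ∫ y, gagliardoKernel s u u (x, y) :=
      integral_nonneg fun y => gagliardoKernel_self_nonneg _
    rcases eq_or_ne (u x) 0 with h0 | h0
    · rw [h0, abs_zero, Real.zero_rpow (by linarith)]
      have := sobolevConst_pos (N := N) (s := s)
      positivity
    refine rpow_le_of_forall_radius hs hN volume_real_unitBall_pos (abs_pos.2 h0) hMpos
      fun r hr => ?_
    have h1 := hx r hr
    have h2 := abs_setIntegral_le_rpow (A := Metric.ball x r) (by linarith : 1 < p) hu.1.1 hup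
      measure_ball_lt_top.ne
    rw [volume_real_ball x hr] at h1 h2
    rw [sq_abs]
    have h3 : 2 * u x * ∫ y in Metric.ball x r, u y ≤ 2 * |u x| * (M ^ (1 / p) *
        (r ^ N * volume.real (Metric.ball (0 : EuclideanSpace ℝ (Fin N)) 1)) ^ (1 - 1 / p)) := by
      refine (le_abs_self _).trans ?_
      rw [abs_mul, abs_mul, abs_two]
      gcongr
    linarith
  have hint : M ≤ sobolevConst N s * M ^ (1 - 2 / p) * ∫ q, gagliardoKernel s u u q := by
    have h1 := integral_mono_ae hup (hk.integral_prod_left.const_mul _) hpt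
    rwa [integral_const_mul, ← integral_prod _ hk] at h1
  have hMM : M = M ^ (1 - 2 / p) * M ^ (2 / p) := by
    rw [← Real.rpow_add hMpos]; simp
  have hMp : 0 < M ^ (1 - 2 / p) := by positivity
  refine le_of_mul_le_mul_left ?_ hMp
  rw [← hMM]
  linarith

theorem abs_clamp_sub_clamp_le (k a b : ℝ) :
    |max (-k) (min a k) - max (-k) (min b k)| ≤ |a - b| :=
  (abs_max_sub_max_le_max _ _ _ _).trans (max_le (by simp)
    ((abs_min_sub_min_le_max _ _ _ _).trans (max_le le_rfl (by simp))))

theorem abs_clamp_le (k a : ℝ) (hk : 0 ≤ k) : |max (-k) (min a k)| ≤ |a| := by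
  simpa [hk] using abs_clamp_sub_clamp_le k a 0

/-- **The fractional Sobolev inequality**, with membership in `L^p` as part of the conclusion. -/
theorem MemHs.sobolev (hs : 0 < s) (hN : 2 * s < N) (hu : MemHs s u) :
    (Integrable fun x => |u x| ^ critExp N s) ∧
    (∫ x, |u x| ^ critExp N s) ^ (2 / critExp N s) ≤
      sobolevConst N s * ∫ q, gagliardoKernel s u u q := by
  suffices h : Integrable fun x => |u x| ^ critExp N s from ⟨h, hu.sobolev_of_integrable hs hN h⟩
  have hp2 := two_lt_critExp hs hN
  set p := critExp N s with hp
  have hp0 : 0 < p := by linarith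
  set I : ℝ := ∫ q, gagliardoKernel s u u q with hI
  have hI0 : 0 ≤ I := integral_nonneg fun q => gagliardoKernel_self_nonneg q
  -- truncations lie in `L^p`, so the inequality for them is already known
  set w : ℕ → EuclideanSpace ℝ (Fin N) → ℝ := fun k x => max (-(k : ℝ)) (min (u x) k) with hw
  have hum := hu.1.1
  have hwm : ∀ k, AEStronglyMeasurable (w k) := fun k => by
    have : Continuous fun t : ℝ => max (-(k : ℝ)) (min t k) := by fun_prop
    exact this.comp_aestronglyMeasurable hum
  have hwle : ∀ k x, |w k x| ≤ |u x| := fun k x => abs_clamp_le _ _ (Nat.cast_nonneg k)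
  have hwk : ∀ k x, |w k x| ≤ k := fun k x => by
    have hk : (0 : ℝ) ≤ k := Nat.cast_nonneg k
    exact abs_le.2 ⟨le_max_left _ _, max_le (by linarith) (min_le_right _ _)⟩
  have hker : ∀ k q, gagliardoKernel s (w k) (w k) q ≤ gagliardoKernel s u u q := fun k q => by
    simp only [gagliardoKernel]
    refine div_le_div_of_nonneg_right ?_ (by positivity)
    exact abs_le_iff_mul_self_le.1 (abs_clamp_sub_clamp_le _ _ _)
  have hwHs : ∀ k, MemHs s (w k) := fun k => by
    refine ⟨hu.1.mono (hwm k) (Eventually.of_forall fun x => by simpa using hwle k x), ?_⟩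
    refine hu.2.mono ?_ (Eventually.of_forall fun q => ?_)
    · obtain ⟨g, hg, hgw⟩ := (hwm k).aemeasurable
      exact (measurable_gagliardoKernel hg hg).aestronglyMeasurable.congr
        (gagliardoKernel_congr hgw hgw).symm
    · rw [Real.norm_of_nonneg (gagliardoKernel_self_nonneg q),
        Real.norm_of_nonneg (gagliardoKernel_self_nonneg q)]
      exact hker k q
  have hpm : Continuous fun t : ℝ => |t| ^ p := continuous_abs.rpow_const fun _ => Or.inr hp0.le
  have hwp : ∀ k, Integrable fun x => |w k x| ^ p := fun k => by
    refine (hu.1.integrable_sq.const_mul ((k : ℝ) ^ (p - 2))).mono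
      (hpm.comp_aestronglyMeasurable (hwm k)) (Eventually.of_forall fun x => ?_)
    rw [Real.norm_of_nonneg (by positivity), Real.norm_of_nonneg (by positivity)]
    rcases eq_or_ne (w k x) 0 with h0 | h0
    · rw [h0, abs_zero, Real.zero_rpow hp0.ne']; positivity
    · have h1 : |w k x| ^ p = |w k x| ^ (p - 2) * |w k x| ^ 2 := by
        rw [← Real.rpow_natCast _ 2, ← Real.rpow_add (abs_pos.2 h0)]; norm_num
      rw [h1, ← sq_abs (u x)]
      exact mul_le_mul (Real.rpow_le_rpow (abs_nonneg _) (hwk k x) (by linarith))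
        (pow_le_pow_left₀ (abs_nonneg _) (hwle k x) 2) (by positivity) (by positivity)
  have hbound : ∀ k, ∫⁻ x, ENNReal.ofReal (|w k x| ^ p) ≤
      ENNReal.ofReal ((sobolevConst N s * I) ^ (p / 2)) := fun k => by
    rw [← ofReal_integral_eq_lintegral_ofReal (hwp k) (Eventually.of_forall fun x => by positivity)]
    refine ENNReal.ofReal_le_ofReal ?_
    have h1 := (hwHs k).sobolev_of_integrable hs hN (hwp k)
    have h2 : ∫ q, gagliardoKernel s (w k) (w k) q ≤ I :=
      integral_mono (hwHs k).2 hu.2 (hker k)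
    have h3 : 0 ≤ ∫ x, |w k x| ^ p := integral_nonneg fun x => by positivity
    have h4 : (∫ x, |w k x| ^ p) = ((∫ x, |w k x| ^ p) ^ (2 / p)) ^ (p / 2) := by
      rw [← Real.rpow_mul h3, div_mul_div_cancel₀ hp0.ne', div_self two_ne_zero, Real.rpow_one]
    rw [h4]
    have := sobolevConst_pos (N := N) (s := s)
    exact Real.rpow_le_rpow (by positivity) (h1.trans (by gcongr)) (by positivity)
  refine ⟨hpm.comp_aestronglyMeasurable hum, ?_⟩
  rw [hasFiniteIntegral_iff_ofReal (Eventually.of_forall fun x => by positivity)]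
  have hlim : ∀ x, liminf (fun k => ENNReal.ofReal (|w k x| ^ p)) atTop =
      ENNReal.ofReal (|u x| ^ p) := fun x => by
    refine Tendsto.liminf_eq (tendsto_const_nhds.congr' ?_)
    obtain ⟨k₀, hk₀⟩ := exists_nat_ge |u x|
    filter_upwards [eventually_ge_atTop k₀] with k hk
    have hk' : |u x| ≤ k := hk₀.trans (by exact_mod_cast hk)
    have : w k x = u x := by
      simp only [hw]
      rw [min_eq_left (abs_le.1 hk').2, max_eq_right (abs_le.1 hk').1]
    rw [this]
  calc ∫⁻ x, ENNReal.ofReal (|u x| ^ p)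
      = ∫⁻ x, liminf (fun k => ENNReal.ofReal (|w k x| ^ p)) atTop := by simp_rw [hlim]
    _ ≤ liminf (fun k => ∫⁻ x, ENNReal.ofReal (|w k x| ^ p)) atTop :=
        lintegral_liminf_le' fun k =>
          (hpm.comp_aestronglyMeasurable (hwm k)).aemeasurable.ennreal_ofReal
    _ ≤ ENNReal.ofReal ((sobolevConst N s * I) ^ (p / 2)) := by
        refine liminf_le_of_le (by isBoundedDefault) fun b hb => ?_
        obtain ⟨k, hk⟩ := hb.exists
        exact hk.trans (hbound k)
    _ < ⊤ := ENNReal.ofReal_lt_top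

/-- **Rellich's theorem**: a sequence bounded in `H^s` whose averages over balls tend to zero tends
to zero in `L^2` of every bounded set. -/
theorem tendsto_integral_sq_of_tendsto_average (hs : 0 < s) {Ω : Set (EuclideanSpace ℝ (Fin N))}
    (hΩb : Bornology.IsBounded Ω) {w : ℕ → EuclideanSpace ℝ (Fin N) → ℝ}
    (hw : ∀ n, MemHs s (w n)) {K : ℝ} (hK1 : ∀ n, ∫ x, w n x ^ 2 ≤ K)
    (hK2 : ∀ n, ∫ q, gagliardoKernel s (w n) (w n) q ≤ K)
    (hav : ∀ x r, Tendsto (fun n => ∫ y in Metric.ball x r, w n y) atTop (𝓝 0)) :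
    Tendsto (fun n => ∫ x in Ω, w n x ^ 2) atTop (𝓝 0) := by
  set ω : ℝ := volume.real (Metric.ball (0 : EuclideanSpace ℝ (Fin N)) 1) with hω
  have hωpos : 0 < ω := volume_real_unitBall_pos
  have hK0 : 0 ≤ K := (integral_nonneg fun q => gagliardoKernel_self_nonneg q).trans (hK2 0)
  have hfin : IsFiniteMeasure (volume.restrict Ω) := ⟨by simpa using hΩb.measure_lt_top⟩
  -- the averages tend to zero in `L^2`
  have hI : ∀ r : ℝ, 0 < r →
      Tendsto (fun n => ∫ x in Ω, (∫ y in Metric.ball x r, w n y) ^ 2) atTop (𝓝 0) ∧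
      ∀ n, IntegrableOn (fun x => (∫ y in Metric.ball x r, w n y) ^ 2) Ω := fun r hr => by
    set V : ℝ := r ^ N * ω with hV
    have hVpos : 0 < V := by positivity
    have hbd : ∀ n x, ‖(∫ y in Metric.ball x r, w n y) ^ 2‖ ≤ K * V := fun n x => by
      have h2 := abs_setIntegral_le_rpow (A := Metric.ball x r) one_lt_two (hw n).1.1
        (by simpa using (hw n).1.integrable_sq) measure_ball_lt_top.ne
      rw [volume_real_ball x hr, ← hω, ← hV] at h2
      simp only [Real.rpow_two, sq_abs, show (1 : ℝ) - 1 / 2 = 1 / 2 by norm_num] at h2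
      rw [Real.norm_eq_abs, abs_of_nonneg (sq_nonneg _), ← sq_abs]
      have h3 : 0 ≤ ∫ x, w n x ^ 2 := integral_nonneg fun x => sq_nonneg _
      calc |∫ y in Metric.ball x r, w n y| ^ 2
          ≤ ((∫ x, w n x ^ 2) ^ (1 / 2 : ℝ) * V ^ (1 / 2 : ℝ)) ^ 2 := by gcongr
        _ = (∫ x, w n x ^ 2) * V := by
          rw [mul_pow, ← Real.sqrt_eq_rpow, ← Real.sqrt_eq_rpow, Real.sq_sqrt h3,
            Real.sq_sqrt hVpos.le]
        _ ≤ K * V := by gcongr; exact hK1 n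
    have hmeas : ∀ n, AEStronglyMeasurable (fun x => (∫ y in Metric.ball x r, w n y) ^ 2)
        (volume.restrict Ω) := fun n => by
      obtain ⟨g, hg, hwg⟩ := (hw n).1.1
      have h1 : ∀ x, ∫ y in Metric.ball x r, w n y =
          ∫ y, {q : EuclideanSpace ℝ (Fin N) × EuclideanSpace ℝ (Fin N) |
            dist q.2 q.1 < r}.indicator (fun q => g q.2) (x, y) := fun x => by
        rw [← integral_indicator measurableSet_ball]
        refine integral_congr_ae ?_
        filter_upwards [hwg] with y hy
        simp only [indicator, Metric.mem_ball, mem_ofPred_eq, hy]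
      simp_rw [h1]
      have h2 : StronglyMeasurable
          ({q : EuclideanSpace ℝ (Fin N) × EuclideanSpace ℝ (Fin N) | dist q.2 q.1 < r}.indicator
            (fun q => g q.2)) :=
        (hg.comp_measurable measurable_snd).indicator
          (measurableSet_lt (by fun_prop) measurable_const)
      exact ((h2.integral_prod_right' (ν := volume)).pow 2).aestronglyMeasurable
    refine ⟨?_, fun n => Integrable.of_bound (hmeas n) (K * V)
      (Eventually.of_forall fun x => hbd n x)⟩
    have h0 : ∫ x in Ω, (0 : ℝ) = 0 := by simp
    rw [← h0]
    refine tendsto_integral_of_dominated_convergence (fun _ => K * V) hmeas (integrable_const _)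
      (fun n => Eventually.of_forall fun x => hbd n x) (Eventually.of_forall fun x => ?_)
    simpa using (hav x r).pow 2
  -- up to the averages at scale `r`, the integral is of order `r^{2s}`, uniformly in `n`
  have hest : ∀ r : ℝ, 0 < r → ∀ n, ∫ x in Ω, w n x ^ 2 ≤
      2 * r ^ (2 * s) / ω * K + 4 / (r ^ N * ω) ^ 2 *
        ∫ x in Ω, (∫ y in Metric.ball x r, w n y) ^ 2 := fun r hr n => by
    have hk := (hw n).2
    rw [Measure.volume_eq_prod] at hk
    have hkl := hk.integral_prod_left
    have hpt : ∀ᵐ x, w n x ^ 2 ≤ 2 * r ^ (2 * s) / ω * (∫ y, gagliardoKernel s (w n) (w n) (x, y)) +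
        4 / (r ^ N * ω) ^ 2 * (∫ y in Metric.ball x r, w n y) ^ 2 := by
      filter_upwards [(hw n).sq_le_average hs] with x hx
      have h1 := hx r hr
      rw [volume_real_ball x hr, ← hω, Real.rpow_add hr, Real.rpow_natCast] at h1
      set I := ∫ y in Metric.ball x r, w n y
      set g := ∫ y, gagliardoKernel s (w n) (w n) (x, y)
      have hV : 0 < r ^ N * ω := by positivity
      have h2 : 2 * w n x * I ≤ r ^ N * ω * (w n x ^ 2 / 2) + 2 / (r ^ N * ω) * I ^ 2 := by
        have : r ^ N * ω * (w n x ^ 2 / 2) + 2 / (r ^ N * ω) * I ^ 2 - 2 * w n x * I =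
            (r ^ N * ω * w n x - 2 * I) ^ 2 / (2 * (r ^ N * ω)) := by field_simp; ring
        have : 0 ≤ (r ^ N * ω * w n x - 2 * I) ^ 2 / (2 * (r ^ N * ω)) := by positivity
        linarith
      have h3 : r ^ N * ω * w n x ^ 2 ≤ r ^ N * ω *
          (2 * r ^ (2 * s) / ω * g + 4 / (r ^ N * ω) ^ 2 * I ^ 2) := by
        have : r ^ N * ω * (2 * r ^ (2 * s) / ω * g + 4 / (r ^ N * ω) ^ 2 * I ^ 2) =
            2 * (r ^ N * r ^ (2 * s) * g + 2 / (r ^ N * ω) * I ^ 2) := by field_simp; ring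
        rw [this]
        linarith
      exact le_of_mul_le_mul_left h3 hV
    have hi1 : IntegrableOn (fun x => 2 * r ^ (2 * s) / ω *
        ∫ y, gagliardoKernel s (w n) (w n) (x, y)) Ω := (hkl.const_mul _).integrableOn
    have hi2 := ((hI r hr).2 n).const_mul (4 / (r ^ N * ω) ^ 2)
    refine (integral_mono_ae (hw n).1.integrable_sq.integrableOn (hi1.add hi2)
      (ae_restrict_of_ae hpt)).trans ?_
    simp only [Pi.add_apply]
    rw [integral_add hi1 hi2, integral_const_mul, integral_const_mul]
    gcongr
    refine (setIntegral_le_integral hkl (Eventually.of_forall fun x =>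
      integral_nonneg fun y => gagliardoKernel_self_nonneg _)).trans ?_
    rw [← integral_prod _ hk]
    exact hK2 n
  rw [Metric.tendsto_atTop]
  intro ε hε
  have hr0 : Tendsto (fun r : ℝ => 2 * r ^ (2 * s) / ω * K) (𝓝 0) (𝓝 0) := by
    have hc : Continuous fun r : ℝ => 2 * r ^ (2 * s) / ω * K := by
      have : Continuous fun r : ℝ => r ^ (2 * s) :=
        continuous_id.rpow_const fun _ => Or.inr (by positivity)
      fun_prop
    have := hc.tendsto 0
    rwa [Real.zero_rpow (by positivity), mul_zero, zero_div, zero_mul] at this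
  obtain ⟨r, hr, hrε⟩ := ((hr0.mono_left nhdsWithin_le_nhds).eventually
    (gt_mem_nhds (half_pos hε)) |>.and self_mem_nhdsWithin).exists (f := 𝓝[>] (0 : ℝ)) |>.imp
      fun r h => And.intro h.2 h.1
  have hlim := (hI r hr).1.const_mul (4 / (r ^ N * ω) ^ 2)
  rw [mul_zero] at hlim
  obtain ⟨n₀, hn₀⟩ := eventually_atTop.1 (hlim.eventually (gt_mem_nhds (half_pos hε)))
  refine ⟨n₀, fun n hn => ?_⟩
  have h0 : 0 ≤ ∫ x in Ω, w n x ^ 2 := integral_nonneg fun x => sq_nonneg _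
  rw [Real.dist_eq, sub_zero, abs_of_nonneg h0]
  linarith [hest r hr n, hn₀ n hn]

end Averages

/-! ### One-dimensional integrals: Gamma, Beta and the subordination of a power -/

section OneDim

/-- `∫_0^∞ r^{-b-1} e^{-c/r} dr = c^{-b} Γ(b)`, by the substitution `r ↦ 1/r`. -/
theorem integrableOn_and_integral_rpow_mul_exp_neg_div {b c : ℝ} (hb : 0 < b) (hc : 0 < c) :
    IntegrableOn (fun r : ℝ => r ^ (-b - 1) * Real.exp (-(c / r))) (Ioi 0) ∧
      ∫ r in Ioi (0 : ℝ), r ^ (-b - 1) * Real.exp (-(c / r)) = c ^ (-b) * Real.Gamma b := by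
  have hval : ∫ r in Ioi (0 : ℝ), r ^ (-b - 1) * Real.exp (-(c / r)) = c ^ (-b) * Real.Gamma b := by
    rw [← integral_comp_rpow_Ioi _ (neg_ne_zero.2 one_ne_zero)]
    rw [Real.rpow_neg hc.le, ← Real.inv_rpow hc.le, inv_eq_one_div,
      ← Real.integral_rpow_mul_exp_neg_mul_Ioi hb hc]
    refine setIntegral_congr_fun measurableSet_Ioi fun x hx => ?_
    have hx0 : (0 : ℝ) < x := hx
    simp only [abs_neg, abs_one, one_mul, smul_eq_mul]
    rw [← mul_assoc, ← Real.rpow_mul hx0.le, ← Real.rpow_add hx0, Real.rpow_neg_one, div_inv_eq_mul]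
    congr 2
    ring
  refine ⟨?_, hval⟩
  refine not_imp_comm.1 integral_undef ?_
  rw [hval]
  exact (mul_pos (Real.rpow_pos_of_pos hc _) (Real.Gamma_pos_of_pos hb)).ne'

/-- The real Beta integral. -/
theorem integrableOn_and_integral_beta {a b : ℝ} (ha : 0 < a) (hb : 0 < b) :
    IntervalIntegrable (fun x : ℝ => x ^ (a - 1) * (1 - x) ^ (b - 1)) volume 0 1 ∧
      ∫ x in (0 : ℝ)..1, x ^ (a - 1) * (1 - x) ^ (b - 1) =
        Real.Gamma a * Real.Gamma b / Real.Gamma (a + b) := by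
  have hcast : ∀ x ∈ Ioo (0 : ℝ) 1, ((x : ℂ) ^ ((a : ℂ) - 1) * (1 - (x : ℂ)) ^ ((b : ℂ) - 1)) =
      ((x ^ (a - 1) * (1 - x) ^ (b - 1) : ℝ) : ℂ) := fun x hx => by
    have h1 : (0 : ℝ) ≤ 1 - x := by linarith [hx.2]
    rw [Complex.ofReal_mul, Complex.ofReal_cpow hx.1.le, Complex.ofReal_cpow h1]
    push_cast
    rfl
  have hval : ∫ x in (0 : ℝ)..1, x ^ (a - 1) * (1 - x) ^ (b - 1) =
      Real.Gamma a * Real.Gamma b / Real.Gamma (a + b) := by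
    have h := ProbabilityTheory.beta_eq_betaIntegralReal a b ha hb
    rw [ProbabilityTheory.beta] at h
    rw [h, Complex.betaIntegral, intervalIntegral.integral_of_le zero_le_one,
      intervalIntegral.integral_of_le zero_le_one, integral_Ioc_eq_integral_Ioo,
      integral_Ioc_eq_integral_Ioo, setIntegral_congr_fun measurableSet_Ioo hcast,
      integral_complex_ofReal, Complex.ofReal_re]
  refine ⟨?_, hval⟩
  by_contra hcon
  rw [intervalIntegral.integral_undef hcon] at hval
  have h1 := Real.Gamma_pos_of_pos ha
  have h2 := Real.Gamma_pos_of_pos hb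
  have h3 := Real.Gamma_pos_of_pos (add_pos ha hb)
  have : 0 < Real.Gamma a * Real.Gamma b / Real.Gamma (a + b) := by positivity
  linarith

/-- The function `τ ↦ 1 - (1 - τ)_+^{β - 1}`. -/
noncomputable def powDefect (β τ : ℝ) : ℝ := if τ < 1 then 1 - (1 - τ) ^ (β - 1) else 1

theorem measurable_powDefect (β : ℝ) : Measurable (powDefect β) :=
  Measurable.ite measurableSet_Iio (by fun_prop) measurable_const

theorem powDefect_le_one (β τ : ℝ) : powDefect β τ ≤ 1 := by
  unfold powDefect
  split_ifs with h
  · have : 0 ≤ (1 - τ) ^ (β - 1) := Real.rpow_nonneg (by linarith) _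
    linarith
  · exact le_rfl

theorem one_sub_rpow_bounds {β τ : ℝ} (hβ : 0 < β) (h0 : 0 ≤ τ) (h1 : τ ≤ 1) :
    0 ≤ 1 - (1 - τ) ^ β ∧ 1 - (1 - τ) ^ β ≤ max 1 β * τ := by
  refine ⟨by linarith [Real.rpow_le_one (by linarith) (by linarith : 1 - τ ≤ 1) hβ.le], ?_⟩
  rcases le_total 1 β with h | h
  · have := one_add_mul_self_le_rpow_one_add (s := -τ) (by linarith) h
    rw [← sub_eq_add_neg] at this
    rw [max_eq_right h]
    linarith
  · have := Real.rpow_le_rpow_of_exponent_ge' (by linarith : 0 ≤ 1 - τ) (by linarith) hβ.le h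
    rw [Real.rpow_one] at this
    rw [max_eq_left h]
    linarith

/-- `∫_0^∞ τ^{-1-s} (1 - (1 - τ)_+^{β-1}) dτ = Γ(1-s) Γ(β) / (s Γ(β-s))`. This is
an integration by parts, arranged so that it also covers `β ≤ 1`. -/
theorem integrableOn_and_integral_powDefect {β s : ℝ} (hs0 : 0 < s) (hs1 : s < 1) (hβ : s < β) :
    IntegrableOn (fun τ : ℝ => τ ^ (-1 - s) * powDefect β τ) (Ioi 0) ∧
      ∫ τ in Ioi (0 : ℝ), τ ^ (-1 - s) * powDefect β τ =
        Real.Gamma (1 - s) * Real.Gamma β / (s * Real.Gamma (β - s)) := by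
  have hβ0 : 0 < β := by linarith
  obtain ⟨hBi, hBv⟩ := integrableOn_and_integral_beta (a := 1 - s) (b := β) (by linarith) hβ0
  rw [show 1 - s - 1 = -s by ring] at hBi hBv
  -- the antiderivative of the regular part
  set Q : ℝ → ℝ := fun τ => -(τ ^ (-s) * (1 - (1 - τ) ^ β)) / s with hQ
  set Q' : ℝ → ℝ := fun τ => τ ^ (-1 - s) * (1 - (1 - τ) ^ β) -
    β / s * (τ ^ (-s) * (1 - τ) ^ (β - 1)) with hQ'
  have hderiv : ∀ τ ∈ Ioo (0 : ℝ) 1, HasDerivAt Q (Q' τ) τ := fun τ hτ => by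
    have h1 : HasDerivAt (fun τ : ℝ => τ ^ (-s)) (-s * τ ^ (-s - 1)) τ :=
      Real.hasDerivAt_rpow_const (Or.inl hτ.1.ne')
    have h2 : HasDerivAt (fun τ : ℝ => (1 - τ) ^ β) (-1 * β * (1 - τ) ^ (β - 1)) τ :=
      ((hasDerivAt_id τ).const_sub 1).rpow_const
        (Or.inl (by simpa using (by linarith [hτ.2] : 1 - τ ≠ 0)))
    have h3 := ((h1.mul (h2.const_sub 1)).neg).div_const s
    refine h3.congr_deriv ?_
    rw [hQ', show -1 - s = -s - 1 by ring]
    field_simp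
    ring
  have hreg : IntervalIntegrable (fun τ : ℝ => τ ^ (-1 - s) * (1 - (1 - τ) ^ β)) volume 0 1 := by
    have h1 : IntervalIntegrable (fun τ : ℝ => max 1 β * τ ^ (-s)) volume 0 1 :=
      (intervalIntegral.intervalIntegrable_rpow' (by linarith)).const_mul _
    rw [intervalIntegrable_iff_integrableOn_Ioc_of_le zero_le_one] at h1 ⊢
    refine h1.mono' (by fun_prop) ?_
    filter_upwards [ae_restrict_mem measurableSet_Ioc] with τ hτ
    obtain ⟨hb1, hb2⟩ := one_sub_rpow_bounds hβ0 hτ.1.le hτ.2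
    have hp : 0 < τ ^ (-1 - s) := Real.rpow_pos_of_pos hτ.1 _
    rw [Real.norm_of_nonneg (by positivity)]
    calc τ ^ (-1 - s) * (1 - (1 - τ) ^ β) ≤ τ ^ (-1 - s) * (max 1 β * τ) := by gcongr
      _ = max 1 β * (τ ^ (-1 - s) * τ ^ (1 : ℝ)) := by rw [Real.rpow_one]; ring
      _ = max 1 β * τ ^ (-s) := by rw [← Real.rpow_add hτ.1]; congr 2; ring
  have hQi : IntervalIntegrable Q' volume 0 1 := hreg.sub (hBi.const_mul _)
  have hlim0 : Tendsto Q (𝓝[>] 0) (𝓝 0) := by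
    have hb : Tendsto (fun τ : ℝ => max 1 β / s * τ ^ (1 - s)) (𝓝[>] 0) (𝓝 0) := by
      have hc : Continuous fun τ : ℝ => max 1 β / s * τ ^ (1 - s) :=
        continuous_const.mul (continuous_id.rpow_const fun _ => Or.inr (by linarith))
      have := hc.tendsto 0
      rw [Real.zero_rpow (by linarith), mul_zero] at this
      exact this.mono_left nhdsWithin_le_nhds
    refine squeeze_zero_norm' ?_ hb
    filter_upwards [Ioo_mem_nhdsGT (zero_lt_one (α := ℝ))] with τ hτ
    obtain ⟨hb1, hb2⟩ := one_sub_rpow_bounds hβ0 hτ.1.le hτ.2.le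
    have hp : 0 < τ ^ (-s) := Real.rpow_pos_of_pos hτ.1 _
    rw [hQ, norm_div, norm_neg, Real.norm_of_nonneg (by positivity), Real.norm_of_nonneg hs0.le]
    calc τ ^ (-s) * (1 - (1 - τ) ^ β) / s ≤ τ ^ (-s) * (max 1 β * τ) / s := by gcongr
      _ = max 1 β / s * (τ ^ (-s) * τ ^ (1 : ℝ)) := by rw [Real.rpow_one]; ring
      _ = max 1 β / s * τ ^ (1 - s) := by rw [← Real.rpow_add hτ.1]; congr 2; ring
  have hlim1 : Tendsto Q (𝓝[<] 1) (𝓝 (-(1 / s))) := by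
    have hc : ContinuousAt Q 1 := by
      have h1 : ContinuousAt (fun τ : ℝ => τ ^ (-s)) 1 :=
        Real.continuousAt_rpow_const _ _ (Or.inl one_ne_zero)
      have h2 : Continuous fun τ : ℝ => (1 - τ) ^ β :=
        (continuous_const.sub continuous_id).rpow_const fun _ => Or.inr hβ0.le
      exact ((h1.mul (continuousAt_const.sub h2.continuousAt)).neg).div_const s
    have h := hc.tendsto.mono_left (nhdsWithin_le_nhds (s := Iio 1))
    have hv : Q 1 = -(1 / s) := by
      simp [hQ, Real.zero_rpow hβ0.ne', neg_div]
    rwa [hv] at h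
  have hQv := intervalIntegral.integral_eq_sub_of_hasDerivAt_of_tendsto one_pos hderiv hQi hlim0
    hlim1
  -- the integral over `(0, 1)`
  have hsplit : ∀ τ ∈ Ioo (0 : ℝ) 1, Q' τ + (β / s - 1) * (τ ^ (-s) * (1 - τ) ^ (β - 1)) =
      τ ^ (-1 - s) * powDefect β τ := fun τ hτ => by
    have h1 : (1 - τ) ^ β = (1 - τ) ^ (β - 1) * (1 - τ) := by
      conv_lhs => rw [show β = β - 1 + 1 by ring,
        Real.rpow_add (by linarith [hτ.2] : (0 : ℝ) < 1 - τ), Real.rpow_one]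
    have h2 : τ ^ (-s) = τ ^ (-1 - s) * τ := by
      conv_lhs => rw [show -s = -1 - s + 1 by ring, Real.rpow_add hτ.1, Real.rpow_one]
    rw [powDefect, if_pos hτ.2, hQ']
    simp only
    rw [h1, h2]
    ring
  have hint := hQi.add (hBi.const_mul (β / s - 1))
  have hint1 : IntegrableOn (fun τ : ℝ => τ ^ (-1 - s) * powDefect β τ) (Ioo 0 1) := by
    rw [intervalIntegrable_iff_integrableOn_Ioo_of_le zero_le_one] at hint
    exact hint.congr_fun hsplit measurableSet_Ioo
  have hval1 : ∫ τ in Ioo (0 : ℝ) 1, τ ^ (-1 - s) * powDefect β τ = -(1 / s) +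
      (β / s - 1) * (Real.Gamma (1 - s) * Real.Gamma β / Real.Gamma (1 - s + β)) := by
    rw [← setIntegral_congr_fun measurableSet_Ioo hsplit, ← integral_Ioc_eq_integral_Ioo,
      ← intervalIntegral.integral_of_le zero_le_one,
      intervalIntegral.integral_add hQi (hBi.const_mul _), intervalIntegral.integral_const_mul,
      hQv, hBv]
    ring
  -- the integral over `[1, ∞)`
  have htail : ∀ τ ∈ Ioi (1 : ℝ), τ ^ (-1 - s) = τ ^ (-1 - s) * powDefect β τ := fun τ hτ => by
    rw [powDefect, if_neg (not_lt.2 (le_of_lt hτ)), mul_one]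
  have hint2 : IntegrableOn (fun τ : ℝ => τ ^ (-1 - s) * powDefect β τ) (Ioi 1) :=
    (integrableOn_Ioi_rpow_of_lt (by linarith) one_pos).congr_fun htail measurableSet_Ioi
  have hval2 : ∫ τ in Ioi (1 : ℝ), τ ^ (-1 - s) * powDefect β τ = 1 / s := by
    rw [← setIntegral_congr_fun measurableSet_Ioi htail, integral_Ioi_rpow_of_lt (by linarith)
      one_pos, Real.one_rpow]
    rw [show -1 - s + 1 = -s by ring]
    field_simp
  have hint1' : IntegrableOn (fun τ : ℝ => τ ^ (-1 - s) * powDefect β τ) (Ioc 0 1) :=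
    (integrableOn_Ioc_iff_integrableOn_Ioo).2 hint1
  have hun : Ioi (0 : ℝ) = Ioc 0 1 ∪ Ioi 1 := (Ioc_union_Ioi_eq_Ioi zero_le_one).symm
  refine ⟨by rw [hun]; exact hint1'.union hint2, ?_⟩
  rw [hun, setIntegral_union Ioc_disjoint_Ioi_same measurableSet_Ioi hint1' hint2,
    integral_Ioc_eq_integral_Ioo, hval1, hval2]
  have hG : Real.Gamma (1 - s + β) = (β - s) * Real.Gamma (β - s) := by
    rw [← Real.Gamma_add_one (by linarith)]; congr 1; ring
  have hGp := Real.Gamma_pos_of_pos (by linarith : 0 < β - s)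
  have hbs : β - s ≠ 0 := by linarith
  rw [hG]
  field_simp
  ring

theorem integrableOn_and_integral_rpow_mul_comp_div {s r : ℝ} (hr : 0 < r)
    {g : ℝ → ℝ} (hi : IntegrableOn (fun τ : ℝ => τ ^ (-1 - s) * g τ) (Ioi 0)) :
    IntegrableOn (fun t : ℝ => t ^ (-1 - s) * g (t / r)) (Ioi 0) ∧
      ∫ t in Ioi (0 : ℝ), t ^ (-1 - s) * g (t / r) =
        r ^ (-s) * ∫ τ in Ioi (0 : ℝ), τ ^ (-1 - s) * g τ := by
  have hr' : 0 < r⁻¹ := inv_pos.2 hr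
  have hcongr : ∀ t ∈ Ioi (0 : ℝ), r ^ (-1 - s) * ((r⁻¹ * t) ^ (-1 - s) * g (r⁻¹ * t)) =
      t ^ (-1 - s) * g (t / r) := fun t ht => by
    rw [← mul_assoc, ← Real.mul_rpow hr.le (mul_pos hr' ht).le, mul_inv_cancel_left₀ hr.ne',
      inv_mul_eq_div]
  refine ⟨?_, ?_⟩
  · have h := (integrableOn_Ioi_comp_mul_left_iff (fun τ : ℝ => τ ^ (-1 - s) * g τ) 0 hr').2
      (by simpa using hi)
    exact IntegrableOn.congr_fun (h.const_mul (r ^ (-1 - s))) hcongr measurableSet_Ioi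
  · rw [← setIntegral_congr_fun measurableSet_Ioi hcongr, integral_const_mul,
      integral_comp_mul_left_Ioi (fun τ : ℝ => τ ^ (-1 - s) * g τ) 0 hr', mul_zero, inv_inv,
      smul_eq_mul, ← mul_assoc]
    congr 1
    conv_rhs => rw [show -s = -1 - s + 1 by ring, Real.rpow_add hr, Real.rpow_one]

end OneDim

/-! ### The heat kernel and the sharp fractional Hardy inequality -/

section Heat

variable {N : ℕ}

/-- The heat kernel `(4πt)^{-N/2} exp(-|x|²/4t)` of `ℝ^N`. -/
noncomputable def heatKernel {N : ℕ} (t : ℝ) (x : EuclideanSpace ℝ (Fin N)) : ℝ :=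
  (4 * Real.pi * t) ^ (-((N : ℝ) / 2)) * Real.exp (-(‖x‖ ^ 2 / (4 * t)))

theorem heatKernel_pos {t : ℝ} (ht : 0 < t) (x : EuclideanSpace ℝ (Fin N)) :
    0 < heatKernel t x := by
  have := Real.pi_pos
  unfold heatKernel
  positivity

theorem heatKernel_neg (t : ℝ) (x : EuclideanSpace ℝ (Fin N)) :
    heatKernel t (-x) = heatKernel t x := by
  simp [heatKernel]

theorem measurable_heatKernel :
    Measurable fun q : ℝ × EuclideanSpace ℝ (Fin N) => heatKernel q.1 q.2 := by
  unfold heatKernel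
  fun_prop

theorem lintegral_heatKernel {t : ℝ} (ht : 0 < t) :
    ∫⁻ y : EuclideanSpace ℝ (Fin N), ENNReal.ofReal (heatKernel t y) = 1 := by
  have hpi := Real.pi_pos
  have hval : ∫ y : EuclideanSpace ℝ (Fin N), heatKernel t y = 1 := by
    have h := GaussianFourier.integral_rexp_neg_mul_sq_norm (V := EuclideanSpace ℝ (Fin N))
      (b := 1 / (4 * t)) (by positivity)
    simp only [finrank_euclideanSpace, Fintype.card_fin] at h
    have he : ∀ y : EuclideanSpace ℝ (Fin N),
        Real.exp (-(‖y‖ ^ 2 / (4 * t))) = Real.exp (-(1 / (4 * t)) * ‖y‖ ^ 2) := fun y => by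
      congr 1; ring
    unfold heatKernel
    simp_rw [he]
    rw [integral_const_mul, h, show Real.pi / (1 / (4 * t)) = 4 * Real.pi * t by field_simp,
      ← Real.rpow_add (by positivity)]
    simp
  have hint : Integrable fun y : EuclideanSpace ℝ (Fin N) => heatKernel t y := by
    refine not_imp_comm.1 integral_undef ?_
    rw [hval]; exact one_ne_zero
  rw [← ofReal_integral_eq_lintegral_ofReal hint
    (Eventually.of_forall fun y => (heatKernel_pos ht y).le), hval, ENNReal.ofReal_one]

theorem lintegral_heatKernel_sub {t : ℝ} (ht : 0 < t) (x : EuclideanSpace ℝ (Fin N)) :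
    ∫⁻ y, ENNReal.ofReal (heatKernel t (x - y)) = 1 := by
  rw [lintegral_sub_left_eq_self (fun y => ENNReal.ofReal (heatKernel t y)) x,
    lintegral_heatKernel ht]

/-- Completing the square in the product of two Gaussians. -/
theorem heatKernel_mul_heatKernel {t r : ℝ} (ht : 0 < t) (hr : 0 < r)
    (x y : EuclideanSpace ℝ (Fin N)) :
    heatKernel t (x - y) * heatKernel r y =
      heatKernel (t + r) x * heatKernel (t * r / (t + r)) (y - (r / (t + r)) • x) := by
  have hpi := Real.pi_pos
  have htr : 0 < t + r := by positivity
  have hexp : -(‖x - y‖ ^ 2 / (4 * t)) + -(‖y‖ ^ 2 / (4 * r)) = -(‖x‖ ^ 2 / (4 * (t + r))) +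
      -(‖y - (r / (t + r)) • x‖ ^ 2 / (4 * (t * r / (t + r)))) := by
    rw [norm_sub_sq_real, norm_sub_sq_real, inner_smul_right, norm_smul, real_inner_comm x y,
      Real.norm_of_nonneg (by positivity)]
    field_simp
    ring
  have hpow : (4 * Real.pi * t) ^ (-((N : ℝ) / 2)) * (4 * Real.pi * r) ^ (-((N : ℝ) / 2)) =
      (4 * Real.pi * (t + r)) ^ (-((N : ℝ) / 2)) *
        (4 * Real.pi * (t * r / (t + r))) ^ (-((N : ℝ) / 2)) := by
    rw [← Real.mul_rpow (by positivity) (by positivity),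
      ← Real.mul_rpow (by positivity) (by positivity)]
    congr 1
    field_simp
  unfold heatKernel
  calc _ = ((4 * Real.pi * t) ^ (-((N : ℝ) / 2)) * (4 * Real.pi * r) ^ (-((N : ℝ) / 2))) *
        (Real.exp (-(‖x - y‖ ^ 2 / (4 * t))) * Real.exp (-(‖y‖ ^ 2 / (4 * r)))) := by ring
    _ = _ := by rw [← Real.exp_add, hexp, Real.exp_add, hpow]; ring

/-- The semigroup property of the heat kernel. -/
theorem lintegral_heatKernel_mul {t r : ℝ} (ht : 0 < t) (hr : 0 < r)
    (x : EuclideanSpace ℝ (Fin N)) :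
    ∫⁻ y, ENNReal.ofReal (heatKernel t (x - y)) * ENNReal.ofReal (heatKernel r y) =
      ENNReal.ofReal (heatKernel (t + r) x) := by
  have h : ∀ y, ENNReal.ofReal (heatKernel t (x - y)) * ENNReal.ofReal (heatKernel r y) =
      ENNReal.ofReal (heatKernel (t + r) x) *
        ENNReal.ofReal (heatKernel (t * r / (t + r)) (y - (r / (t + r)) • x)) := fun y => by
    rw [← ENNReal.ofReal_mul (heatKernel_pos ht _).le, heatKernel_mul_heatKernel ht hr,
      ENNReal.ofReal_mul (heatKernel_pos (by positivity) _).le]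
  simp_rw [h]
  rw [lintegral_const_mul' _ _ ENNReal.ofReal_ne_top,
    lintegral_sub_right_eq_self (fun y => ENNReal.ofReal (heatKernel (t * r / (t + r)) y)),
    lintegral_heatKernel (by positivity), mul_one]

/-- `∫_0^∞ r^{b-1} p_r(x) dr`, a Riesz potential kernel. -/
theorem integrableOn_and_integral_rpow_mul_heatKernel {b : ℝ} (hb : b < N / 2)
    {x : EuclideanSpace ℝ (Fin N)} (hx : x ≠ 0) :
    IntegrableOn (fun r : ℝ => r ^ (b - 1) * heatKernel r x) (Ioi 0) ∧
      ∫ r in Ioi (0 : ℝ), r ^ (b - 1) * heatKernel r x =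
        (4 * Real.pi) ^ (-((N : ℝ) / 2)) *
          ((‖x‖ ^ 2 / 4) ^ (-((N : ℝ) / 2 - b)) * Real.Gamma ((N : ℝ) / 2 - b)) := by
  have hpi := Real.pi_pos
  have hx' : 0 < ‖x‖ := norm_pos_iff.2 hx
  obtain ⟨h1, h2⟩ := integrableOn_and_integral_rpow_mul_exp_neg_div
    (b := (N : ℝ) / 2 - b) (c := ‖x‖ ^ 2 / 4) (by linarith) (by positivity)
  have hcongr : ∀ r ∈ Ioi (0 : ℝ), (4 * Real.pi) ^ (-((N : ℝ) / 2)) *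
      (r ^ (-((N : ℝ) / 2 - b) - 1) * Real.exp (-(‖x‖ ^ 2 / 4 / r))) =
      r ^ (b - 1) * heatKernel r x := fun r hr => by
    have hr0 : (0 : ℝ) < r := hr
    rw [heatKernel, Real.mul_rpow (by positivity) hr0.le, div_div,
      show -((N : ℝ) / 2 - b) - 1 = (b - 1) + -((N : ℝ) / 2) by ring, Real.rpow_add hr0]
    ring
  refine ⟨IntegrableOn.congr_fun (h1.const_mul _) hcongr measurableSet_Ioi, ?_⟩
  rw [← setIntegral_congr_fun measurableSet_Ioi hcongr, integral_const_mul, h2]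

/-- Subordination: `∫_0^∞ t^{-1-s} p_t(z) dt` is a multiple of `|z|^{-N-2s}`. -/
theorem lintegral_rpow_mul_heatKernel {s : ℝ} (hs : 0 < s) {z : EuclideanSpace ℝ (Fin N)}
    (hz : z ≠ 0) :
    ∫⁻ t in Ioi (0 : ℝ), ENNReal.ofReal (t ^ (-1 - s) * heatKernel t z) =
      ENNReal.ofReal (4 ^ s * Real.pi ^ (-((N : ℝ) / 2)) * Real.Gamma ((N : ℝ) / 2 + s) /
        ‖z‖ ^ ((N : ℝ) + 2 * s)) := by
  have hpi := Real.pi_pos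
  have hz' : 0 < ‖z‖ := norm_pos_iff.2 hz
  have hN0 : (0 : ℝ) ≤ N := Nat.cast_nonneg N
  obtain ⟨h1, h2⟩ := integrableOn_and_integral_rpow_mul_heatKernel (b := -s)
    (by linarith [div_nonneg hN0 zero_le_two]) hz
  rw [show -s - 1 = -1 - s by ring] at h1 h2
  rw [← ofReal_integral_eq_lintegral_ofReal h1, h2]
  · congr 1
    rw [sub_neg_eq_add, Real.div_rpow (by positivity) (by norm_num), ← Real.rpow_natCast ‖z‖ 2,
      ← Real.rpow_mul hz'.le, Real.mul_rpow (by norm_num) hpi.le,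
      show ((2 : ℕ) : ℝ) * -((N : ℝ) / 2 + s) = -((N : ℝ) + 2 * s) by push_cast; ring,
      Real.rpow_neg hz'.le, Real.rpow_neg (by norm_num : (0 : ℝ) ≤ 4) ((N : ℝ) / 2 + s),
      Real.rpow_add (by norm_num : (0 : ℝ) < 4), Real.rpow_neg (by norm_num : (0 : ℝ) ≤ 4)]
    field_simp
  · filter_upwards [ae_restrict_mem measurableSet_Ioi] with t ht
    have := heatKernel_pos ht z
    have ht0 : (0 : ℝ) < t := ht
    simp only [Pi.zero_apply]
    positivity

/-- The truncated Riesz potential `∫_{r₀}^∞ r^{β-1} p_r(x) dr`, a regularisation of the Hardy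
ground state. -/
noncomputable def heatPotential {N : ℕ} (β r₀ : ℝ) (x : EuclideanSpace ℝ (Fin N)) : ℝ :=
  ∫ r in Ioi r₀, r ^ (β - 1) * heatKernel r x

theorem heatPotential_integrableOn {β r₀ : ℝ} (hβ : β < N / 2) (hr₀ : 0 < r₀)
    (x : EuclideanSpace ℝ (Fin N)) :
    IntegrableOn (fun r : ℝ => r ^ (β - 1) * heatKernel r x) (Ioi r₀) := by
  have hpi := Real.pi_pos
  have h1 : IntegrableOn (fun r : ℝ => (4 * Real.pi) ^ (-((N : ℝ) / 2)) *
      r ^ (β - 1 - (N : ℝ) / 2)) (Ioi r₀) :=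
    (integrableOn_Ioi_rpow_of_lt (by linarith) hr₀).const_mul _
  refine Integrable.mono' h1 ?_ ?_
  · have := measurable_heatKernel (N := N)
    exact ((measurable_id.pow_const _).mul
      (this.comp (measurable_id.prodMk measurable_const))).aestronglyMeasurable
  · filter_upwards [ae_restrict_mem measurableSet_Ioi] with r hr
    have hr0 : 0 < r := hr₀.trans hr
    have hp := heatKernel_pos hr0 x
    rw [Real.norm_of_nonneg (by positivity), heatKernel, sub_eq_add_neg (β - 1), Real.rpow_add hr0,
      Real.mul_rpow (by positivity) hr0.le]
    have : Real.exp (-(‖x‖ ^ 2 / (4 * r))) ≤ 1 :=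
      Real.exp_le_one_iff.2 (neg_nonpos.2 (by positivity))
    calc _ ≤ r ^ (β - 1) * ((4 * Real.pi) ^ (-((N : ℝ) / 2)) * r ^ (-((N : ℝ) / 2)) * 1) := by
          gcongr
      _ = _ := by ring

theorem heatPotential_pos {β r₀ : ℝ} (hβ : β < N / 2) (hr₀ : 0 < r₀)
    (x : EuclideanSpace ℝ (Fin N)) : 0 < heatPotential β r₀ x := by
  have hpos : ∀ r ∈ Ioi r₀, 0 < r ^ (β - 1) * heatKernel r x := fun r hr => by
    have hr0 : 0 < r := hr₀.trans hr
    have hp := heatKernel_pos hr0 x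
    positivity
  rw [heatPotential, setIntegral_pos_iff_support_of_nonneg_ae
    (by filter_upwards [ae_restrict_mem measurableSet_Ioi] with r hr using (hpos r hr).le)
    (heatPotential_integrableOn hβ hr₀ x)]
  have hsub : Ioi r₀ ⊆ Function.support (fun r : ℝ => r ^ (β - 1) * heatKernel r x) ∩ Ioi r₀ :=
    fun r hr => ⟨(hpos r hr).ne', hr⟩
  refine lt_of_lt_of_le ?_ (measure_mono hsub)
  simp

theorem measurable_heatPotential {β r₀ : ℝ} :
    Measurable (heatPotential (N := N) β r₀) := by
  have : StronglyMeasurable fun q : EuclideanSpace ℝ (Fin N) × ℝ =>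
      q.2 ^ (β - 1) * heatKernel q.2 q.1 :=
    ((measurable_snd.pow_const _).mul
      (measurable_heatKernel.comp measurable_swap)).stronglyMeasurable
  exact (this.integral_prod_right' (ν := volume.restrict (Ioi r₀))).measurable

theorem ofReal_heatPotential {β r₀ : ℝ} (hβ : β < N / 2) (hr₀ : 0 < r₀)
    (x : EuclideanSpace ℝ (Fin N)) : ENNReal.ofReal (heatPotential β r₀ x) =
      ∫⁻ r in Ioi r₀, ENNReal.ofReal (r ^ (β - 1)) * ENNReal.ofReal (heatKernel r x) := by
  rw [heatPotential, ofReal_integral_eq_lintegral_ofReal (heatPotential_integrableOn hβ hr₀ x)]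
  · refine setLIntegral_congr_fun measurableSet_Ioi fun r hr => ?_
    rw [ENNReal.ofReal_mul (Real.rpow_nonneg (hr₀.trans hr).le _)]
  · filter_upwards [ae_restrict_mem measurableSet_Ioi] with r hr
    have hr0 : 0 < r := hr₀.trans hr
    have hp := heatKernel_pos hr0 x
    simp only [Pi.zero_apply]
    positivity

/-- The heat flow applied to `heatPotential`: the shift `r ↦ r - t` in the parameter. -/
theorem lintegral_heatKernel_mul_heatPotential_le {β r₀ t : ℝ} (hβ : β < N / 2) (hr₀ : 0 < r₀)
    (ht : 0 < t) (x : EuclideanSpace ℝ (Fin N)) :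
    ∫⁻ y, ENNReal.ofReal (heatKernel t (x - y)) * ENNReal.ofReal (heatPotential β r₀ y) ≤
      ∫⁻ r in Ioi r₀, ENNReal.ofReal ((1 - powDefect β (t / r)) *
        (r ^ (β - 1) * heatKernel r x)) := by
  have hm := measurable_heatKernel (N := N)
  have hm1 : Measurable fun y : EuclideanSpace ℝ (Fin N) => heatKernel t (x - y) :=
    hm.comp (measurable_const.prodMk (measurable_const.sub measurable_id))
  calc ∫⁻ y, ENNReal.ofReal (heatKernel t (x - y)) * ENNReal.ofReal (heatPotential β r₀ y)
      = ∫⁻ y, ∫⁻ r in Ioi r₀, ENNReal.ofReal (heatKernel t (x - y)) *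
          (ENNReal.ofReal (r ^ (β - 1)) * ENNReal.ofReal (heatKernel r y)) := by
        refine lintegral_congr fun y => ?_
        rw [ofReal_heatPotential hβ hr₀, lintegral_const_mul' _ _ ENNReal.ofReal_ne_top]
    _ = ∫⁻ r in Ioi r₀, ∫⁻ y, ENNReal.ofReal (heatKernel t (x - y)) *
          (ENNReal.ofReal (r ^ (β - 1)) * ENNReal.ofReal (heatKernel r y)) := by
        refine lintegral_lintegral_swap (Measurable.aemeasurable ?_)
        refine ((hm1.comp measurable_fst).ennreal_ofReal).mul
          (((measurable_snd.pow_const _).ennreal_ofReal).mul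
          (hm.comp measurable_swap).ennreal_ofReal)
    _ = ∫⁻ r in Ioi r₀, ENNReal.ofReal (r ^ (β - 1)) * ENNReal.ofReal (heatKernel (t + r) x) := by
        refine setLIntegral_congr_fun measurableSet_Ioi fun r hr => ?_
        rw [← lintegral_heatKernel_mul ht (hr₀.trans hr),
          ← lintegral_const_mul' _ _ ENNReal.ofReal_ne_top]
        refine lintegral_congr fun y => ?_
        ring
    _ = ∫⁻ r, (Ioi r₀).indicator (fun r => ENNReal.ofReal (r ^ (β - 1)) *
          ENNReal.ofReal (heatKernel (t + r) x)) r := (lintegral_indicator measurableSet_Ioi _).symm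
    _ = ∫⁻ r, (Ioi r₀).indicator (fun r => ENNReal.ofReal (r ^ (β - 1)) *
          ENNReal.ofReal (heatKernel (t + r) x)) (r - t) :=
        (lintegral_sub_right_eq_self _ t).symm
    _ ≤ ∫⁻ r, (Ioi r₀).indicator (fun r => ENNReal.ofReal ((1 - powDefect β (t / r)) *
          (r ^ (β - 1) * heatKernel r x))) r := by
        refine lintegral_mono fun r => ?_
        by_cases hr : r - t ∈ Ioi r₀
        · have hr1 : r₀ < r - t := hr
          have hr2 : 0 < r := by linarith
          have hr3 : r ∈ Ioi r₀ := by simp only [mem_Ioi]; linarith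
          have hr4 : t / r < 1 := by rw [div_lt_one hr2]; linarith
          rw [indicator_of_mem hr, indicator_of_mem hr3, add_sub_cancel,
            ← ENNReal.ofReal_mul (Real.rpow_nonneg (by linarith) _), powDefect, if_pos hr4,
            sub_sub_cancel, ← mul_assoc, ← Real.mul_rpow (by linarith) hr2.le]
          rw [show (1 - t / r) * r = r - t by field_simp]
        · rw [indicator_of_notMem hr]; exact zero_le
    _ = _ := lintegral_indicator measurableSet_Ioi _

/-- The density `u² w⁻¹ r^{β-1} p_r`, where `w` is the potential `heatPotential β r₀`; its integral
over `r > r₀` is `u²`. -/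
noncomputable def hardyDensity {N : ℕ} (β r₀ : ℝ) (u : EuclideanSpace ℝ (Fin N) → ℝ)
    (q : EuclideanSpace ℝ (Fin N) × ℝ) : ℝ :=
  u q.1 ^ 2 / heatPotential β r₀ q.1 * (q.2 ^ (β - 1) * heatKernel q.2 q.1)

variable {β r₀ : ℝ} {u : EuclideanSpace ℝ (Fin N) → ℝ}

theorem measurable_hardyDensity (hu : Measurable u) : Measurable (hardyDensity β r₀ u) := by
  have h1 := measurable_heatPotential (N := N) (β := β) (r₀ := r₀)
  exact (((hu.comp measurable_fst).pow_const 2).div (h1.comp measurable_fst)).mul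
    ((measurable_snd.pow_const _).mul (measurable_heatKernel.comp measurable_swap))

theorem hardyDensity_nonneg (hβ : β < N / 2) (hr₀ : 0 < r₀)
    {q : EuclideanSpace ℝ (Fin N) × ℝ} (hq : 0 < q.2) : 0 ≤ hardyDensity β r₀ u q := by
  have h1 := heatPotential_pos hβ hr₀ q.1
  have h2 := heatKernel_pos hq q.1
  unfold hardyDensity
  positivity

theorem integral_hardyDensity (hβ : β < N / 2) (hr₀ : 0 < r₀) (x : EuclideanSpace ℝ (Fin N)) :
    ∫ r in Ioi r₀, hardyDensity β r₀ u (x, r) = u x ^ 2 := by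
  have h := (heatPotential_pos hβ hr₀ x).ne'
  simp only [hardyDensity]
  rw [integral_const_mul]
  change u x ^ 2 / heatPotential β r₀ x * heatPotential β r₀ x = _
  field_simp

theorem integrable_hardyDensity (hβ : β < N / 2) (hr₀ : 0 < r₀) (hum : Measurable u)
    (hu : MemLp u 2) :
    Integrable (hardyDensity β r₀ u) (volume.prod (volume.restrict (Ioi r₀))) := by
  rw [integrable_prod_iff (measurable_hardyDensity hum).aestronglyMeasurable]
  refine ⟨Eventually.of_forall fun x =>
    (heatPotential_integrableOn hβ hr₀ x).const_mul (u x ^ 2 / heatPotential β r₀ x), ?_⟩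
  refine hu.integrable_sq.congr (Eventually.of_forall fun x => ?_)
  simp only
  rw [← integral_hardyDensity hβ hr₀ x]
  refine setIntegral_congr_fun measurableSet_Ioi fun r hr => ?_
  exact (Real.norm_of_nonneg (hardyDensity_nonneg hβ hr₀ (q := (x, r)) (hr₀.trans hr))).symm

/-- The Schur test for the heat semigroup, with weight `heatPotential β r₀`: the Dirichlet form at
time `t` dominates the integral of `u² (w - P_t w) / w`. -/
theorem ofReal_integral_powDefect_le (hβ : β < N / 2) (hr₀ : 0 < r₀) (hum : Measurable u)
    (hu : MemLp u 2) {t : ℝ} (ht : 0 < t)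
    (hi : Integrable (fun q => powDefect β (t / q.2) * hardyDensity β r₀ u q)
      (volume.prod (volume.restrict (Ioi r₀)))) :
    ENNReal.ofReal (2 * ∫ q, powDefect β (t / q.2) * hardyDensity β r₀ u q
      ∂(volume.prod (volume.restrict (Ioi r₀)))) ≤
    ∫⁻ q : EuclideanSpace ℝ (Fin N) × EuclideanSpace ℝ (Fin N),
      ENNReal.ofReal (heatKernel t (q.1 - q.2) * (u q.1 - u q.2) ^ 2) := by
  set m : Measure (EuclideanSpace ℝ (Fin N) × ℝ) := volume.prod (volume.restrict (Ioi r₀)) with hm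
  set w := heatPotential (N := N) β r₀ with hw
  have hwpos : ∀ x, 0 < w x := heatPotential_pos hβ hr₀
  have hwm : Measurable w := measurable_heatPotential
  have hkm : Measurable fun q : EuclideanSpace ℝ (Fin N) × EuclideanSpace ℝ (Fin N) =>
      heatKernel t (q.1 - q.2) :=
    measurable_heatKernel.comp (measurable_const.prodMk (measurable_fst.sub measurable_snd))
  have hd := integrable_hardyDensity hβ hr₀ hum hu
  rw [← hm] at hd
  have hdint : ∫ q, hardyDensity β r₀ u q ∂m = ∫ x, u x ^ 2 := by
    rw [hm, integral_prod _ hd]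
    exact integral_congr_ae (Eventually.of_forall fun x => integral_hardyDensity hβ hr₀ x)
  -- the cross term: `P_t w` is bounded by a shift of the parameter `r`
  set A : EuclideanSpace ℝ (Fin N) × EuclideanSpace ℝ (Fin N) → ℝ := fun q =>
    heatKernel t (q.1 - q.2) * (u q.1 ^ 2 / w q.1 * w q.2) with hA
  have hAm : Measurable A := hkm.mul ((((hum.comp measurable_fst).pow_const 2).div
    (hwm.comp measurable_fst)).mul (hwm.comp measurable_snd))
  have hA0 : ∀ q, 0 ≤ A q := fun q => by
    have h1 := heatKernel_pos ht (q.1 - q.2)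
    have h2 := hwpos q.1
    have h3 := hwpos q.2
    simp only [hA]
    positivity
  have hAle : ∫⁻ q, ENNReal.ofReal (A q) ≤
      ∫⁻ q, ENNReal.ofReal ((1 - powDefect β (t / q.2)) * hardyDensity β r₀ u q) ∂m := by
    rw [Measure.volume_eq_prod, lintegral_prod _ hAm.ennreal_ofReal.aemeasurable, hm,
      lintegral_prod _ (Measurable.aemeasurable ?_)]
    · refine lintegral_mono fun x => ?_
      have hux : 0 ≤ u x ^ 2 / w x := div_nonneg (sq_nonneg _) (hwpos x).le
      calc ∫⁻ y, ENNReal.ofReal (A (x, y))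
          = ∫⁻ y, ENNReal.ofReal (u x ^ 2 / w x) *
              (ENNReal.ofReal (heatKernel t (x - y)) * ENNReal.ofReal (w y)) := by
            refine lintegral_congr fun y => ?_
            rw [← ENNReal.ofReal_mul (heatKernel_pos ht _).le, ← ENNReal.ofReal_mul hux]
            congr 1
            simp only [hA]; ring
        _ ≤ ENNReal.ofReal (u x ^ 2 / w x) * ∫⁻ r in Ioi r₀,
              ENNReal.ofReal ((1 - powDefect β (t / r)) * (r ^ (β - 1) * heatKernel r x)) := by
            rw [lintegral_const_mul' _ _ ENNReal.ofReal_ne_top]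
            gcongr
            exact lintegral_heatKernel_mul_heatPotential_le hβ hr₀ ht x
        _ = _ := by
            rw [← lintegral_const_mul' _ _ ENNReal.ofReal_ne_top]
            refine lintegral_congr fun r => ?_
            rw [← ENNReal.ofReal_mul hux]
            congr 1
            simp only [hardyDensity, ← hw]; ring
    · exact (((measurable_const.sub ((measurable_powDefect β).comp
        (measurable_const.div measurable_snd)))).mul (measurable_hardyDensity hum)).ennreal_ofReal
  have hAval : ∫⁻ q, ENNReal.ofReal ((1 - powDefect β (t / q.2)) * hardyDensity β r₀ u q) ∂m =
      ENNReal.ofReal ((∫ x, u x ^ 2) - ∫ q, powDefect β (t / q.2) * hardyDensity β r₀ u q ∂m) := by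
    have hsub : Integrable (fun q => (1 - powDefect β (t / q.2)) * hardyDensity β r₀ u q) m :=
      (hd.sub hi).congr (Eventually.of_forall fun q => by simp only [Pi.sub_apply]; ring)
    rw [← ofReal_integral_eq_lintegral_ofReal hsub, ← hdint, ← integral_sub hd hi]
    · congr 1
      exact integral_congr_ae (Eventually.of_forall fun q => by simp only; ring)
    · rw [hm]
      have : ∀ᵐ q ∂(volume.prod (volume.restrict (Ioi r₀)) :
          Measure (EuclideanSpace ℝ (Fin N) × ℝ)), q.2 ∈ Ioi r₀ :=
        Measure.quasiMeasurePreserving_snd.ae (ae_restrict_mem measurableSet_Ioi)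
      filter_upwards [this] with q hq
      exact mul_nonneg (sub_nonneg.2 (powDefect_le_one _ _))
        (hardyDensity_nonneg hβ hr₀ (hr₀.trans hq))
  -- the diagonal terms
  have hdiag1 : ∫⁻ q : EuclideanSpace ℝ (Fin N) × EuclideanSpace ℝ (Fin N),
      ENNReal.ofReal (heatKernel t (q.1 - q.2) * u q.1 ^ 2) = ENNReal.ofReal (∫ x, u x ^ 2) := by
    rw [Measure.volume_eq_prod, lintegral_prod _ (by
      exact (hkm.mul ((hum.comp measurable_fst).pow_const 2)).ennreal_ofReal.aemeasurable),
      ofReal_integral_eq_lintegral_ofReal hu.integrable_sq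
        (Eventually.of_forall fun x => sq_nonneg _)]
    refine lintegral_congr fun x => ?_
    have : ∀ y, ENNReal.ofReal (heatKernel t (x - y) * u x ^ 2) =
        ENNReal.ofReal (heatKernel t (x - y)) * ENNReal.ofReal (u x ^ 2) := fun y =>
      ENNReal.ofReal_mul (heatKernel_pos ht _).le
    simp only [this]
    rw [lintegral_mul_const' _ _ ENNReal.ofReal_ne_top, lintegral_heatKernel_sub ht, one_mul]
  have hswap : ∀ f : EuclideanSpace ℝ (Fin N) × EuclideanSpace ℝ (Fin N) → ENNReal,
      ∫⁻ q, f (Prod.swap q) = ∫⁻ q, f q := fun f => by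
    rw [Measure.volume_eq_prod]
    exact (Measure.measurePreserving_swap (μ := volume) (ν := volume)).lintegral_comp_emb
      MeasurableEquiv.prodComm.measurableEmbedding f
  have hdiag2 : ∫⁻ q : EuclideanSpace ℝ (Fin N) × EuclideanSpace ℝ (Fin N),
      ENNReal.ofReal (heatKernel t (q.1 - q.2) * u q.2 ^ 2) = ENNReal.ofReal (∫ x, u x ^ 2) := by
    rw [← hdiag1, ← hswap]
    refine lintegral_congr fun q => ?_
    rw [Prod.fst_swap, Prod.snd_swap, ← heatKernel_neg, neg_sub]
  have hpt : ∀ q : EuclideanSpace ℝ (Fin N) × EuclideanSpace ℝ (Fin N),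
      ENNReal.ofReal (heatKernel t (q.1 - q.2) * u q.1 ^ 2) +
        ENNReal.ofReal (heatKernel t (q.1 - q.2) * u q.2 ^ 2) ≤
      ENNReal.ofReal (heatKernel t (q.1 - q.2) * (u q.1 - u q.2) ^ 2) +
        (ENNReal.ofReal (A q) + ENNReal.ofReal (A q.swap)) := fun q => by
    have hk := heatKernel_pos ht (q.1 - q.2)
    rw [← ENNReal.ofReal_add (by positivity) (by positivity),
      ← ENNReal.ofReal_add (hA0 _) (hA0 _),
      ← ENNReal.ofReal_add (by positivity) (add_nonneg (hA0 _) (hA0 _))]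
    refine ENNReal.ofReal_le_ofReal ?_
    have h1 := hwpos q.1
    have h2 := hwpos q.2
    have hsw : A q.swap = heatKernel t (q.1 - q.2) * (u q.2 ^ 2 / w q.2 * w q.1) := by
      simp only [hA, Prod.fst_swap, Prod.snd_swap]
      rw [← heatKernel_neg, neg_sub]
    have hAq : A q = heatKernel t (q.1 - q.2) * (u q.1 ^ 2 / w q.1 * w q.2) := rfl
    rw [hsw, hAq, ← mul_add, ← mul_add, ← mul_add]
    refine mul_le_mul_of_nonneg_left ?_ hk.le
    -- the Schur test: `2 a b ≤ a² (w' / w) + b² (w / w')`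
    have : u q.1 ^ 2 / w q.1 * w q.2 + u q.2 ^ 2 / w q.2 * w q.1 - 2 * u q.1 * u q.2 =
        (u q.1 * w q.2 - u q.2 * w q.1) ^ 2 / (w q.1 * w q.2) := by field_simp; ring
    have : 0 ≤ (u q.1 * w q.2 - u q.2 * w q.1) ^ 2 / (w q.1 * w q.2) := by positivity
    nlinarith
  have hsum := lintegral_mono hpt (μ := volume)
  rw [lintegral_add_left' (by
      exact (hkm.mul ((hum.comp measurable_fst).pow_const 2)).ennreal_ofReal.aemeasurable),
    lintegral_add_right' _ (by
      exact (hAm.ennreal_ofReal.add (hAm.comp measurable_swap).ennreal_ofReal).aemeasurable),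
    lintegral_add_left' (by exact hAm.ennreal_ofReal.aemeasurable), hdiag1, hdiag2,
    hswap (fun q => ENNReal.ofReal (A q))] at hsum
  set P := ∫ q, powDefect β (t / q.2) * hardyDensity β r₀ u q ∂m
  set L := ∫ x, u x ^ 2 with hL
  have hL0 : 0 ≤ L := integral_nonneg fun x => sq_nonneg _
  have hfin := hAle.trans_eq hAval
  have hPL : P ≤ L := by
    rw [← hdint]
    refine integral_mono_ae hi hd ?_
    have : ∀ᵐ q ∂(volume.prod (volume.restrict (Ioi r₀)) :
        Measure (EuclideanSpace ℝ (Fin N) × ℝ)), q.2 ∈ Ioi r₀ :=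
      Measure.quasiMeasurePreserving_snd.ae (ae_restrict_mem measurableSet_Ioi)
    filter_upwards [this] with q hq
    exact mul_le_of_le_one_left (hardyDensity_nonneg hβ hr₀ (hr₀.trans hq)) (powDefect_le_one _ _)
  -- `powDefect` is negative near `0` when `β < 1`, so the sign of `P` is not known
  rcases lt_or_ge P 0 with hP | hP
  · rw [ENNReal.ofReal_of_nonpos (by linarith)]
    exact zero_le
  · have h1 := hsum.trans (add_le_add_right (add_le_add hfin hfin) _)
    rw [← ENNReal.ofReal_add hL0 hL0, ← ENNReal.ofReal_add (by linarith) (by linarith),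
      show L + L = 2 * P + (L - P + (L - P)) by ring,
      ENNReal.ofReal_add (by linarith) (by linarith)] at h1
    exact (ENNReal.add_le_add_iff_right ENNReal.ofReal_ne_top).1 h1

/-- The Hardy inequality with the regularised weight, obtained by integrating
`ofReal_integral_powDefect_le` against `t^{-1-s} dt`. -/
theorem ofReal_hardy_truncated {s : ℝ} (hs0 : 0 < s) (hs1 : s < 1) (hβs : s < β)
    (hβ : β < N / 2) (hr₀ : 0 < r₀) (hum : Measurable u) (hu : MemHs s u) :
    ENNReal.ofReal (2 * (Real.Gamma (1 - s) * Real.Gamma β / (s * Real.Gamma (β - s)))) *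
      ∫⁻ q, ENNReal.ofReal (q.2 ^ (-s) * hardyDensity β r₀ u q)
        ∂(volume.prod (volume.restrict (Ioi r₀))) ≤
    ENNReal.ofReal (4 ^ s * Real.pi ^ (-((N : ℝ) / 2)) * Real.Gamma ((N : ℝ) / 2 + s) *
      ∫ q, gagliardoKernel s u u q) := by
  set m : Measure (EuclideanSpace ℝ (Fin N) × ℝ) := volume.prod (volume.restrict (Ioi r₀)) with hm
  have hpi := Real.pi_pos
  obtain ⟨hKi, hKv⟩ := integrableOn_and_integral_powDefect hs0 hs1 hβs
  set K : ℝ := Real.Gamma (1 - s) * Real.Gamma β / (s * Real.Gamma (β - s)) with hK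
  have hK0 : 0 < K := by
    have h1 := Real.Gamma_pos_of_pos (by linarith : 0 < 1 - s)
    have h2 := Real.Gamma_pos_of_pos (by linarith : 0 < β)
    have h3 := Real.Gamma_pos_of_pos (by linarith : 0 < β - s)
    positivity
  have hΓ : 0 < Real.Gamma ((N : ℝ) / 2 + s) := Real.Gamma_pos_of_pos (by positivity)
  set κ : ℝ := 4 ^ s * Real.pi ^ (-((N : ℝ) / 2)) * Real.Gamma ((N : ℝ) / 2 + s) with hκ
  have hκ0 : 0 < κ := by positivity
  have hmem : ∀ᵐ q ∂m, r₀ < q.2 :=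
    Measure.quasiMeasurePreserving_snd.ae (ae_restrict_mem measurableSet_Ioi)
  have hdm := measurable_hardyDensity (β := β) (r₀ := r₀) hum
  have hd : Integrable (hardyDensity β r₀ u) m := integrable_hardyDensity hβ hr₀ hum hu.1
  have hwd : Integrable (fun q => q.2 ^ (-s) * hardyDensity β r₀ u q) m := by
    refine (hd.const_mul (r₀ ^ (-s))).mono'
      ((measurable_snd.pow_const _).mul hdm).aestronglyMeasurable ?_
    filter_upwards [hmem] with q hq
    have h1 := hardyDensity_nonneg (u := u) hβ hr₀ (hr₀.trans hq)
    have h2 : q.2 ^ (-s) ≤ r₀ ^ (-s) := Real.rpow_le_rpow_of_nonpos hr₀ hq.le (by linarith)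
    rw [norm_mul, Real.norm_of_nonneg h1,
      Real.norm_of_nonneg (Real.rpow_nonneg (hr₀.trans hq).le _)]
    gcongr
  -- `F` is absolutely integrable because `r ≥ r₀`, so Fubini applies although it changes sign
  set F : (EuclideanSpace ℝ (Fin N) × ℝ) × ℝ → ℝ := fun z =>
    z.2 ^ (-1 - s) * powDefect β (z.2 / z.1.2) * hardyDensity β r₀ u z.1 with hF
  have hFm : Measurable F := ((measurable_snd.pow_const _).mul ((measurable_powDefect β).comp
    (measurable_snd.div (measurable_snd.comp measurable_fst)))).mul (hdm.comp measurable_fst)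
  have hFi : Integrable F (m.prod (volume.restrict (Ioi 0))) := by
    rw [integrable_prod_iff hFm.aestronglyMeasurable]
    constructor
    · filter_upwards [hmem] with q hq
      exact (integrableOn_and_integral_rpow_mul_comp_div (hr₀.trans hq) hKi).1.mul_const
        (hardyDensity β r₀ u q)
    · refine (hwd.const_mul (∫ τ in Ioi (0 : ℝ), τ ^ (-1 - s) * |powDefect β τ|)).congr ?_
      filter_upwards [hmem] with q hq
      have hKi' : IntegrableOn (fun τ : ℝ => τ ^ (-1 - s) * |powDefect β τ|) (Ioi 0) := by
        refine IntegrableOn.congr_fun hKi.norm (fun τ hτ => ?_) measurableSet_Ioi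
        simp only [norm_mul, Real.norm_eq_abs]
        rw [abs_of_nonneg (Real.rpow_nonneg (le_of_lt hτ) _)]
      have h := (integrableOn_and_integral_rpow_mul_comp_div (hr₀.trans hq) hKi').2
      have h1 := hardyDensity_nonneg (u := u) hβ hr₀ (hr₀.trans hq)
      have h2 : ∫ t in Ioi (0 : ℝ), ‖F (q, t)‖ =
          ∫ t in Ioi (0 : ℝ), t ^ (-1 - s) * |powDefect β (t / q.2)| * hardyDensity β r₀ u q := by
        refine setIntegral_congr_fun measurableSet_Ioi fun t ht => ?_
        simp only [hF, norm_mul, Real.norm_eq_abs]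
        rw [abs_of_nonneg (Real.rpow_nonneg (le_of_lt ht) _), abs_of_nonneg h1]
      rw [h2, integral_mul_const, h]
      ring
  have hswap : ∫ t in Ioi (0 : ℝ), ∫ q, F (q, t) ∂m =
      K * ∫ q, q.2 ^ (-s) * hardyDensity β r₀ u q ∂m := by
    rw [← integral_integral_swap (f := fun q t => F (q, t)) hFi, ← integral_const_mul]
    refine integral_congr_ae ?_
    filter_upwards [hmem] with q hq
    have h := (integrableOn_and_integral_rpow_mul_comp_div (hr₀.trans hq) hKi).2
    simp only [hF]
    rw [integral_mul_const, h, hKv]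
    ring
  have hFt : Integrable (fun t => 2 * ∫ q, F (q, t) ∂m) (volume.restrict (Ioi 0)) :=
    hFi.integral_prod_right.const_mul 2
  have hkm : Measurable fun z : ℝ × (EuclideanSpace ℝ (Fin N) × EuclideanSpace ℝ (Fin N)) =>
      z.1 ^ (-1 - s) * heatKernel z.1 (z.2.1 - z.2.2) :=
    (measurable_fst.pow_const _).mul (measurable_heatKernel.comp
      (measurable_fst.prodMk ((measurable_fst.sub measurable_snd).comp measurable_snd)))
  calc ENNReal.ofReal (2 * K) * ∫⁻ q, ENNReal.ofReal (q.2 ^ (-s) * hardyDensity β r₀ u q) ∂m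
      = ENNReal.ofReal (∫ t in Ioi (0 : ℝ), 2 * ∫ q, F (q, t) ∂m) := by
        rw [integral_const_mul, hswap, ← ofReal_integral_eq_lintegral_ofReal hwd,
          ← ENNReal.ofReal_mul (by positivity), mul_assoc]
        filter_upwards [hmem] with q hq
        exact mul_nonneg (Real.rpow_nonneg (hr₀.trans hq).le _)
          (hardyDensity_nonneg hβ hr₀ (hr₀.trans hq))
    _ ≤ ENNReal.ofReal (∫ t in Ioi (0 : ℝ), max (2 * ∫ q, F (q, t) ∂m) 0) :=
        ENNReal.ofReal_le_ofReal (integral_mono hFt hFt.pos_part fun t => le_max_left _ _)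
    _ = ∫⁻ t in Ioi (0 : ℝ), ENNReal.ofReal (2 * ∫ q, F (q, t) ∂m) := by
        rw [ofReal_integral_eq_lintegral_ofReal hFt.pos_part
          (Eventually.of_forall fun t => le_max_right _ _)]
        refine lintegral_congr fun t => ?_
        rcases le_total (2 * ∫ q, F (q, t) ∂m) 0 with h | h
        · rw [max_eq_right h, ENNReal.ofReal_of_nonpos h, ENNReal.ofReal_zero]
        · rw [max_eq_left h]
    _ ≤ ∫⁻ t in Ioi (0 : ℝ), ∫⁻ q : EuclideanSpace ℝ (Fin N) × EuclideanSpace ℝ (Fin N),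
          ENNReal.ofReal (t ^ (-1 - s) * heatKernel t (q.1 - q.2) * (u q.1 - u q.2) ^ 2) := by
        refine lintegral_mono_ae ?_
        filter_upwards [hFi.prod_left_ae, ae_restrict_mem measurableSet_Ioi] with t hFi' ht
        have ht0 : (0 : ℝ) < t := ht
        have htp : 0 < t ^ (-1 - s) := Real.rpow_pos_of_pos ht0 _
        have hi : Integrable (fun q => powDefect β (t / q.2) * hardyDensity β r₀ u q) m := by
          refine (hFi'.const_mul (t ^ (-1 - s))⁻¹).congr (Eventually.of_forall fun q => ?_)
          simp only [hF]
          field_simp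
        have h1 : 2 * ∫ q, F (q, t) ∂m = t ^ (-1 - s) *
            (2 * ∫ q, powDefect β (t / q.2) * hardyDensity β r₀ u q ∂m) := by
          rw [mul_left_comm, ← integral_const_mul (t ^ (-1 - s))]
          congr 1
          exact integral_congr_ae (Eventually.of_forall fun q => mul_assoc _ _ _)
        rw [h1, ENNReal.ofReal_mul htp.le]
        refine (mul_le_mul_right
          (ofReal_integral_powDefect_le hβ hr₀ hum hu.1 ht0 hi) _).trans_eq ?_
        rw [← lintegral_const_mul' _ _ ENNReal.ofReal_ne_top]
        refine lintegral_congr fun q => ?_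
        rw [← ENNReal.ofReal_mul htp.le, mul_assoc]
    _ = ∫⁻ q : EuclideanSpace ℝ (Fin N) × EuclideanSpace ℝ (Fin N), ∫⁻ t in Ioi (0 : ℝ),
          ENNReal.ofReal (t ^ (-1 - s) * heatKernel t (q.1 - q.2) * (u q.1 - u q.2) ^ 2) := by
        refine lintegral_lintegral_swap (Measurable.aemeasurable ?_)
        exact (hkm.mul (((hum.comp measurable_fst).sub (hum.comp measurable_snd)).pow_const 2
          |>.comp measurable_snd)).ennreal_ofReal
    _ = ∫⁻ q, ENNReal.ofReal (κ * gagliardoKernel s u u q) := by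
        refine lintegral_congr fun q => ?_
        have h1 : ∀ t ∈ Ioi (0 : ℝ),
            ENNReal.ofReal (t ^ (-1 - s) * heatKernel t (q.1 - q.2) * (u q.1 - u q.2) ^ 2) =
            ENNReal.ofReal (t ^ (-1 - s) * heatKernel t (q.1 - q.2)) *
              ENNReal.ofReal ((u q.1 - u q.2) ^ 2) := fun t ht => by
          refine ENNReal.ofReal_mul ?_
          have := heatKernel_pos ht (q.1 - q.2)
          exact mul_nonneg (Real.rpow_nonneg (le_of_lt ht) _) this.le
        rw [setLIntegral_congr_fun measurableSet_Ioi h1,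
          lintegral_mul_const' _ _ ENNReal.ofReal_ne_top]
        rcases eq_or_ne (q.1 - q.2) 0 with h0 | h0
        · rw [sub_eq_zero] at h0
          simp [gagliardoKernel, h0]
        · have hz : 0 < ‖q.1 - q.2‖ := norm_pos_iff.2 h0
          rw [lintegral_rpow_mul_heatKernel hs0 h0, ← ENNReal.ofReal_mul (by positivity)]
          congr 1
          simp only [gagliardoKernel, hκ]
          field_simp
    _ = ENNReal.ofReal (κ * ∫ q, gagliardoKernel s u u q) := by
        rw [← ofReal_integral_eq_lintegral_ofReal (hu.2.const_mul κ)
          (Eventually.of_forall fun q => mul_nonneg hκ0.le (gagliardoKernel_self_nonneg q)),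
          integral_const_mul]

/-- As the truncation is removed, the heat potential tends to a multiple of `|x|^{2b-N}`. -/
theorem tendsto_heatPotential {b : ℝ} (hb : b < N / 2) {x : EuclideanSpace ℝ (Fin N)} (hx : x ≠ 0)
    {ρ : ℕ → ℝ} (hρ : ∀ n, 0 < ρ n) (hρ0 : Tendsto ρ atTop (𝓝 0)) :
    Tendsto (fun n => heatPotential b (ρ n) x) atTop (𝓝 ((4 * Real.pi) ^ (-((N : ℝ) / 2)) *
      ((‖x‖ ^ 2 / 4) ^ (-((N : ℝ) / 2 - b)) * Real.Gamma ((N : ℝ) / 2 - b)))) := by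
  obtain ⟨h1, h2⟩ := integrableOn_and_integral_rpow_mul_heatKernel hb hx
  have h := (aecover_Ioi_of_Ioi
    (μ := (volume : Measure ℝ)) hρ0).integral_tendsto_of_countably_generated h1
  rw [h2] at h
  refine h.congr fun n => ?_
  rw [Measure.restrict_restrict measurableSet_Ioi,
    inter_eq_left.2 (Ioi_subset_Ioi (hρ n).le), heatPotential]

theorem cNs_pos {s : ℝ} (hs0 : 0 < s) (hs1 : s < 1) : 0 < cNs N s := by
  have hpi := Real.pi_pos
  have h1 : 0 < Real.Gamma (((N : ℝ) + 2 * s) / 2) := Real.Gamma_pos_of_pos (by positivity)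
  have h2 : Real.Gamma (-s) ≠ 0 := by
    have h := Real.Gamma_add_one (s := -s) (by linarith)
    have h3 := Real.Gamma_pos_of_pos (show 0 < -s + 1 by linarith)
    intro h0
    rw [h0, mul_zero] at h
    linarith
  have := abs_pos.2 h2
  unfold cNs
  positivity

/-- Hardy's inequality in `ℝ≥0∞`: the truncation at `r₀` is removed by Fatou's lemma. The exponent
`β = (N + 2s)/4` makes the limiting weight `|x|^{-(N-2s)/2}`, the ground state of the Hardy
operator, and this is what produces the sharp constant. -/
theorem MemHs.hardy_of_measurable {s : ℝ} (hs0 : 0 < s) (hs1 : s < 1) (hN : 2 * s < N)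
    (hum : Measurable u) (hu : MemHs s u) :
    ENNReal.ofReal (hardyConst N s) * ∫⁻ x, ENNReal.ofReal (|u x| ^ 2 / ‖x‖ ^ (2 * s)) ≤
      ENNReal.ofReal (gagliardoForm s u u) := by
  have hN0 : (0 : ℝ) < N := by linarith
  have hNpos : 0 < N := by exact_mod_cast hN0
  have : Nonempty (Fin N) := ⟨⟨0, hNpos⟩⟩
  have hpi := Real.pi_pos
  set β : ℝ := ((N : ℝ) + 2 * s) / 4 with hβ
  set γ : ℝ := ((N : ℝ) - 2 * s) / 4 with hγ
  have hβγ : β - s = γ := by rw [hβ, hγ]; ring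
  have hβN : β < N / 2 := by rw [hβ]; linarith
  have hγN : γ < N / 2 := by rw [hγ]; linarith
  have hβ0 : 0 < β := by positivity
  have hγ0 : 0 < γ := by rw [hγ]; linarith
  have hNβ : (N : ℝ) / 2 - β = γ := by rw [hβ, hγ]; ring
  have hNγ : (N : ℝ) / 2 - γ = β := by rw [hβ, hγ]; ring
  have hΓβ := Real.Gamma_pos_of_pos hβ0
  have hΓγ := Real.Gamma_pos_of_pos hγ0
  have hΓs := Real.Gamma_pos_of_pos (show 0 < 1 - s by linarith)
  have hΓN : 0 < Real.Gamma ((N : ℝ) / 2 + s) := Real.Gamma_pos_of_pos (by positivity)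
  have habs : |Real.Gamma (-s)| = Real.Gamma (1 - s) / s := by
    have h := Real.Gamma_add_one (s := -s) (by linarith)
    rw [show -s + 1 = 1 - s by ring] at h
    rw [h, abs_of_neg (by nlinarith)]
    field_simp
  have h4 : (2 : ℝ) ^ (2 * s) = 4 ^ s := by
    rw [Real.rpow_mul (by norm_num)]; norm_num
  set ρ : ℕ → ℝ := fun n => 1 / ((n : ℝ) + 1) with hρ
  have hρpos : ∀ n, 0 < ρ n := fun n => by positivity
  have hρ0 : Tendsto ρ atTop (𝓝 0) := tendsto_one_div_add_atTop_nhds_zero_nat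
  set q : ℕ → EuclideanSpace ℝ (Fin N) → ℝ := fun n x =>
    u x ^ 2 / heatPotential β (ρ n) x * heatPotential γ (ρ n) x with hq
  have hqm : ∀ n, Measurable (q n) := fun n =>
    ((hum.pow_const 2).div measurable_heatPotential).mul measurable_heatPotential
  have hqint : ∀ n, ∫⁻ z, ENNReal.ofReal (z.2 ^ (-s) * hardyDensity β (ρ n) u z)
      ∂(volume.prod (volume.restrict (Ioi (ρ n)))) = ∫⁻ x, ENNReal.ofReal (q n x) := fun n => by
    rw [lintegral_prod _ (by exact ((measurable_snd.pow_const _).mul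
      (measurable_hardyDensity hum)).ennreal_ofReal.aemeasurable)]
    refine lintegral_congr fun x => ?_
    have hw := heatPotential_pos hβN (hρpos n) x
    have hux : 0 ≤ u x ^ 2 / heatPotential β (ρ n) x := by positivity
    rw [hq, ENNReal.ofReal_mul hux, ofReal_heatPotential hγN (hρpos n),
      ← lintegral_const_mul' _ _ ENNReal.ofReal_ne_top]
    refine setLIntegral_congr_fun measurableSet_Ioi fun r hr => ?_
    have hr0 : 0 < r := (hρpos n).trans hr
    simp only
    rw [← ENNReal.ofReal_mul (Real.rpow_nonneg hr0.le _), ← ENNReal.ofReal_mul hux, hardyDensity]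
    congr 1
    rw [show γ - 1 = -s + (β - 1) by rw [← hβγ]; ring, Real.rpow_add hr0]
    ring
  have hlim : ∀ᵐ x, ENNReal.ofReal (4 ^ s * Real.Gamma β / Real.Gamma γ) *
      ENNReal.ofReal (|u x| ^ 2 / ‖x‖ ^ (2 * s)) =
      liminf (fun n => ENNReal.ofReal (q n x)) atTop := by
    filter_upwards [compl_mem_ae_iff.2 (measure_singleton (0 : EuclideanSpace ℝ (Fin N)))] with x hx
    have hx0 : x ≠ 0 := hx
    have hxp : 0 < ‖x‖ := norm_pos_iff.2 hx0
    have hw1 := tendsto_heatPotential hβN hx0 hρpos hρ0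
    have hw2 := tendsto_heatPotential hγN hx0 hρpos hρ0
    rw [hNβ] at hw1
    rw [hNγ] at hw2
    have hne : (4 * Real.pi) ^ (-((N : ℝ) / 2)) * ((‖x‖ ^ 2 / 4) ^ (-γ) * Real.Gamma γ) ≠ 0 := by
      positivity
    have hl : Tendsto (fun n => q n x) atTop (𝓝 _) :=
      ((tendsto_const_nhds (x := u x ^ 2)).div hw1 hne).mul hw2
    rw [(ENNReal.tendsto_ofReal hl).liminf_eq, ← ENNReal.ofReal_mul (by positivity)]
    congr 1
    have hβe : (‖x‖ ^ 2 / 4) ^ (-β) = (‖x‖ ^ 2 / 4) ^ (-γ) * (4 ^ s / ‖x‖ ^ (2 * s)) := by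
      rw [show -β = -γ + -s by rw [← hβγ]; ring, Real.rpow_add (by positivity)]
      congr 1
      rw [Real.rpow_neg (by positivity), Real.div_rpow (by positivity) (by norm_num),
        ← Real.rpow_natCast ‖x‖ 2, ← Real.rpow_mul hxp.le, inv_div]
      norm_num
    rw [hβe, sq_abs]
    field_simp
  set K : ℝ := Real.Gamma (1 - s) * Real.Gamma β / (s * Real.Gamma γ) with hK
  set κ : ℝ := 4 ^ s * Real.pi ^ (-((N : ℝ) / 2)) * Real.Gamma ((N : ℝ) / 2 + s) with hκ
  have hK0 : 0 < K := by positivity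
  have hbound : ∀ n, ENNReal.ofReal (2 * K) * ∫⁻ x, ENNReal.ofReal (q n x) ≤
      ENNReal.ofReal (κ * ∫ z, gagliardoKernel s u u z) := fun n => by
    have h := ofReal_hardy_truncated hs0 hs1 (by linarith) hβN (hρpos n) hum hu
    rwa [hqint n, hβγ] at h
  have hfatou : ENNReal.ofReal (2 * K) * (ENNReal.ofReal (4 ^ s * Real.Gamma β / Real.Gamma γ) *
      ∫⁻ x, ENNReal.ofReal (|u x| ^ 2 / ‖x‖ ^ (2 * s))) ≤
      ENNReal.ofReal (κ * ∫ z, gagliardoKernel s u u z) := by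
    rw [← lintegral_const_mul' _ _ ENNReal.ofReal_ne_top, lintegral_congr_ae hlim]
    calc _ ≤ ENNReal.ofReal (2 * K) * liminf (fun n => ∫⁻ x, ENNReal.ofReal (q n x)) atTop := by
          gcongr
          exact lintegral_liminf_le fun n => (hqm n).ennreal_ofReal
      _ = liminf (fun n => ENNReal.ofReal (2 * K) * ∫⁻ x, ENNReal.ofReal (q n x)) atTop :=
          (ENNReal.liminf_const_mul_of_ne_top ENNReal.ofReal_ne_top).symm
      _ ≤ _ := by
          refine liminf_le_of_le (by isBoundedDefault) fun b hb => ?_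
          obtain ⟨n, hn⟩ := hb.exists
          exact hn.trans (hbound n)
  -- compare the constants
  have hGs : 0 < Real.Gamma (1 - s) / s := by positivity
  have hc1 : hardyConst N s = (2 * (Real.Gamma (1 - s) / s))⁻¹ *
      (2 * K * (4 ^ s * Real.Gamma β / Real.Gamma γ)) := by
    rw [hardyConst, h4, hK, ← hβ, ← hγ]
    field_simp
  have hc2 : gagliardoForm s u u = (2 * (Real.Gamma (1 - s) / s))⁻¹ *
      (κ * ∫ z, gagliardoKernel s u u z) := by
    rw [gagliardoForm, cNs, habs, Real.rpow_sub (by norm_num), h4, Real.rpow_one, hκ,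
      show ((N : ℝ) + 2 * s) / 2 = (N : ℝ) / 2 + s by ring]
    field_simp
  have hGs' : 0 ≤ (2 * (Real.Gamma (1 - s) / s))⁻¹ := by positivity
  have hK2 : 0 ≤ 2 * K := by positivity
  rw [hc1, hc2, ENNReal.ofReal_mul hGs', ENNReal.ofReal_mul hGs', ENNReal.ofReal_mul hK2,
    mul_assoc, mul_assoc]
  exact mul_le_mul_right hfatou _

/-- The fractional Hardy inequality with its sharp constant. -/
theorem MemHs.hardy {s : ℝ} (hs0 : 0 < s) (hs1 : s < 1) (hN : 2 * s < N) (hu : MemHs s u) :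
    Integrable (fun x => |u x| ^ 2 / ‖x‖ ^ (2 * s)) ∧
      hardyConst N s * ∫ x, |u x| ^ 2 / ‖x‖ ^ (2 * s) ≤ gagliardoForm s u u := by
  obtain ⟨v, hv, huv⟩ := hu.1.1.aemeasurable
  have h := (hu.congr huv).hardy_of_measurable hs0 hs1 hN hv
  have hH : 0 < hardyConst N s := by
    have h1 : 0 < Real.Gamma (((N : ℝ) + 2 * s) / 4) := Real.Gamma_pos_of_pos (by positivity)
    have h2 : 0 < Real.Gamma (((N : ℝ) - 2 * s) / 4) := Real.Gamma_pos_of_pos (by linarith)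
    unfold hardyConst
    positivity
  have hform : gagliardoForm s v v = gagliardoForm s u u := gagliardoForm_congr huv.symm huv.symm
  have hcongr : (fun x => |u x| ^ 2 / ‖x‖ ^ (2 * s)) =ᵐ[volume]
      fun x => |v x| ^ 2 / ‖x‖ ^ (2 * s) := by
    filter_upwards [huv] with x hx
    rw [hx]
  have hi : Integrable fun x => |v x| ^ 2 / ‖x‖ ^ (2 * s) := by
    refine ⟨(((continuous_abs.measurable.comp hv).pow_const 2).div
      (continuous_norm.measurable.pow_const _)).aestronglyMeasurable, ?_⟩
    rw [hasFiniteIntegral_iff_ofReal (Eventually.of_forall fun x => by positivity)]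
    by_contra hcon
    rw [not_lt, top_le_iff] at hcon
    rw [hcon, ENNReal.mul_top (by simpa using hH), top_le_iff] at h
    exact ENNReal.ofReal_ne_top h
  refine ⟨hi.congr hcongr.symm, ?_⟩
  rw [integral_congr_ae hcongr, ← hform]
  rw [← ofReal_integral_eq_lintegral_ofReal hi (Eventually.of_forall fun x => by positivity),
    ← ENNReal.ofReal_mul hH.le] at h
  refine (ENNReal.ofReal_le_ofReal_iff ?_).1 h
  exact mul_nonneg (cNs_pos hs0 hs1).le (integral_nonneg fun z => gagliardoKernel_self_nonneg z)

end Heat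

/-! ### The nonlinearity and its superposition operator -/

section Nonlinearity

/-- A nonlinearity that is jointly measurable, continuous in the second variable, and of growth at
most `|t|^{p-1}` at infinity. -/
structure IsGrowthBounded {α : Type*} [MeasurableSpace α] (p : ℝ) (k : α → ℝ → ℝ) : Prop where
  measurable : Measurable (Function.uncurry k)
  continuous : ∀ x, Continuous (k x)
  growth : ∃ C, 0 ≤ C ∧ ∀ x t, |k x t| ≤ C * (1 + |t| ^ (p - 1))

/-- A growth-bounded nonlinearity that is small compared with `|t|` at zero and with `|t|^{p-1}` at
infinity. -/
structure IsSubcritical {α : Type*} [MeasurableSpace α] (p : ℝ) (g : α → ℝ → ℝ) : Prop where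
  measurable : Measurable (Function.uncurry g)
  continuous : ∀ x, Continuous (g x)
  small_at_zero : ∀ ε, 0 < ε → ∃ C, 0 ≤ C ∧ ∀ x t, |g x t| ≤ ε * |t| + C * |t| ^ (p - 1)
  small_at_infinity : ∀ ε, 0 < ε → ∃ C, 0 ≤ C ∧ ∀ x t, |g x t| ≤ C * |t| + ε * |t| ^ (p - 1)

variable {α : Type*} [MeasurableSpace α] {m : Measure α} {p : ℝ} {k g : α → ℝ → ℝ}

theorem abs_le_one_add_rpow {q : ℝ} (hq : 1 ≤ q) (t : ℝ) : |t| ≤ 1 + |t| ^ q := by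
  rcases le_total |t| 1 with h | h
  · have : 0 ≤ |t| ^ q := by positivity
    linarith
  · have := Real.rpow_le_rpow_of_exponent_le h hq
    rw [Real.rpow_one] at this
    linarith

theorem abs_mul_rpow_sub_two (t : ℝ) {p : ℝ} (hp : p ≠ 1) :
    |(|t| ^ (p - 2) * t)| = |t| ^ (p - 1) := by
  rw [abs_mul, abs_of_nonneg (by positivity)]
  rcases eq_or_ne t 0 with rfl | ht
  · rw [abs_zero, mul_zero, Real.zero_rpow (sub_ne_zero.2 hp)]
  · conv_lhs => rw [← Real.rpow_one |t|, ← Real.rpow_mul (abs_nonneg t), one_mul,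
      ← Real.rpow_add (abs_pos.2 ht)]
    congr 1; ring

theorem abs_rpow_sub_two_mul_self_mul (t : ℝ) {p : ℝ} (hp : p ≠ 0) :
    |t| ^ (p - 2) * t * t = |t| ^ p := by
  rcases eq_or_ne t 0 with rfl | ht
  · rw [mul_zero, abs_zero, Real.zero_rpow hp]
  · rw [mul_assoc, ← sq, ← sq_abs, ← Real.rpow_natCast |t| 2, ← Real.rpow_add (abs_pos.2 ht)]
    congr 1
    push_cast
    ring

theorem rpow_sub_one_mul_self {a p : ℝ} (ha : 0 ≤ a) (hp : 1 < p) : a ^ (p - 1) * a = a ^ p := by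
  rcases ha.eq_or_lt with rfl | ha
  · rw [mul_zero, Real.zero_rpow (by linarith)]
  · conv_lhs => rw [← Real.rpow_one a, ← Real.rpow_mul ha.le, one_mul, ← Real.rpow_add ha]
    congr 1; ring

/-- Adding the critical power to a subcritical nonlinearity. -/
theorem IsSubcritical.isGrowthBounded_add (hp : 2 < p) (hg : IsSubcritical p g) :
    IsGrowthBounded p (fun x t => |t| ^ (p - 2) * t + g x t) := by
  refine ⟨?_, fun x => ?_, ?_⟩
  · have := hg.measurable
    have h1 : Measurable fun t : ℝ => |t| ^ (p - 2) * t :=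
      (continuous_abs.measurable.pow_const _).mul measurable_id
    exact (h1.comp measurable_snd).add this
  · exact ((continuous_abs.rpow_const fun _ => Or.inr (by linarith)).mul continuous_id).add
      (hg.continuous x)
  · obtain ⟨C, hC0, hC⟩ := hg.small_at_zero 1 one_pos
    refine ⟨C + 2, by linarith, fun x t => (abs_add_le _ _).trans ?_⟩
    rw [abs_mul_rpow_sub_two t (by linarith)]
    have h1 := hC x t
    have h2 := abs_le_one_add_rpow (show 1 ≤ p - 1 by linarith) t
    nlinarith

theorem rpow_mul_le_add_rpow {a b p ε : ℝ} (hp : 1 < p) (ha : 0 ≤ a) (hb : 0 ≤ b) (hε : 0 < ε) :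
    a ^ (p - 1) * b ≤ ε * a ^ p + ε⁻¹ ^ (p - 1) * b ^ p := by
  have h1 : 0 ≤ a ^ p := by positivity
  have h2 : 0 ≤ ε⁻¹ ^ (p - 1) * b ^ p := by positivity
  rcases le_total b (ε * a) with h | h
  · calc a ^ (p - 1) * b ≤ a ^ (p - 1) * (ε * a) := by gcongr
      _ = ε * a ^ p := by rw [← rpow_sub_one_mul_self ha hp]; ring
      _ ≤ _ := by linarith
  · have h3 : a ≤ ε⁻¹ * b := by rw [inv_mul_eq_div, le_div_iff₀ hε]; linarith
    calc a ^ (p - 1) * b ≤ (ε⁻¹ * b) ^ (p - 1) * b := by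
          gcongr
      _ = ε⁻¹ ^ (p - 1) * b ^ p := by
          rw [Real.mul_rpow (by positivity) hb, mul_assoc, rpow_sub_one_mul_self hb hp]
      _ ≤ _ := by nlinarith

theorem add_rpow_le_two_rpow_mul {a b p : ℝ} (ha : 0 ≤ a) (hb : 0 ≤ b) (hp : 0 ≤ p) :
    (a + b) ^ p ≤ 2 ^ p * (a ^ p + b ^ p) := by
  have h1 : 0 ≤ a ^ p := by positivity
  have h2 : 0 ≤ b ^ p := by positivity
  rcases le_total a b with h | h
  · calc (a + b) ^ p ≤ (2 * b) ^ p := by gcongr; linarith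
      _ = 2 ^ p * b ^ p := Real.mul_rpow (by norm_num) hb
      _ ≤ _ := by gcongr; linarith
  · calc (a + b) ^ p ≤ (2 * a) ^ p := by gcongr; linarith
      _ = 2 ^ p * a ^ p := Real.mul_rpow (by norm_num) ha
      _ ≤ _ := by gcongr; linarith

theorem aestronglyMeasurable_abs_rpow {u : α → ℝ} (hu : AEStronglyMeasurable u m) (p : ℝ) :
    AEStronglyMeasurable (fun x => |u x| ^ p) m :=
  ((continuous_abs.measurable.pow_const p).comp_aemeasurable hu.aemeasurable).aestronglyMeasurable

theorem integrable_abs_add_rpow (hp : 1 < p) {u v : α → ℝ} (hu : AEStronglyMeasurable u m)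
    (hv : AEStronglyMeasurable v m) (hup : Integrable (fun x => |u x| ^ p) m)
    (hvp : Integrable (fun x => |v x| ^ p) m) : Integrable (fun x => (|u x| + |v x|) ^ p) m := by
  refine ((hup.add hvp).const_mul (2 ^ p)).mono' ?_ (Eventually.of_forall fun x => ?_)
  · have := hu.aemeasurable
    have := hv.aemeasurable
    exact AEMeasurable.aestronglyMeasurable (by fun_prop)
  · rw [Real.norm_of_nonneg (by positivity)]
    exact add_rpow_le_two_rpow_mul (abs_nonneg _) (abs_nonneg _) (by linarith)

namespace IsGrowthBounded

theorem aestronglyMeasurable_comp (hk : IsGrowthBounded p k) {u : α → ℝ}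
    (hu : AEStronglyMeasurable u m) : AEStronglyMeasurable (fun x => k x (u x)) m :=
  (hk.measurable.comp_aemeasurable
    (aemeasurable_id.prodMk hu.aemeasurable)).aestronglyMeasurable

theorem integrable_mul [IsFiniteMeasure m] (hp : 1 < p) (hk : IsGrowthBounded p k) {u φ : α → ℝ}
    (hu : AEStronglyMeasurable u m) (hφ : AEStronglyMeasurable φ m)
    (hup : Integrable (fun x => |u x| ^ p) m) (hφp : Integrable (fun x => |φ x| ^ p) m) :
    Integrable (fun x => k x (u x) * φ x) m := by
  obtain ⟨C, hC0, hC⟩ := hk.growth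
  refine ((((integrable_const (1 : ℝ)).add hφp).add (hup.add hφp)).const_mul C).mono'
    ((hk.aestronglyMeasurable_comp hu).mul hφ) (Eventually.of_forall fun x => ?_)
  have h1 := abs_le_one_add_rpow hp.le (φ x)
  have h2 := rpow_mul_le_add_rpow hp (abs_nonneg (u x)) (abs_nonneg (φ x)) one_pos
  rw [inv_one, Real.one_rpow, one_mul, one_mul] at h2
  rw [norm_mul, Real.norm_eq_abs, Real.norm_eq_abs]
  simp only [Pi.add_apply]
  calc |k x (u x)| * |φ x| ≤ C * (1 + |u x| ^ (p - 1)) * |φ x| := by gcongr; exact hC _ _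
    _ = C * (|φ x| + |u x| ^ (p - 1) * |φ x|) := by ring
    _ ≤ _ := by gcongr

theorem measurable_primitive (hk : IsGrowthBounded p k) :
    Measurable fun q : α × ℝ => ∫ τ in (0 : ℝ)..q.2, k q.1 τ := by
  have h1 : ∀ q : α × ℝ, ∫ τ in (0 : ℝ)..q.2, k q.1 τ =
      q.2 * ∫ θ in Ioc (0 : ℝ) 1, k q.1 (q.2 * θ) := fun q => by
    rw [← intervalIntegral.integral_of_le zero_le_one, ← smul_eq_mul,
      intervalIntegral.smul_integral_comp_mul_left, mul_zero, mul_one]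
  simp_rw [h1]
  refine measurable_snd.mul ?_
  have h2 : StronglyMeasurable fun z : (α × ℝ) × ℝ => k z.1.1 (z.1.2 * z.2) :=
    (hk.measurable.comp ((measurable_fst.comp measurable_fst).prodMk
      ((measurable_snd.comp measurable_fst).mul measurable_snd))).stronglyMeasurable
  exact (h2.integral_prod_right' (ν := volume.restrict (Ioc 0 1))).measurable

theorem hasDerivAt_primitive (hk : IsGrowthBounded p k) (x : α) (t : ℝ) :
    HasDerivAt (fun t => ∫ τ in (0 : ℝ)..t, k x τ) (k x t) t :=
  intervalIntegral.integral_hasDerivAt_right ((hk.continuous x).intervalIntegrable _ _)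
    ((hk.continuous x).stronglyMeasurableAtFilter _ _) (hk.continuous x).continuousAt

theorem integrable_primitive [IsFiniteMeasure m] (hp : 1 < p) (hk : IsGrowthBounded p k) {u : α → ℝ}
    (hu : AEStronglyMeasurable u m) (hup : Integrable (fun x => |u x| ^ p) m) :
    Integrable (fun x => ∫ τ in (0 : ℝ)..(u x), k x τ) m := by
  obtain ⟨C, hC0, hC⟩ := hk.growth
  refine ((((integrable_const (1 : ℝ)).add hup).add hup).const_mul C).mono'
    ((hk.measurable_primitive.comp_aemeasurable
      (aemeasurable_id.prodMk hu.aemeasurable)).aestronglyMeasurable)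
    (Eventually.of_forall fun x => ?_)
  have h1 : ‖∫ τ in (0 : ℝ)..(u x), k x τ‖ ≤ C * (1 + |u x| ^ (p - 1)) * |u x - 0| := by
    refine intervalIntegral.norm_integral_le_of_norm_le_const fun τ hτ => (hC x τ).trans ?_
    have : |τ| ≤ |u x| := by
      rcases le_total 0 (u x) with h | h
      · rw [uIoc_of_le h] at hτ
        rw [abs_of_pos hτ.1, abs_of_nonneg h]; exact hτ.2
      · rw [uIoc_of_ge h] at hτ
        rw [abs_of_nonpos hτ.2, abs_of_nonpos h]; linarith [hτ.1]
    have : |τ| ^ (p - 1) ≤ |u x| ^ (p - 1) := Real.rpow_le_rpow (abs_nonneg _) this (by linarith)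
    gcongr
  have h2 := abs_le_one_add_rpow hp.le (u x)
  simp only [Pi.add_apply]
  rw [sub_zero] at h1
  calc _ ≤ C * (|u x| + |u x| ^ (p - 1) * |u x|) := by linarith
    _ ≤ _ := by rw [rpow_sub_one_mul_self (abs_nonneg _) hp]; gcongr

/-- The superposition functional has Gateaux derivative `φ ↦ ∫ k(x, u) φ`. -/
theorem hasDerivAt_integral_primitive [IsFiniteMeasure m] (hp : 1 < p) (hk : IsGrowthBounded p k)
    {u φ : α → ℝ} (hu : AEStronglyMeasurable u m) (hφ : AEStronglyMeasurable φ m)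
    (hup : Integrable (fun x => |u x| ^ p) m) (hφp : Integrable (fun x => |φ x| ^ p) m) :
    HasDerivAt (fun h : ℝ => ∫ x, (∫ τ in (0 : ℝ)..(u x + h * φ x), k x τ) ∂m)
      (∫ x, k x (u x) * φ x ∂m) 0 := by
  obtain ⟨C, hC0, hC⟩ := hk.growth
  have hsum := integrable_abs_add_rpow hp hu hφ hup hφp
  have h := hasDerivAt_integral_of_dominated_loc_of_deriv_le (μ := m) (x₀ := (0 : ℝ))
    (F := fun h x => ∫ τ in (0 : ℝ)..(u x + h * φ x), k x τ)
    (F' := fun h x => k x (u x + h * φ x) * φ x)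
    (bound := fun x => C * ((1 + |φ x| ^ p) + (|u x| + |φ x|) ^ p))
    (Metric.ball_mem_nhds 0 one_pos) (Eventually.of_forall fun h => ?_)
    (by simpa using hk.integrable_primitive hp hu hup)
    (by simp only [zero_mul, add_zero]; exact (hk.aestronglyMeasurable_comp hu).mul hφ)
    (Eventually.of_forall fun x h hh => ?_)
    ((((integrable_const (1 : ℝ)).add hφp).add hsum).const_mul C)
    (Eventually.of_forall fun x h _ => ?_)
  · simpa using h.2
  · exact (hk.measurable_primitive.comp_aemeasurable
      (aemeasurable_id.prodMk (hu.add (hφ.const_mul h)).aemeasurable)).aestronglyMeasurable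
  · have hh1 : |h| ≤ 1 := by
      rw [Metric.mem_ball, dist_zero_right, Real.norm_eq_abs] at hh; exact hh.le
    have h1 := abs_le_one_add_rpow hp.le (φ x)
    have h2 : |u x + h * φ x| ≤ |u x| + |φ x| := by
      refine (abs_add_le _ _).trans ?_
      rw [abs_mul]
      nlinarith [abs_nonneg (φ x)]
    have h3 : |u x + h * φ x| ^ (p - 1) ≤ (|u x| + |φ x|) ^ (p - 1) :=
      Real.rpow_le_rpow (abs_nonneg _) h2 (by linarith)
    have h4 : (|u x| + |φ x|) ^ (p - 1) * |φ x| ≤ (|u x| + |φ x|) ^ p := by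
      rw [← rpow_sub_one_mul_self (by positivity : 0 ≤ |u x| + |φ x|) hp]
      gcongr
      linarith [abs_nonneg (u x)]
    rw [norm_mul, Real.norm_eq_abs, Real.norm_eq_abs]
    calc |k x (u x + h * φ x)| * |φ x| ≤ C * (1 + (|u x| + |φ x|) ^ (p - 1)) * |φ x| := by
          gcongr
          exact (hC _ _).trans (by gcongr)
      _ = C * (|φ x| + (|u x| + |φ x|) ^ (p - 1) * |φ x|) := by ring
      _ ≤ _ := by gcongr
  · have h1 : HasDerivAt (fun h : ℝ => u x + h * φ x) (φ x) h := by
      simpa using ((hasDerivAt_id h).mul_const (φ x)).const_add (u x)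
    exact (hk.hasDerivAt_primitive x (u x + h * φ x)).comp h h1

/-- A dominated convergence theorem in which the bound is perturbed by functions whose integrals
have small upper limit. -/
theorem _root_.tendsto_integral_of_le_add {a r : ℕ → α → ℝ} {h : α → ℝ}
    (ham : ∀ n, AEStronglyMeasurable (a n) m) (ha0 : ∀ n x, 0 ≤ a n x)
    (hlim : ∀ᵐ x ∂m, Tendsto (fun n => a n x) atTop (𝓝 0)) (hh : Integrable h m)
    (hr : ∀ n, Integrable (r n) m) (hle : ∀ n x, a n x ≤ h x + r n x) (hr0 : ∀ n x, 0 ≤ r n x)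
    (hh0 : ∀ x, 0 ≤ h x) {δ : ℝ} (hδ : ∀ᶠ n in atTop, ∫ x, r n x ∂m ≤ δ) {ε : ℝ} (hε : δ < ε) :
    ∀ᶠ n in atTop, ∫ x, a n x ∂m < ε := by
  have h1 : Tendsto (fun n => ∫ x, min (a n x) (h x) ∂m) atTop (𝓝 (∫ _, (0 : ℝ) ∂m)) := by
    refine tendsto_integral_of_dominated_convergence h (fun n => (ham n).inf hh.1) hh
      (fun n => Eventually.of_forall fun x => ?_) ?_
    · rw [Real.norm_of_nonneg (le_min (ha0 n x) (hh0 x))]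
      exact min_le_right _ _
    · filter_upwards [hlim] with x hx
      have := hx.min (tendsto_const_nhds (x := h x))
      rwa [min_eq_left (hh0 x)] at this
  rw [integral_zero] at h1
  filter_upwards [h1.eventually (gt_mem_nhds (sub_pos.2 hε)), hδ] with n hn hδn
  have hmin : Integrable (fun x => min (a n x) (h x)) m :=
    hh.mono' ((ham n).inf hh.1) (Eventually.of_forall fun x => by
      rw [Real.norm_of_nonneg (le_min (ha0 n x) (hh0 x))]; exact min_le_right _ _)
  have h2 : ∫ x, a n x ∂m ≤ ∫ x, (min (a n x) (h x) + r n x) ∂m := by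
    refine integral_mono_of_nonneg (Eventually.of_forall fun x => ha0 n x) (hmin.add (hr n))
      (Eventually.of_forall fun x => ?_)
    simp only
    rcases le_total (a n x) (h x) with hx | hx
    · rw [min_eq_left hx]; linarith [hr0 n x]
    · rw [min_eq_right hx]; exact hle n x
  rw [integral_add hmin (hr n)] at h2
  linarith

/-- Continuity of the superposition operator from `L^p` to the dual exponent. -/
theorem tendsto_integral_sub_rpow [IsFiniteMeasure m] (hp : 2 < p) (hk : IsGrowthBounded p k)
    {u : ℕ → α → ℝ} {v : α → ℝ} (hu : ∀ n, AEStronglyMeasurable (u n) m)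
    (hv : AEStronglyMeasurable v m) (hvp : Integrable (fun x => |v x| ^ p) m)
    (hup : ∀ n, Integrable (fun x => |u n x - v x| ^ p) m)
    (hlim : Tendsto (fun n => ∫ x, |u n x - v x| ^ p ∂m) atTop (𝓝 0))
    (hae : ∀ᵐ x ∂m, Tendsto (fun n => u n x) atTop (𝓝 (v x))) :
    Tendsto (fun n => ∫ x, |k x (u n x) - k x (v x)| ^ (p / (p - 1)) ∂m) atTop (𝓝 0) := by
  obtain ⟨C, hC0, hC⟩ := hk.growth
  have hp1 : 0 < p - 1 := by linarith
  have hp0 : 0 < p := by linarith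
  set q := p / (p - 1) with hq
  have hq0 : 0 < q := by positivity
  have hqp : (p - 1) * q = p := by rw [hq]; field_simp
  -- the constants come from `|t|^{p-1}` to the power `q` being `|t|^p`
  set D : ℝ := (4 * C) ^ q * 2 ^ q with hD
  have hD0 : 0 ≤ D := by positivity
  have hbound : ∀ n x, |k x (u n x) - k x (v x)| ^ q ≤
      D * (1 + 2 ^ p * |v x| ^ p) + D * 2 ^ p * |u n x - v x| ^ p := fun n x => by
    set M := |v x| + |u n x - v x| with hM
    have hM0 : 0 ≤ M := by positivity
    have h1 : |u n x| ≤ M := by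
      have := abs_add_le (v x) (u n x - v x)
      rwa [add_sub_cancel] at this
    have h2 : |v x| ≤ M := by linarith [abs_nonneg (u n x - v x)]
    have h3 : |k x (u n x) - k x (v x)| ≤ 4 * C * (1 + M ^ (p - 1)) := by
      have ha : |u n x| ^ (p - 1) ≤ M ^ (p - 1) := Real.rpow_le_rpow (abs_nonneg _) h1 hp1.le
      have hb : |v x| ^ (p - 1) ≤ M ^ (p - 1) := Real.rpow_le_rpow (abs_nonneg _) h2 hp1.le
      have hc : 0 ≤ M ^ (p - 1) := by positivity
      have := abs_sub (k x (u n x)) (k x (v x))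
      nlinarith [hC x (u n x), hC x (v x)]
    calc |k x (u n x) - k x (v x)| ^ q ≤ (4 * C * (1 + M ^ (p - 1))) ^ q := by gcongr
      _ = (4 * C) ^ q * (1 + M ^ (p - 1)) ^ q := Real.mul_rpow (by positivity) (by positivity)
      _ ≤ (4 * C) ^ q * (2 ^ q * (1 ^ q + (M ^ (p - 1)) ^ q)) := by
          gcongr
          exact add_rpow_le_two_rpow_mul zero_le_one (by positivity) hq0.le
      _ = D * (1 + M ^ p) := by rw [Real.one_rpow, ← Real.rpow_mul hM0, hqp, hD]; ring
      _ ≤ D * (1 + 2 ^ p * (|v x| ^ p + |u n x - v x| ^ p)) := by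
          gcongr
          exact add_rpow_le_two_rpow_mul (abs_nonneg _) (abs_nonneg _) hp0.le
      _ = _ := by ring
  rw [Metric.tendsto_atTop']
  intro ε hε
  have hr : Tendsto (fun n => ∫ x, D * 2 ^ p * |u n x - v x| ^ p ∂m) atTop (𝓝 0) := by
    simp_rw [integral_const_mul]
    simpa using hlim.const_mul (D * 2 ^ p)
  have h := tendsto_integral_of_le_add (m := m) (a := fun n x => |k x (u n x) - k x (v x)| ^ q)
    (r := fun n x => D * 2 ^ p * |u n x - v x| ^ p) (h := fun x => D * (1 + 2 ^ p * |v x| ^ p))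
    (fun n => aestronglyMeasurable_abs_rpow ((hk.aestronglyMeasurable_comp (hu n)).sub
      (hk.aestronglyMeasurable_comp hv)) q)
    (fun n x => by positivity) ?_ (((integrable_const _).add (hvp.const_mul _)).const_mul D)
    (fun n => (hup n).const_mul _) hbound (fun n x => by positivity) (fun x => by positivity)
    (hr.eventually (ge_mem_nhds (half_pos hε))) (half_lt_self hε)
  · obtain ⟨n₀, hn₀⟩ := eventually_atTop.1 h
    refine ⟨n₀, fun n hn => ?_⟩
    rw [Real.dist_eq, sub_zero, abs_of_nonneg (integral_nonneg fun x => by positivity)]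
    exact hn₀ n hn.le
  · filter_upwards [hae] with x hx
    have h1 := (((hk.continuous x).tendsto (v x)).comp hx).sub_const (k x (v x))
    rw [sub_self] at h1
    have h2 := (h1.abs).rpow_const (p := q) (Or.inr hq0.le)
    rwa [abs_zero, Real.zero_rpow hq0.ne'] at h2

/-- Weak continuity of the superposition operator along almost everywhere convergent sequences
that are bounded in `L^p`. -/
theorem tendsto_integral_mul [IsFiniteMeasure m] (hp : 1 < p) (hk : IsGrowthBounded p k)
    {u : ℕ → α → ℝ} {v φ : α → ℝ} (hu : ∀ n, AEStronglyMeasurable (u n) m)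
    (hv : AEStronglyMeasurable v m) (hφ : AEStronglyMeasurable φ m)
    (hvp : Integrable (fun x => |v x| ^ p) m) (hφp : Integrable (fun x => |φ x| ^ p) m)
    (hup : ∀ n, Integrable (fun x => |u n x| ^ p) m) {M : ℝ}
    (hM : ∀ n, ∫ x, |u n x| ^ p ∂m ≤ M)
    (hae : ∀ᵐ x ∂m, Tendsto (fun n => u n x) atTop (𝓝 (v x))) :
    Tendsto (fun n => ∫ x, k x (u n x) * φ x ∂m) atTop (𝓝 (∫ x, k x (v x) * φ x ∂m)) := by
  obtain ⟨C, hC0, hC⟩ := hk.growth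
  have hM0 : 0 ≤ M := (integral_nonneg fun x => by positivity).trans (hM 0)
  rw [Metric.tendsto_atTop']
  intro ε hε
  -- Young's inequality with a small coefficient in front of `|u n|^p`
  set η : ℝ := ε / 2 / (C * M + 1) with hη
  have hη0 : 0 < η := by positivity
  have hbound : ∀ n x, |k x (u n x) - k x (v x)| * |φ x| ≤
      (C * ((1 + |φ x| ^ p) + η⁻¹ ^ (p - 1) * |φ x| ^ p) + |k x (v x) * φ x|) +
        C * η * |u n x| ^ p := fun n x => by
    have h1 := abs_le_one_add_rpow hp.le (φ x)
    have h2 := rpow_mul_le_add_rpow hp (abs_nonneg (u n x)) (abs_nonneg (φ x)) hη0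
    calc |k x (u n x) - k x (v x)| * |φ x| ≤ (|k x (u n x)| + |k x (v x)|) * |φ x| := by
          gcongr
          exact abs_sub _ _
      _ ≤ (C * (1 + |u n x| ^ (p - 1)) + |k x (v x)|) * |φ x| := by gcongr; exact hC _ _
      _ = C * (|φ x| + |u n x| ^ (p - 1) * |φ x|) + |k x (v x) * φ x| := by rw [abs_mul]; ring
      _ ≤ C * ((1 + |φ x| ^ p) + (η * |u n x| ^ p + η⁻¹ ^ (p - 1) * |φ x| ^ p)) +
            |k x (v x) * φ x| := by gcongr
      _ = _ := by ring
  have hvi := hk.integrable_mul hp hv hφ hvp hφp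
  have hδ : ∀ n, ∫ x, C * η * |u n x| ^ p ∂m ≤ ε / 2 := fun n => by
    rw [integral_const_mul]
    calc C * η * ∫ x, |u n x| ^ p ∂m ≤ C * η * M := by gcongr; exact hM n
      _ = ε / 2 * (C * M / (C * M + 1)) := by rw [hη]; ring
      _ ≤ ε / 2 * 1 := by
          gcongr
          rw [div_le_one (by positivity)]
          linarith
      _ = _ := mul_one _
  have h := tendsto_integral_of_le_add (m := m)
    (a := fun n x => |k x (u n x) - k x (v x)| * |φ x|)
    (r := fun n x => C * η * |u n x| ^ p)
    (h := fun x => C * ((1 + |φ x| ^ p) + η⁻¹ ^ (p - 1) * |φ x| ^ p) + |k x (v x) * φ x|)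
    (fun n => (((hk.aestronglyMeasurable_comp (hu n)).sub
      (hk.aestronglyMeasurable_comp hv)).norm).mul hφ.norm)
    (fun n x => by positivity) ?_
    ((((((integrable_const (1 : ℝ)).add hφp).add (hφp.const_mul _)).const_mul C)).add hvi.abs)
    (fun n => (hup n).const_mul _) hbound (fun n x => by positivity) (fun x => by positivity)
    (Eventually.of_forall hδ) (half_lt_self hε)
  · obtain ⟨n₀, hn₀⟩ := eventually_atTop.1 h
    refine ⟨n₀, fun n hn => ?_⟩
    rw [Real.dist_eq, ← integral_sub (hk.integrable_mul hp (hu n) hφ (hup n) hφp) hvi]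
    refine (abs_integral_le_integral_abs).trans_lt ?_
    simp_rw [← sub_mul, abs_mul]
    exact hn₀ n hn.le
  · filter_upwards [hae] with x hx
    have h1 := (((hk.continuous x).tendsto (v x)).comp hx).sub_const (k x (v x))
    rw [sub_self] at h1
    have h2 := (h1.abs).mul_const |φ x|
    rwa [abs_zero, zero_mul] at h2

end IsGrowthBounded

theorem integral_abs_rpow_mul (hp : 1 < p) (t : ℝ) :
    ∫ τ in (0 : ℝ)..t, |τ| ^ (p - 2) * τ = 1 / p * |t| ^ p := by
  have hc : ∀ τ : ℝ, HasDerivAt (fun τ : ℝ => 1 / p * |τ| ^ p) (|τ| ^ (p - 2) * τ) τ := fun τ => by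
    have h := (hasDerivAt_abs_rpow τ hp).const_mul (1 / p)
    refine h.congr_deriv ?_
    field_simp
  have hcont : Continuous fun τ : ℝ => |τ| ^ (p - 2) * τ := by
    have h1 := contDiff_norm_rpow (E := ℝ) hp
    have h2 : (fun τ : ℝ => |τ| ^ (p - 2) * τ) = deriv (fun τ : ℝ => 1 / p * ‖τ‖ ^ p) := by
      funext τ
      exact (hc τ).deriv.symm
    rw [h2]
    exact (contDiff_const.mul h1).continuous_deriv le_rfl
  rw [intervalIntegral.integral_eq_sub_of_hasDerivAt (fun τ _ => hc τ)
    (hcont.intervalIntegrable _ _), abs_zero, Real.zero_rpow (by linarith)]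
  ring

theorem abs_primitive_le (hp : 1 < p) {A B : ℝ} (hA : 0 ≤ A) (hB : 0 ≤ B) {g : ℝ → ℝ}
    (hg : ∀ t, |g t| ≤ A * |t| + B * |t| ^ (p - 1)) (t : ℝ) :
    |∫ τ in (0 : ℝ)..t, g τ| ≤ A * t ^ 2 + B * |t| ^ p := by
  have h1 : ‖∫ τ in (0 : ℝ)..t, g τ‖ ≤ (A * |t| + B * |t| ^ (p - 1)) * |t - 0| := by
    refine intervalIntegral.norm_integral_le_of_norm_le_const fun τ hτ => (hg τ).trans ?_
    have : |τ| ≤ |t| := by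
      rcases le_total 0 t with h | h
      · rw [uIoc_of_le h] at hτ
        rw [abs_of_pos hτ.1, abs_of_nonneg h]; exact hτ.2
      · rw [uIoc_of_ge h] at hτ
        rw [abs_of_nonpos hτ.2, abs_of_nonpos h]; linarith [hτ.1]
    have h2 : |τ| ^ (p - 1) ≤ |t| ^ (p - 1) := Real.rpow_le_rpow (abs_nonneg _) this (by linarith)
    gcongr
  rw [sub_zero, Real.norm_eq_abs] at h1
  refine h1.trans_eq ?_
  rw [← rpow_sub_one_mul_self (abs_nonneg t) hp, ← sq_abs t]
  ring

namespace IsSubcritical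

theorem isGrowthBounded (hp : 2 < p) (hg : IsSubcritical p g) : IsGrowthBounded p g := by
  refine ⟨hg.measurable, hg.continuous, ?_⟩
  obtain ⟨C, hC0, hC⟩ := hg.small_at_zero 1 one_pos
  refine ⟨C + 1, by linarith, fun x t => (hC x t).trans ?_⟩
  have h2 := abs_le_one_add_rpow (show 1 ≤ p - 1 by linarith) t
  nlinarith

theorem abs_primitive_small_at_zero (hp : 1 < p) (hg : IsSubcritical p g) {ε : ℝ} (hε : 0 < ε) :
    ∃ C, 0 ≤ C ∧ ∀ x t, |∫ τ in (0 : ℝ)..t, g x τ| ≤ ε * t ^ 2 + C * |t| ^ p := by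
  obtain ⟨C, hC0, hC⟩ := hg.small_at_zero ε hε
  exact ⟨C, hC0, fun x t => abs_primitive_le hp hε.le hC0 (hC x) t⟩

/-- Both `g(x, t) t` and the primitive of `g` are negligible compared with `|t|^p`, up to
a multiple of `t²`. -/
theorem abs_small_at_infinity (hp : 1 < p) (hg : IsSubcritical p g) {ε : ℝ} (hε : 0 < ε) :
    ∃ C, 0 ≤ C ∧ ∀ x t, |∫ τ in (0 : ℝ)..t, g x τ| ≤ C * t ^ 2 + ε * |t| ^ p ∧
      |g x t * t| ≤ C * t ^ 2 + ε * |t| ^ p := by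
  obtain ⟨C, hC0, hC⟩ := hg.small_at_infinity ε hε
  refine ⟨C, hC0, fun x t => ⟨abs_primitive_le hp hC0 hε.le (hC x) t, ?_⟩⟩
  rw [abs_mul]
  calc |g x t| * |t| ≤ (C * |t| + ε * |t| ^ (p - 1)) * |t| := by gcongr; exact hC x t
    _ = _ := by rw [← rpow_sub_one_mul_self (abs_nonneg t) hp, ← sq_abs t]; ring

end IsSubcritical

/-- A Carathéodory function as in the hypotheses coincides, almost everywhere in `Ω`, with
a jointly measurable nonlinearity whose growth bounds hold everywhere. -/
theorem IsLowerOrderPerturbation.exists_isSubcritical {N : ℕ} {s : ℝ} (hs : 0 < s)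
    (hN : 2 * s < N) {Ω : Set (EuclideanSpace ℝ (Fin N))} (hΩ : MeasurableSet Ω)
    {f : EuclideanSpace ℝ (Fin N) → ℝ → ℝ} (hf : IsLowerOrderPerturbation s Ω f) :
    ∃ g : EuclideanSpace ℝ (Fin N) → ℝ → ℝ, IsSubcritical (critExp N s) g ∧
      ∀ᵐ x ∂(volume.restrict Ω), ∀ t, f x t = g x t := by
  classical
  have hp := two_lt_critExp hs hN
  set p := critExp N s with hpdef
  choose D hD using fun n : ℕ => hf.locally_bounded n
  have hmk : ∀ᵐ x ∂(volume.restrict Ω), ∀ q : ℚ, f x q = (hf.aemeasurable q).mk _ x :=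
    ae_all_iff.2 fun q => (hf.aemeasurable q).ae_eq_mk
  -- a measurable set of full measure on which all hypotheses hold pointwise
  have hgood : ∀ᵐ x ∂(volume.restrict Ω), x ∈ Ω ∧ Continuous (f x) ∧
      (∀ n : ℕ, ∀ t : ℝ, |t| ≤ n → |f x t| ≤ D n) ∧
      ∀ q : ℚ, f x q = (hf.aemeasurable q).mk _ x := by
    filter_upwards [ae_restrict_mem hΩ, hf.continuous, ae_all_iff.2 hD, hmk] with x h1 h2 h3 h4
    exact ⟨h1, h2, h3, h4⟩
  obtain ⟨A, hAsub, hAm, hA0⟩ := exists_measurable_superset_of_null (ae_iff.1 hgood)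
  have hA : ∀ x, x ∉ A → x ∈ Ω ∧ Continuous (f x) ∧
      (∀ n : ℕ, ∀ t : ℝ, |t| ≤ n → |f x t| ≤ D n) ∧
      ∀ q : ℚ, f x q = (hf.aemeasurable q).mk _ x := fun x hx => by
    by_contra hcon
    exact hx (hAsub hcon)
  set g : EuclideanSpace ℝ (Fin N) → ℝ → ℝ := fun x t => if x ∈ A then 0 else f x t with hg
  have hgc : ∀ x, Continuous (g x) := fun x => by
    by_cases hx : x ∈ A
    · simp only [hg, if_pos hx]; exact continuous_const
    · simp only [hg, if_neg hx]; exact (hA x hx).2.1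
  have hgq : ∀ q : ℚ, Measurable fun x => g x q := fun q => by
    have : (fun x => g x q) = fun x => if x ∈ A then 0 else (hf.aemeasurable q).mk _ x := by
      funext x
      by_cases hx : x ∈ A
      · simp only [hg, if_pos hx]
      · simp only [hg, if_neg hx]; exact (hA x hx).2.2.2 q
    rw [this]
    exact Measurable.ite hAm measurable_const (hf.aemeasurable q).measurable_mk
  have hgm : ∀ t : ℝ, Measurable fun x => g x t := fun t => by
    obtain ⟨q, -, -, hq⟩ := Real.exists_seq_rat_strictMono_tendsto t
    exact measurable_of_tendsto_metrizable (fun n => hgq (q n))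
      (tendsto_pi_nhds.2 fun x => ((hgc x).tendsto t).comp hq)
  -- pointwise trichotomy: small, large and intermediate arguments
  have hsmall : ∀ ε, 0 < ε → ∃ δ, 0 < δ ∧ ∀ x t, |t| < δ → |g x t| ≤ ε * |t| := by
    have key : ∀ ε, 0 < ε → ∃ δ, 0 < δ ∧ ∀ x t, t ≠ 0 → |t| < δ → |g x t| ≤ ε * |t| :=
      fun ε hε => by
        have h := Metric.tendstoUniformlyOn_iff.1 hf.at_zero ε hε
        rw [eventually_nhdsWithin_iff, Metric.eventually_nhds_iff] at h
        obtain ⟨δ, hδ, h⟩ := h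
        refine ⟨δ, hδ, fun x t ht0 ht => ?_⟩
        by_cases hx : x ∈ A
        · simp only [hg, if_pos hx, abs_zero]; positivity
        · simp only [hg, if_neg hx]
          have h1 := h (by simpa using ht) ht0 x (hA x hx).1
          rw [dist_comm, Real.dist_eq, sub_zero, abs_div, div_lt_iff₀ (abs_pos.2 ht0)] at h1
          exact h1.le
    intro ε hε
    obtain ⟨δ, hδ, h⟩ := key ε hε
    refine ⟨δ, hδ, fun x t ht => ?_⟩
    rcases eq_or_ne t 0 with rfl | ht0
    · have h1 : Tendsto (fun t => |g x t|) (𝓝[≠] 0) (𝓝 |g x 0|) :=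
        ((hgc x).abs.tendsto 0).mono_left nhdsWithin_le_nhds
      have h2 : Tendsto (fun t : ℝ => ε * |t|) (𝓝[≠] 0) (𝓝 (ε * |0|)) :=
        (Continuous.tendsto (by fun_prop) 0).mono_left nhdsWithin_le_nhds
      refine le_of_tendsto_of_tendsto h1 h2 ?_
      rw [EventuallyLE, eventually_nhdsWithin_iff, Metric.eventually_nhds_iff]
      exact ⟨δ, hδ, fun t ht ht0 => h x t ht0 (by simpa using ht)⟩
    · exact h x t ht0 ht
  have hlarge : ∀ ε, 0 < ε → ∃ n : ℕ, ∀ x t, (n : ℝ) < |t| → |g x t| ≤ ε * |t| ^ (p - 1) :=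
    fun ε hε => by
      have h := Metric.tendstoUniformlyOn_iff.1 hf.at_infinity ε hε
      rw [← comap_norm_atTop, eventually_comap] at h
      obtain ⟨R, hR⟩ := eventually_atTop.1 h
      obtain ⟨n, hn⟩ := exists_nat_ge R
      refine ⟨n, fun x t ht => ?_⟩
      by_cases hx : x ∈ A
      · simp only [hg, if_pos hx, abs_zero]; positivity
      · simp only [hg, if_neg hx]
        have h1 := hR |t| (by linarith) t (Real.norm_eq_abs t) x (hA x hx).1
        have htp : 0 < |t| := (Nat.cast_nonneg n).trans_lt ht
        have htp' : 0 < |t| ^ (p - 1) := by positivity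
        rw [dist_comm, Real.dist_eq, sub_zero, abs_div, abs_of_pos htp', div_lt_iff₀ htp'] at h1
        exact h1.le
  have hmid : ∀ (n : ℕ) x (t : ℝ), |t| ≤ n → |g x t| ≤ |D n| := fun n x t ht => by
    by_cases hx : x ∈ A
    · simp only [hg, if_pos hx, abs_zero]; positivity
    · simp only [hg, if_neg hx]
      exact ((hA x hx).2.2.1 n t ht).trans (le_abs_self _)
  refine ⟨g, ⟨?_, hgc, fun ε hε => ?_, fun ε hε => ?_⟩, ?_⟩
  · exact (measurable_uncurry_of_continuous_of_measurable (u := fun t x => g x t) hgc hgm).comp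
      measurable_swap
  · obtain ⟨δ, hδ, h1⟩ := hsmall ε hε
    obtain ⟨n, h2⟩ := hlarge 1 one_pos
    refine ⟨1 + |D n| / δ ^ (p - 1), by positivity, fun x t => ?_⟩
    have ht0 : 0 ≤ |t| ^ (p - 1) := by positivity
    have hd0 : 0 ≤ |D n| / δ ^ (p - 1) * |t| ^ (p - 1) := by positivity
    have he0 : 0 ≤ ε * |t| := by positivity
    rcases lt_or_ge |t| δ with ht | ht
    · have := h1 x t ht; nlinarith
    rcases lt_or_ge (n : ℝ) |t| with htn | htn
    · have := h2 x t htn; nlinarith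
    · have h3 := hmid n x t htn
      have h4 : |D n| ≤ |D n| / δ ^ (p - 1) * |t| ^ (p - 1) := by
        rw [div_mul_eq_mul_div, le_div_iff₀ (by positivity)]
        gcongr
        linarith
      nlinarith
  · obtain ⟨δ, hδ, h1⟩ := hsmall 1 one_pos
    obtain ⟨n, h2⟩ := hlarge ε hε
    refine ⟨1 + |D n| / δ, by positivity, fun x t => ?_⟩
    have ht0 : 0 ≤ ε * |t| ^ (p - 1) := by positivity
    have hd0 : 0 ≤ |D n| / δ * |t| := by positivity
    have he0 : 0 ≤ |t| := abs_nonneg t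
    rcases lt_or_ge |t| δ with ht | ht
    · have := h1 x t ht; nlinarith
    rcases lt_or_ge (n : ℝ) |t| with htn | htn
    · have := h2 x t htn; nlinarith
    · have h3 := hmid n x t htn
      have h4 : |D n| ≤ |D n| / δ * |t| := by
        rw [div_mul_eq_mul_div, le_div_iff₀ hδ]
        gcongr
      nlinarith
  · have : ∀ᵐ x ∂(volume.restrict Ω), x ∉ A := measure_eq_zero_iff_ae_notMem.1 hA0
    filter_upwards [this] with x hx t
    simp only [hg, if_neg hx]

end Nonlinearity

/-! ### The quadratic form and the best constants -/

section QuadraticForm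

variable {N : ℕ} {s μ lam : ℝ} {Ω : Set (EuclideanSpace ℝ (Fin N))}
  {u φ : EuclideanSpace ℝ (Fin N) → ℝ}

theorem hardyConst_pos (hs : 0 < s) (hN : 2 * s < N) : 0 < hardyConst N s := by
  have h1 : 0 < Real.Gamma (((N : ℝ) + 2 * s) / 4) := Real.Gamma_pos_of_pos (by positivity)
  have h2 : 0 < Real.Gamma (((N : ℝ) - 2 * s) / 4) := Real.Gamma_pos_of_pos (by linarith)
  unfold hardyConst
  positivity

theorem gagliardoForm_self_nonneg (hs0 : 0 < s) (hs1 : s < 1) : 0 ≤ gagliardoForm s u u :=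
  mul_nonneg (cNs_pos hs0 hs1).le (integral_nonneg fun z => gagliardoKernel_self_nonneg z)

/-- By Hardy's inequality the form with the subcritical Hardy potential controls the seminorm. -/
theorem MemHs.mul_gagliardoForm_le_hardyEnergy (hs0 : 0 < s) (hs1 : s < 1) (hN : 2 * s < N)
    (hμ0 : 0 ≤ μ) (hu : MemHs s u) (A : Set (EuclideanSpace ℝ (Fin N))) :
    (1 - μ / hardyConst N s) * gagliardoForm s u u ≤ hardyEnergy s μ A u := by
  obtain ⟨hi, hh⟩ := hu.hardy hs0 hs1 hN
  have hH := hardyConst_pos hs0 hN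
  have h1 : ∫ x in A, |u x| ^ 2 / ‖x‖ ^ (2 * s) ≤ ∫ x, |u x| ^ 2 / ‖x‖ ^ (2 * s) :=
    setIntegral_le_integral hi (Eventually.of_forall fun x => by positivity)
  have h2 : ∫ x, |u x| ^ 2 / ‖x‖ ^ (2 * s) ≤ gagliardoForm s u u / hardyConst N s := by
    rw [le_div_iff₀ hH]; linarith
  have h3 := mul_le_mul_of_nonneg_left (h1.trans h2) hμ0
  rw [hardyEnergy]
  have h4 : μ * (gagliardoForm s u u / hardyConst N s) =
      μ / hardyConst N s * gagliardoForm s u u := by ring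
  linarith

theorem MemHs.hardyEnergy_nonneg (hs0 : 0 < s) (hs1 : s < 1) (hN : 2 * s < N)
    (hμ0 : 0 ≤ μ) (hμ1 : μ < hardyConst N s) (hu : MemHs s u)
    (A : Set (EuclideanSpace ℝ (Fin N))) : 0 ≤ hardyEnergy s μ A u := by
  refine le_trans (mul_nonneg ?_ (gagliardoForm_self_nonneg hs0 hs1))
    (hu.mul_gagliardoForm_le_hardyEnergy hs0 hs1 hN hμ0 A)
  rw [sub_nonneg, div_le_one (hardyConst_pos hs0 hN)]
  exact hμ1.le

theorem integral_abs_rpow_pos {p : ℝ} (hp : 0 < p) (hi : Integrable fun x => |u x| ^ p)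
    (hne : ¬ u =ᵐ[volume] 0) : 0 < ∫ x, |u x| ^ p := by
  have h0 : 0 ≤ ∫ x, |u x| ^ p := integral_nonneg fun x => by positivity
  refine lt_of_le_of_ne h0 fun h => hne ?_
  have h1 := (integral_eq_zero_iff_of_nonneg (fun x => by positivity) hi).1 h.symm
  filter_upwards [h1] with x hx
  have h2 : |u x| ^ p = 0 := hx
  rw [Real.rpow_eq_zero (abs_nonneg _) hp.ne', abs_eq_zero] at h2
  exact h2

theorem MemHs.bestS_mul_le (hs0 : 0 < s) (hs1 : s < 1) (hN : 2 * s < N)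
    (hμ0 : 0 ≤ μ) (hμ1 : μ < hardyConst N s) (hu : MemHs s u) :
    bestS N s μ * (∫ x, |u x| ^ critExp N s) ^ (2 / critExp N s) ≤ hardyEnergy s μ univ u := by
  have hp := two_lt_critExp hs0 hN
  by_cases hne : u =ᵐ[volume] 0
  · have h0 : ∫ x, |u x| ^ critExp N s = 0 := by
      rw [integral_congr_ae (g := fun _ => (0 : ℝ)), integral_zero]
      filter_upwards [hne] with x hx
      rw [hx, Pi.zero_apply, abs_zero, Real.zero_rpow (by linarith)]
    rw [h0, Real.zero_rpow (by positivity), mul_zero]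
    exact hu.hardyEnergy_nonneg hs0 hs1 hN hμ0 hμ1 univ
  · have hpos := integral_abs_rpow_pos (by linarith) (hu.sobolev hs0 hN).1 hne
    rw [← le_div_iff₀ (by positivity)]
    refine csInf_le ⟨0, ?_⟩ ⟨u, hu, hne, rfl⟩
    rintro _ ⟨v, hv, -, rfl⟩
    have h0 : 0 ≤ ∫ x, |v x| ^ critExp N s := integral_nonneg fun x => by positivity
    exact div_nonneg (hv.hardyEnergy_nonneg hs0 hs1 hN hμ0 hμ1 univ) (by positivity)

theorem bestS_pos (hs0 : 0 < s) (hs1 : s < 1) (hN : 2 * s < N)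
    (hμ0 : 0 ≤ μ) (hμ1 : μ < hardyConst N s) (hu : MemHs s u) (hne : ¬ u =ᵐ[volume] 0) :
    0 < bestS N s μ := by
  have hp := two_lt_critExp hs0 hN
  have hS := sobolevConst_pos (N := N) (s := s)
  have hc := cNs_pos (N := N) hs0 hs1
  have hθ : 0 < 1 - μ / hardyConst N s := by
    rw [sub_pos, div_lt_one (hardyConst_pos hs0 hN)]; exact hμ1
  have hpos : 0 < (1 - μ / hardyConst N s) * (cNs N s / sobolevConst N s) := by positivity
  refine hpos.trans_le (le_csInf ⟨_, u, hu, hne, rfl⟩ ?_)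
  rintro _ ⟨v, hv, hvne, rfl⟩
  obtain ⟨hi, hsob⟩ := hv.sobolev hs0 hN
  have hvpos := integral_abs_rpow_pos (by linarith) hi hvne
  rw [le_div_iff₀ (by positivity)]
  refine le_trans ?_ (hv.mul_gagliardoForm_le_hardyEnergy hs0 hs1 hN hμ0 univ)
  rw [mul_assoc]
  refine mul_le_mul_of_nonneg_left ?_ hθ.le
  rw [gagliardoForm, div_mul_eq_mul_div, mul_div_assoc]
  refine mul_le_mul_of_nonneg_left ?_ hc.le
  rw [div_le_iff₀ hS]
  linarith

theorem MemX0.setIntegral_eq (hu : MemX0 s Ω u) (hΩ : MeasurableSet Ω)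
    {F : EuclideanSpace ℝ (Fin N) → ℝ} (hF : ∀ x, u x = 0 → F x = 0) :
    ∫ x in Ω, F x = ∫ x, F x := by
  refine setIntegral_eq_integral_of_ae_compl_eq_zero ?_
  filter_upwards [(ae_restrict_iff' hΩ.compl).1 hu.2] with x hx hxΩ
  exact hF x (hx hxΩ)

theorem MemX0.hardyEnergy_eq (hu : MemX0 s Ω u) (hΩ : MeasurableSet Ω) :
    hardyEnergy s μ Ω u = hardyEnergy s μ univ u := by
  rw [hardyEnergy, hardyEnergy, setIntegral_univ, hu.setIntegral_eq hΩ fun x hx => by simp [hx]]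

theorem MemX0.firstEigenvalue_mul_le (hs0 : 0 < s) (hs1 : s < 1) (hN : 2 * s < N)
    (hμ0 : 0 ≤ μ) (hμ1 : μ < hardyConst N s) (hΩ : MeasurableSet Ω) (hu : MemX0 s Ω u) :
    firstEigenvalue s μ Ω * ∫ x in Ω, |u x| ^ 2 ≤ hardyEnergy s μ Ω u := by
  by_cases hne : u =ᵐ[volume] 0
  · have h0 : ∫ x in Ω, |u x| ^ 2 = 0 := by
      rw [hu.setIntegral_eq hΩ fun x hx => by simp [hx],
        integral_congr_ae (g := fun _ => (0 : ℝ)), integral_zero]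
      filter_upwards [hne] with x hx
      rw [hx, Pi.zero_apply, abs_zero, zero_pow two_ne_zero]
    rw [h0, mul_zero]
    exact hu.1.hardyEnergy_nonneg hs0 hs1 hN hμ0 hμ1 Ω
  · have hpos : 0 < ∫ x in Ω, |u x| ^ 2 := by
      rw [hu.setIntegral_eq hΩ fun x hx => by simp [hx]]
      have h := integral_abs_rpow_pos (p := 2) two_pos (by simpa using hu.1.1.integrable_sq) hne
      simpa using h
    rw [← le_div_iff₀ hpos]
    refine csInf_le ⟨0, ?_⟩ ⟨u, hu, hne, rfl⟩
    rintro _ ⟨v, hv, -, rfl⟩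
    exact div_nonneg (hv.1.hardyEnergy_nonneg hs0 hs1 hN hμ0 hμ1 Ω)
      (integral_nonneg fun x => by positivity)

/-- Coercivity of the quadratic part of the functional. -/
theorem exists_coercive (hs0 : 0 < s) (hs1 : s < 1) (hN : 2 * s < N)
    (hμ0 : 0 ≤ μ) (hμ1 : μ < hardyConst N s) (hΩ : MeasurableSet Ω) (hlam0 : 0 < lam)
    (hlam1 : lam < firstEigenvalue s μ Ω) :
    ∃ c, 0 < c ∧ ∀ u : EuclideanSpace ℝ (Fin N) → ℝ, MemX0 s Ω u →
      c * ((∫ x in Ω, |u x| ^ 2) + ∫ z, gagliardoKernel s u u z) ≤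
        hardyEnergy s μ Ω u - lam * ∫ x in Ω, |u x| ^ 2 := by
  set L := firstEigenvalue s μ Ω with hL
  have hL0 : 0 < L := hlam0.trans hlam1
  have hc := cNs_pos (N := N) hs0 hs1
  have hθ : 0 < 1 - μ / hardyConst N s := by
    rw [sub_pos, div_lt_one (hardyConst_pos hs0 hN)]; exact hμ1
  have hη : 0 < 1 - lam / L := by
    rw [sub_pos, div_lt_one hL0]; exact hlam1
  set c := (1 - lam / L) / 2 * min L ((1 - μ / hardyConst N s) * cNs N s) with hcdef
  refine ⟨c, by positivity, fun u hu => ?_⟩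
  have h1 := hu.firstEigenvalue_mul_le hs0 hs1 hN hμ0 hμ1 hΩ
  have h2 := hu.1.mul_gagliardoForm_le_hardyEnergy hs0 hs1 hN hμ0 Ω
  rw [gagliardoForm, ← mul_assoc] at h2
  rw [← hL] at h1
  set ℓ := ∫ x in Ω, |u x| ^ 2
  set k := ∫ z, gagliardoKernel s u u z
  set e := hardyEnergy s μ Ω u
  have hℓ : 0 ≤ ℓ := integral_nonneg fun x => by positivity
  have hk : 0 ≤ k := integral_nonneg fun z => gagliardoKernel_self_nonneg z
  have h3 : lam * ℓ ≤ lam / L * e := by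
    rw [div_mul_eq_mul_div, le_div_iff₀ hL0]
    nlinarith
  have h4 : min L ((1 - μ / hardyConst N s) * cNs N s) * ℓ ≤ e :=
    (mul_le_mul_of_nonneg_right (min_le_left _ _) hℓ).trans h1
  have h5 : min L ((1 - μ / hardyConst N s) * cNs N s) * k ≤ e :=
    (mul_le_mul_of_nonneg_right (min_le_right _ _) hk).trans h2
  calc c * (ℓ + k) = (1 - lam / L) / 2 * (min L ((1 - μ / hardyConst N s) * cNs N s) * ℓ +
        min L ((1 - μ / hardyConst N s) * cNs N s) * k) := by rw [hcdef]; ring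
    _ ≤ (1 - lam / L) / 2 * (e + e) := by gcongr
    _ = e - lam / L * e := by ring
    _ ≤ e - lam * ℓ := by linarith

end QuadraticForm

/-! ### The Hilbert space `X_0` -/

section EnergySpace

variable {N : ℕ} {s : ℝ} {Ω : Set (EuclideanSpace ℝ (Fin N))}
  {u φ : EuclideanSpace ℝ (Fin N) → ℝ}

/-- The weighted difference quotient `(u(x) - u(y)) / |x - y|^{(N+2s)/2}`. -/
noncomputable def diffQuot {N : ℕ} (s : ℝ) (u : EuclideanSpace ℝ (Fin N) → ℝ)
    (q : EuclideanSpace ℝ (Fin N) × EuclideanSpace ℝ (Fin N)) : ℝ :=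
  (u q.1 - u q.2) / ‖q.1 - q.2‖ ^ (((N : ℝ) + 2 * s) / 2)

theorem diffQuot_mul_diffQuot (q : EuclideanSpace ℝ (Fin N) × EuclideanSpace ℝ (Fin N)) :
    diffQuot s u q * diffQuot s φ q = gagliardoKernel s u φ q := by
  rw [diffQuot, diffQuot, gagliardoKernel, div_mul_div_comm]
  congr 1
  rw [← sq, ← Real.rpow_natCast, ← Real.rpow_mul (norm_nonneg _)]
  congr 1
  push_cast
  ring

theorem ae_fst_snd {P : EuclideanSpace ℝ (Fin N) → Prop} (h : ∀ᵐ x, P x) :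
    ∀ᵐ q : EuclideanSpace ℝ (Fin N) × EuclideanSpace ℝ (Fin N), P q.1 ∧ P q.2 := by
  rw [Measure.volume_eq_prod]
  exact (Measure.quasiMeasurePreserving_fst.ae h).and (Measure.quasiMeasurePreserving_snd.ae h)

theorem diffQuot_congr {v : EuclideanSpace ℝ (Fin N) → ℝ} (h : u =ᵐ[volume] v) :
    diffQuot s u =ᵐ[volume] diffQuot s v := by
  filter_upwards [ae_fst_snd h] with q hq
  rw [diffQuot, diffQuot, hq.1, hq.2]

theorem MemHs.memLp_diffQuot (hu : MemHs s u) : MemLp (diffQuot s u) 2 volume := by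
  obtain ⟨v, hv, huv⟩ := hu.1.1.aemeasurable
  have hm : AEStronglyMeasurable (diffQuot s u) volume := by
    refine AEStronglyMeasurable.congr ?_ (diffQuot_congr huv).symm
    unfold diffQuot
    exact Measurable.aestronglyMeasurable (by fun_prop)
  rw [memLp_two_iff_integrable_sq hm]
  exact hu.2.congr (Eventually.of_forall fun q => by
    simp only [sq, diffQuot_mul_diffQuot])

theorem MemHs.integrable_gagliardoKernel (hu : MemHs s u) (hφ : MemHs s φ) :
    Integrable (gagliardoKernel s u φ) volume :=
  (hu.memLp_diffQuot.integrable_mul hφ.memLp_diffQuot).congr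
    (Eventually.of_forall fun q => diffQuot_mul_diffQuot q)

/-- The space `X_0` as a Hilbert space: pairs consisting of a function that vanishes outside `Ω` and
its weighted difference quotient, both in `L²`. Its norm is
`(‖u‖_2² + ∫∫ |u(x) - u(y)|² / |x - y|^{N+2s})^{1/2}`. -/
noncomputable def energySpace {N : ℕ} (s : ℝ) (Ω : Set (EuclideanSpace ℝ (Fin N))) :
    Submodule ℝ (WithLp 2 ((Lp ℝ 2 (volume : Measure (EuclideanSpace ℝ (Fin N)))) ×
      (Lp ℝ 2 (volume : Measure (EuclideanSpace ℝ (Fin N) × EuclideanSpace ℝ (Fin N)))))) where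
  carrier := {z | z.snd =ᵐ[volume] diffQuot s z.fst ∧ ∀ᵐ x ∂(volume.restrict Ωᶜ), z.fst x = 0}
  zero_mem' := by
    have h0 : ((0 : Lp ℝ 2 (volume : Measure (EuclideanSpace ℝ (Fin N)))) : _ → ℝ) =ᵐ[volume] 0 :=
      Lp.coeFn_zero _ _ _
    refine ⟨?_, ?_⟩
    · simp only [WithLp.zero_fst, WithLp.zero_snd]
      filter_upwards [Lp.coeFn_zero ℝ 2 (volume : Measure (EuclideanSpace ℝ (Fin N) ×
        EuclideanSpace ℝ (Fin N))), ae_fst_snd h0] with q h1 h2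
      rw [h1, diffQuot, h2.1, h2.2]
      simp
    · simp only [WithLp.zero_fst]
      filter_upwards [ae_restrict_of_ae h0] with x hx
      rw [hx, Pi.zero_apply]
  add_mem' := by
    rintro z w ⟨hz1, hz2⟩ ⟨hw1, hw2⟩
    have h0 := Lp.coeFn_add z.fst w.fst
    refine ⟨?_, ?_⟩
    · simp only [WithLp.add_fst, WithLp.add_snd]
      filter_upwards [Lp.coeFn_add z.snd w.snd, ae_fst_snd h0, hz1, hw1] with q h1 h2 h3 h4
      rw [h1, Pi.add_apply, h3, h4, diffQuot, diffQuot, diffQuot, h2.1, h2.2]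
      simp only [Pi.add_apply]
      ring
    · simp only [WithLp.add_fst]
      filter_upwards [ae_restrict_of_ae h0, hz2, hw2] with x h1 h2 h3
      rw [h1, Pi.add_apply, h2, h3, add_zero]
  smul_mem' := by
    rintro c z ⟨hz1, hz2⟩
    have h0 := Lp.coeFn_smul c z.fst
    refine ⟨?_, ?_⟩
    · simp only [WithLp.smul_fst, WithLp.smul_snd]
      filter_upwards [Lp.coeFn_smul c z.snd, ae_fst_snd h0, hz1] with q h1 h2 h3
      rw [h1, Pi.smul_apply, h3, diffQuot, diffQuot, h2.1, h2.2]
      simp only [Pi.smul_apply, smul_eq_mul]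
      ring
    · simp only [WithLp.smul_fst]
      filter_upwards [ae_restrict_of_ae h0, hz2] with x h1 h2
      rw [h1, Pi.smul_apply, h2, smul_zero]

theorem isClosed_energySpace : IsClosed (energySpace s Ω : Set (WithLp 2
    ((Lp ℝ 2 (volume : Measure (EuclideanSpace ℝ (Fin N)))) ×
      (Lp ℝ 2 (volume : Measure (EuclideanSpace ℝ (Fin N) × EuclideanSpace ℝ (Fin N))))))) := by
  refine IsSeqClosed.isClosed fun z w hz hlim => ?_
  have h1 : Tendsto (fun n => (z n).fst) atTop (𝓝 w.fst) :=
    ((WithLp.fstL 2 ℝ _ _).continuous.tendsto w).comp hlim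
  have h2 : Tendsto (fun n => (z n).snd) atTop (𝓝 w.snd) :=
    ((WithLp.sndL 2 ℝ _ _).continuous.tendsto w).comp hlim
  obtain ⟨a, ha, hae1⟩ := (tendstoInMeasure_of_tendsto_Lp h1).exists_seq_tendsto_ae
  obtain ⟨b, hb, hae2⟩ :=
    (tendstoInMeasure_of_tendsto_Lp (h2.comp ha.tendsto_atTop)).exists_seq_tendsto_ae
  have hz1 : ∀ᵐ q, ∀ n, (z n).snd q = diffQuot s (z n).fst q := ae_all_iff.2 fun n => (hz n).1
  have hz2 : ∀ᵐ x ∂(volume.restrict Ωᶜ), ∀ n, (z n).fst x = 0 := ae_all_iff.2 fun n => (hz n).2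
  refine ⟨?_, ?_⟩
  · filter_upwards [hae2, hz1, ae_fst_snd hae1] with q h3 h4 h5
    have h6 : Tendsto (fun n => diffQuot s (z (a (b n))).fst q) atTop (𝓝 (diffQuot s w.fst q)) := by
      unfold diffQuot
      exact ((h5.1.comp hb.tendsto_atTop).sub (h5.2.comp hb.tendsto_atTop)).div_const _
    refine tendsto_nhds_unique h3 (h6.congr fun n => ?_)
    exact (h4 (a (b n))).symm
  · filter_upwards [ae_restrict_of_ae hae1, hz2] with x h3 h4
    refine tendsto_nhds_unique h3 (tendsto_const_nhds.congr fun n => ?_)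
    exact (h4 (a n)).symm

instance : CompleteSpace (energySpace s Ω) := isClosed_energySpace.completeSpace_coe

namespace energySpace

/-- The function underlying an element of the energy space. -/
noncomputable def fn (z : energySpace s Ω) : EuclideanSpace ℝ (Fin N) → ℝ := z.1.fst

theorem fn_add (z w : energySpace s Ω) : fn (z + w) =ᵐ[volume] fun x => fn z x + fn w x :=
  Lp.coeFn_add z.1.fst w.1.fst

theorem fn_smul (c : ℝ) (z : energySpace s Ω) : fn (c • z) =ᵐ[volume] fun x => c * fn z x :=
  Lp.coeFn_smul c z.1.fst

theorem memX0 (z : energySpace s Ω) : MemX0 s Ω (fn z) := by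
  refine ⟨⟨Lp.memLp z.1.fst, ?_⟩, z.2.2⟩
  refine (Lp.memLp z.1.snd).integrable_sq.congr ?_
  filter_upwards [z.2.1] with q hq
  rw [hq, sq, diffQuot_mul_diffQuot]
  rfl

theorem exists_fn_eq (hu : MemX0 s Ω u) : ∃ z : energySpace s Ω, fn z =ᵐ[volume] u := by
  have h1 := hu.1.1.coeFn_toLp
  refine ⟨⟨WithLp.toLp 2 (hu.1.1.toLp u, hu.1.memLp_diffQuot.toLp _), ?_, ?_⟩, h1⟩
  · exact hu.1.memLp_diffQuot.coeFn_toLp.trans (diffQuot_congr h1).symm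
  · filter_upwards [ae_restrict_of_ae h1, hu.2] with x h2 h3
    exact h2.trans h3

theorem inner_fst (z w : energySpace s Ω) :
    inner ℝ z.1.fst w.1.fst = ∫ x, fn z x * fn w x := by
  rw [L2.inner_def]
  refine integral_congr_ae (Eventually.of_forall fun x => ?_)
  simp only [RCLike.inner_apply, conj_trivial, fn]
  ring

theorem inner_snd (z w : energySpace s Ω) :
    inner ℝ z.1.snd w.1.snd = ∫ q, gagliardoKernel s (fn z) (fn w) q := by
  rw [L2.inner_def]
  refine integral_congr_ae ?_
  filter_upwards [z.2.1, w.2.1] with q h1 h2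
  simp only [RCLike.inner_apply, conj_trivial, h1, h2]
  rw [mul_comm, diffQuot_mul_diffQuot]
  rfl

theorem inner_eq (z w : energySpace s Ω) :
    inner ℝ z w = (∫ x, fn z x * fn w x) + ∫ q, gagliardoKernel s (fn z) (fn w) q := by
  rw [← inner_fst, ← inner_snd, Submodule.coe_inner, WithLp.prod_inner_apply]
  rfl

end energySpace

/-- A Hilbert space `H` realizes `X_0` through `fn` when its elements represent, almost everywhere,
exactly the functions of `X_0`, with the inner product
`∫ u v + ∫∫ (u(x) - u(y)) (v(x) - v(y)) / |x - y|^{N+2s}`. -/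
structure IsEnergySpace {N : ℕ} (s : ℝ) (Ω : Set (EuclideanSpace ℝ (Fin N))) {H : Type*}
    [NormedAddCommGroup H] [InnerProductSpace ℝ H] (fn : H → EuclideanSpace ℝ (Fin N) → ℝ) :
    Prop where
  fn_add : ∀ z w, fn (z + w) =ᵐ[volume] fun x => fn z x + fn w x
  fn_smul : ∀ (c : ℝ) z, fn (c • z) =ᵐ[volume] fun x => c * fn z x
  memX0 : ∀ z, MemX0 s Ω (fn z)
  exists_fn_eq : ∀ u, MemX0 s Ω u → ∃ z, fn z =ᵐ[volume] u
  inner_eq : ∀ z w, inner ℝ z w =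
    (∫ x, fn z x * fn w x) + ∫ q, gagliardoKernel s (fn z) (fn w) q

theorem isEnergySpace_fn : IsEnergySpace s Ω (energySpace.fn : energySpace s Ω → _) where
  fn_add := energySpace.fn_add
  fn_smul := energySpace.fn_smul
  memX0 := energySpace.memX0
  exists_fn_eq _ := energySpace.exists_fn_eq
  inner_eq := energySpace.inner_eq

instance : SecondCountableTopology (energySpace s Ω) := by
  have : Fact ((2 : ENNReal) ≠ ⊤) := ⟨by simp⟩
  have : SecondCountableTopology (Lp ℝ 2 (volume : Measure (EuclideanSpace ℝ (Fin N)))) :=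
    Lp.SecondCountableTopology
  have : SecondCountableTopology (Lp ℝ 2 (volume : Measure (EuclideanSpace ℝ (Fin N) ×
      EuclideanSpace ℝ (Fin N)))) := by
    have := isSeparable_of_sigmaFinite (volume : Measure (EuclideanSpace ℝ (Fin N) ×
      EuclideanSpace ℝ (Fin N)))
    exact Lp.SecondCountableTopology
  exact TopologicalSpace.Subtype.secondCountableTopology _

end EnergySpace

/-! ### The gradient of the functional -/

section Holder

variable {α : Type*} [MeasurableSpace α] {m : Measure α} {p : ℝ}

theorem memLp_ofReal_iff_integrable {a : α → ℝ} (ha : AEStronglyMeasurable a m) (hp : 0 < p) :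
    MemLp a (ENNReal.ofReal p) m ↔ Integrable (fun x => |a x| ^ p) m := by
  have h := integrable_norm_rpow_iff ha (p := ENNReal.ofReal p) (by simpa using hp)
    ENNReal.ofReal_ne_top
  rw [ENNReal.toReal_ofReal hp.le] at h
  exact h.symm

theorem abs_integral_mul_le_rpow_mul_rpow (hp : 1 < p) {a φ : α → ℝ}
    (ha : MemLp a (ENNReal.ofReal (p / (p - 1))) m) (hφ : MemLp φ (ENNReal.ofReal p) m) :
    |∫ x, a x * φ x ∂m| ≤ (∫ x, |a x| ^ (p / (p - 1)) ∂m) ^ (1 / (p / (p - 1))) *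
      (∫ x, |φ x| ^ p ∂m) ^ (1 / p) := by
  have hpq : (p / (p - 1)).HolderConjugate p :=
    (Real.HolderConjugate.conjExponent hp).symm
  refine (norm_integral_le_integral_norm (fun x => a x * φ x)).trans ?_
  simp only [norm_mul]
  exact integral_mul_norm_le_Lp_mul_Lq hpq ha hφ

theorem IsGrowthBounded.memLp_comp [IsFiniteMeasure m] (hp : 1 < p) {k : α → ℝ → ℝ}
    (hk : IsGrowthBounded p k) {u : α → ℝ} (hu : AEStronglyMeasurable u m)
    (hup : Integrable (fun x => |u x| ^ p) m) :
    MemLp (fun x => k x (u x)) (ENNReal.ofReal (p / (p - 1))) m := by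
  obtain ⟨C, hC0, hC⟩ := hk.growth
  have hp1 : 0 < p - 1 := by linarith
  set q := p / (p - 1) with hq
  have hq0 : 0 < q := by positivity
  have hqp : (p - 1) * q = p := by rw [hq]; field_simp
  have hm := hk.aestronglyMeasurable_comp hu
  rw [memLp_ofReal_iff_integrable hm hq0]
  refine (((integrable_const (1 : ℝ)).add hup).const_mul (C ^ q * 2 ^ q)).mono'
    (aestronglyMeasurable_abs_rpow hm q) (Eventually.of_forall fun x => ?_)
  rw [Real.norm_of_nonneg (by positivity)]
  simp only [Pi.add_apply]
  calc |k x (u x)| ^ q ≤ (C * (1 + |u x| ^ (p - 1))) ^ q :=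
        Real.rpow_le_rpow (abs_nonneg _) (hC _ _) hq0.le
    _ = C ^ q * (1 + |u x| ^ (p - 1)) ^ q := Real.mul_rpow hC0 (by positivity)
    _ ≤ C ^ q * (2 ^ q * (1 ^ q + (|u x| ^ (p - 1)) ^ q)) := by
        gcongr
        exact add_rpow_le_two_rpow_mul zero_le_one (by positivity) hq0.le
    _ = C ^ q * 2 ^ q * (1 + |u x| ^ p) := by
        rw [Real.one_rpow, ← Real.rpow_mul (abs_nonneg _), hqp]; ring

end Holder

/-- A linear map into `L²`, bounded by the norm, represented by functions defined almost
everywhere. -/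
theorem exists_clm_coeFn_eq {α H : Type*} [MeasurableSpace α] {m : Measure α}
    [NormedAddCommGroup H] [InnerProductSpace ℝ H] {L : H → α → ℝ} (hm : ∀ z, MemLp (L z) 2 m)
    (hadd : ∀ z w, L (z + w) =ᵐ[m] L z + L w) (hsmul : ∀ (c : ℝ) z, L (c • z) =ᵐ[m] c • L z)
    {C : ℝ} (hC : 0 ≤ C) (hL : ∀ z, ∫ x, L z x * L z x ∂m ≤ C * ‖z‖ ^ 2) :
    ∃ T : H →L[ℝ] Lp ℝ 2 m, (∀ z, T z =ᵐ[m] L z) ∧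
      ∀ z w, inner ℝ (T z) (T w) = ∫ x, L z x * L w x ∂m := by
  let T₀ : H →ₗ[ℝ] Lp ℝ 2 m :=
    { toFun := fun z => (hm z).toLp _
      map_add' := fun z w => ((MemLp.toLp_eq_toLp_iff _ _).2 (hadd z w)).trans
        (MemLp.toLp_add (hm z) (hm w))
      map_smul' := fun c z => ((MemLp.toLp_eq_toLp_iff _ _).2 (hsmul c z)).trans
        (MemLp.toLp_const_smul c (hm z)) }
  have hc : ∀ z, T₀ z =ᵐ[m] L z := fun z => (hm z).coeFn_toLp
  have hT : ∀ z w, inner ℝ (T₀ z) (T₀ w) = ∫ x, L z x * L w x ∂m := fun z w => by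
    rw [L2.inner_def]
    refine integral_congr_ae ?_
    filter_upwards [hc z, hc w] with x h1 h2
    simp only [RCLike.inner_apply, conj_trivial, h1, h2]
    ring
  refine ⟨T₀.mkContinuous (Real.sqrt C) fun z => ?_, hc, hT⟩
  refine abs_le_of_sq_le_sq' ?_ (by positivity) |>.2
  rw [mul_pow, Real.sq_sqrt hC, ← real_inner_self_eq_norm_sq, hT]
  exact hL z

namespace IsEnergySpace

variable {N : ℕ} {s μ lam : ℝ} {Ω : Set (EuclideanSpace ℝ (Fin N))} {H : Type*}
  [NormedAddCommGroup H] [InnerProductSpace ℝ H] {fn : H → EuclideanSpace ℝ (Fin N) → ℝ}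

theorem fn_zero (hE : IsEnergySpace s Ω fn) : fn 0 =ᵐ[volume] 0 := by
  have h := hE.fn_smul 0 0
  rw [zero_smul] at h
  filter_upwards [h] with x hx
  rw [hx, zero_mul, Pi.zero_apply]

theorem fn_sub (hE : IsEnergySpace s Ω fn) (z w : H) :
    fn (z - w) =ᵐ[volume] fun x => fn z x - fn w x := by
  have h1 := hE.fn_add z ((-1 : ℝ) • w)
  rw [neg_one_smul, ← sub_eq_add_neg] at h1
  have h2 := hE.fn_smul (-1) w
  rw [neg_one_smul] at h2
  filter_upwards [h1, h2] with x h3 h4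
  rw [h3, h4]
  ring

theorem norm_sq_eq (hE : IsEnergySpace s Ω fn) (z : H) :
    ‖z‖ ^ 2 = (∫ x, fn z x ^ 2) + ∫ q, gagliardoKernel s (fn z) (fn z) q := by
  rw [← real_inner_self_eq_norm_sq, hE.inner_eq]
  simp only [sq]

theorem integral_sq_le (hE : IsEnergySpace s Ω fn) (z : H) : ∫ x, fn z x ^ 2 ≤ ‖z‖ ^ 2 := by
  rw [hE.norm_sq_eq]
  have : 0 ≤ ∫ q, gagliardoKernel s (fn z) (fn z) q :=
    integral_nonneg fun q => gagliardoKernel_self_nonneg q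
  linarith

theorem integral_gagliardoKernel_le (hE : IsEnergySpace s Ω fn) (z : H) :
    ∫ q, gagliardoKernel s (fn z) (fn z) q ≤ ‖z‖ ^ 2 := by
  rw [hE.norm_sq_eq]
  have : 0 ≤ ∫ x, fn z x ^ 2 := integral_nonneg fun x => sq_nonneg _
  linarith

theorem fn_ae_eq_zero_iff (hE : IsEnergySpace s Ω fn) (z : H) : fn z =ᵐ[volume] 0 ↔ z = 0 := by
  refine ⟨fun h => ?_, fun h => h ▸ hE.fn_zero⟩
  have h1 : ‖z‖ ^ 2 = 0 := by
    rw [hE.norm_sq_eq, integral_congr_ae (g := fun _ => (0 : ℝ)) (by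
      filter_upwards [h] with x hx; rw [hx, Pi.zero_apply, zero_pow two_ne_zero]),
      integral_congr_ae (gagliardoKernel_congr h h)]
    simp [gagliardoKernel]
  exact norm_eq_zero.1 (pow_eq_zero_iff two_ne_zero |>.1 h1)

/-- The Sobolev embedding of the energy space. -/
theorem sobolev (hE : IsEnergySpace s Ω fn) (hs : 0 < s) (hN : 2 * s < N) (z : H) :
    (Integrable fun x => |fn z x| ^ critExp N s) ∧
      ∫ x, |fn z x| ^ critExp N s ≤ (Real.sqrt (sobolevConst N s) * ‖z‖) ^ critExp N s := by
  obtain ⟨h1, h2⟩ := (hE.memX0 z).1.sobolev hs hN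
  refine ⟨h1, ?_⟩
  have hp := two_lt_critExp hs hN
  set p := critExp N s with hpdef
  have hp0 : 0 < p := by linarith
  have h0 : 0 ≤ ∫ x, |fn z x| ^ p := integral_nonneg fun x => by positivity
  have hS := sobolevConst_pos (N := N) (s := s)
  have h3 : (∫ x, |fn z x| ^ p) = ((∫ x, |fn z x| ^ p) ^ (2 / p)) ^ (p / 2) := by
    rw [← Real.rpow_mul h0, div_mul_div_cancel₀ hp0.ne', div_self two_ne_zero, Real.rpow_one]
  have h4 : (Real.sqrt (sobolevConst N s) * ‖z‖) ^ p = (sobolevConst N s * ‖z‖ ^ 2) ^ (p / 2) := by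
    have : sobolevConst N s * ‖z‖ ^ 2 = (Real.sqrt (sobolevConst N s) * ‖z‖) ^ (2 : ℝ) := by
      rw [Real.rpow_two, mul_pow, Real.sq_sqrt hS.le]
    rw [this, ← Real.rpow_mul (by positivity), mul_div_cancel₀ _ two_ne_zero]
  rw [h3, h4]
  refine Real.rpow_le_rpow (by positivity) (h2.trans ?_) (by positivity)
  gcongr
  exact hE.integral_gagliardoKernel_le z

theorem aestronglyMeasurable_fn (hE : IsEnergySpace s Ω fn) (z : H) :
    AEStronglyMeasurable (fn z) volume :=
  (hE.memX0 z).1.1.1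

theorem integrable_fn_mul (hE : IsEnergySpace s Ω fn) (z w : H) :
    Integrable fun x => fn z x * fn w x :=
  (hE.memX0 z).1.1.integrable_mul (hE.memX0 w).1.1

theorem memLp_fn_div_rpow (hE : IsEnergySpace s Ω fn) (hs0 : 0 < s) (hs1 : s < 1)
    (hN : 2 * s < N) (z : H) :
    MemLp (fun x => fn z x / ‖x‖ ^ s) 2 volume := by
  have hm : AEStronglyMeasurable (fun x => fn z x / ‖x‖ ^ s) volume := by
    have := (hE.aestronglyMeasurable_fn z).aemeasurable
    exact AEMeasurable.aestronglyMeasurable (by fun_prop)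
  rw [memLp_two_iff_integrable_sq hm]
  refine ((hE.memX0 z).1.hardy hs0 hs1 hN).1.congr (Eventually.of_forall fun x => ?_)
  simp only [div_pow, sq_abs]
  rw [← Real.rpow_natCast (_ ^ s), ← Real.rpow_mul (norm_nonneg _), mul_comm 2 s, Nat.cast_ofNat]

theorem div_rpow_mul_div_rpow (a b : ℝ) (x : EuclideanSpace ℝ (Fin N)) :
    a / ‖x‖ ^ s * (b / ‖x‖ ^ s) = a * b / ‖x‖ ^ (2 * s) := by
  rw [div_mul_div_comm, ← sq, ← Real.rpow_natCast (_ ^ s), ← Real.rpow_mul (norm_nonneg _),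
    mul_comm 2 s, Nat.cast_ofNat]

theorem integrable_fn_mul_div (hE : IsEnergySpace s Ω fn) (hs0 : 0 < s) (hs1 : s < 1)
    (hN : 2 * s < N)
    (z w : H) : Integrable fun x => fn z x * fn w x / ‖x‖ ^ (2 * s) :=
  ((hE.memLp_fn_div_rpow hs0 hs1 hN z).integrable_mul (hE.memLp_fn_div_rpow hs0 hs1 hN w)).congr
    (Eventually.of_forall fun x => div_rpow_mul_div_rpow _ _ x)

/-- The embedding of `X_0` into `L²`. -/
theorem exists_toL2 (hE : IsEnergySpace s Ω fn) :
    ∃ P : H →L[ℝ] Lp ℝ 2 (volume : Measure (EuclideanSpace ℝ (Fin N))),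
    (∀ z, P z =ᵐ[volume] fn z) ∧ ∀ z w, inner ℝ (P z) (P w) = ∫ x, fn z x * fn w x :=
  exists_clm_coeFn_eq (fun z => (hE.memX0 z).1.1) (fun z w => hE.fn_add z w)
    (fun c z => hE.fn_smul c z)
    (C := 1) zero_le_one (fun z => by
      simp only [← sq, one_mul]
      exact hE.integral_sq_le z)

/-- The quadratic part of the functional is given by a bounded operator. -/
theorem exists_energyOperator (hE : IsEnergySpace s Ω fn) (hs0 : 0 < s) (hs1 : s < 1)
    (hN : 2 * s < N) [CompleteSpace H] (μ lam : ℝ) : ∃ A : H →L[ℝ] H, ∀ z w, inner ℝ (A z) w =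
      gagliardoForm s (fn z) (fn w) - μ * (∫ x, fn z x * fn w x / ‖x‖ ^ (2 * s)) -
        lam * ∫ x, fn z x * fn w x := by
  have hH := hardyConst_pos (N := N) hs0 hN
  have hc := cNs_pos (N := N) hs0 hs1
  obtain ⟨T, -, hT⟩ := exists_clm_coeFn_eq (L := fun z x => fn z x / ‖x‖ ^ s)
    (hE.memLp_fn_div_rpow hs0 hs1 hN)
    (fun z w => by
      filter_upwards [hE.fn_add z w] with x hx
      simp only [hx, Pi.add_apply, add_div])
    (fun c z => by
      filter_upwards [hE.fn_smul c z] with x hx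
      simp only [hx, Pi.smul_apply, smul_eq_mul, mul_div_assoc])
    (C := cNs N s / hardyConst N s) (by positivity) (fun z => by
      simp only [div_rpow_mul_div_rpow]
      rw [div_mul_eq_mul_div, le_div_iff₀ hH]
      have h1 := ((hE.memX0 z).1.hardy hs0 hs1 hN).2
      rw [gagliardoForm] at h1
      have h2 := mul_le_mul_of_nonneg_left (hE.integral_gagliardoKernel_le z) hc.le
      simp only [sq_abs] at h1
      simp only [← sq]
      linarith)
  obtain ⟨Q, -, hQ⟩ := exists_clm_coeFn_eq (L := fun z => diffQuot s (fn z))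
    (fun z => (hE.memX0 z).1.memLp_diffQuot)
    (fun z w => by
      filter_upwards [ae_fst_snd (hE.fn_add z w)] with q hq
      simp only [Pi.add_apply, diffQuot, hq.1, hq.2]
      ring)
    (fun c z => by
      filter_upwards [ae_fst_snd (hE.fn_smul c z)] with q hq
      simp only [Pi.smul_apply, smul_eq_mul, diffQuot, hq.1, hq.2]
      ring)
    (C := 1) zero_le_one (fun z => by
      simp only [diffQuot_mul_diffQuot, one_mul]
      exact hE.integral_gagliardoKernel_le z)
  obtain ⟨P, -, hP⟩ := hE.exists_toL2
  simp only [div_rpow_mul_div_rpow] at hT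
  simp only [diffQuot_mul_diffQuot] at hQ
  refine ⟨cNs N s • (ContinuousLinearMap.adjoint Q).comp Q -
    μ • (ContinuousLinearMap.adjoint T).comp T - lam • (ContinuousLinearMap.adjoint P).comp P,
    fun z w => ?_⟩
  simp only [sub_apply, smul_apply, ContinuousLinearMap.comp_apply, inner_sub_left,
    real_inner_smul_left, ContinuousLinearMap.adjoint_inner_left, hP, hQ, hT, gagliardoForm]

section Superposition

variable {k : EuclideanSpace ℝ (Fin N) → ℝ → ℝ}

theorem memLp_fn (hE : IsEnergySpace s Ω fn) (hs : 0 < s) (hN : 2 * s < N) (z : H) :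
    MemLp (fn z) (ENNReal.ofReal (critExp N s)) (volume.restrict Ω) := by
  have hp := two_lt_critExp hs hN
  rw [memLp_ofReal_iff_integrable (hE.aestronglyMeasurable_fn z).restrict (by linarith)]
  exact (hE.sobolev hs hN z).1.restrict

theorem setIntegral_rpow_le (hE : IsEnergySpace s Ω fn) (hs : 0 < s) (hN : 2 * s < N) (z : H) :
    ∫ x in Ω, |fn z x| ^ critExp N s ≤ (Real.sqrt (sobolevConst N s) * ‖z‖) ^ critExp N s :=
  (setIntegral_le_integral (hE.sobolev hs hN z).1
    (Eventually.of_forall fun x => by positivity)).trans (hE.sobolev hs hN z).2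

theorem abs_setIntegral_mul_fn_le (hE : IsEnergySpace s Ω fn) (hs : 0 < s) (hN : 2 * s < N)
    {a : EuclideanSpace ℝ (Fin N) → ℝ}
    (ha : MemLp a (ENNReal.ofReal (critExp N s / (critExp N s - 1))) (volume.restrict Ω))
    (z : H) :
    |∫ x in Ω, a x * fn z x| ≤ (∫ x in Ω, |a x| ^ (critExp N s / (critExp N s - 1))) ^
      (1 / (critExp N s / (critExp N s - 1))) * Real.sqrt (sobolevConst N s) * ‖z‖ := by
  have hp := two_lt_critExp hs hN
  refine (abs_integral_mul_le_rpow_mul_rpow (by linarith) ha (hE.memLp_fn hs hN z)).trans ?_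
  rw [mul_assoc]
  refine mul_le_mul_of_nonneg_left ?_
    (Real.rpow_nonneg (integral_nonneg fun x => by positivity) _)
  calc (∫ x in Ω, |fn z x| ^ critExp N s) ^ (1 / critExp N s)
      ≤ ((Real.sqrt (sobolevConst N s) * ‖z‖) ^ critExp N s) ^ (1 / critExp N s) :=
        Real.rpow_le_rpow (integral_nonneg fun x => by positivity) (hE.setIntegral_rpow_le hs hN z)
          (by positivity)
    _ = Real.sqrt (sobolevConst N s) * ‖z‖ := by
        rw [← Real.rpow_mul (by positivity), mul_one_div_cancel (by linarith), Real.rpow_one]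

theorem exists_subseq_tendsto_ae (hE : IsEnergySpace s Ω fn) {z : ℕ → H} {w : H}
    (h : Tendsto z atTop (𝓝 w)) : ∃ a : ℕ → ℕ, StrictMono a ∧
      ∀ᵐ x, Tendsto (fun n => fn (z (a n)) x) atTop (𝓝 (fn w x)) := by
  obtain ⟨P, hP, -⟩ := hE.exists_toL2
  obtain ⟨a, ha, hae⟩ :=
    (tendstoInMeasure_of_tendsto_Lp ((P.continuous.tendsto w).comp h)).exists_seq_tendsto_ae
  refine ⟨a, ha, ?_⟩
  filter_upwards [hae, hP w, ae_all_iff.2 fun n => hP (z (a n))] with x h1 h2 h3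
  rw [← h2]
  exact h1.congr fun n => h3 n

/-- The superposition operator of a growth-bounded nonlinearity, as a continuous gradient field. -/
theorem exists_superposition (hE : IsEnergySpace s Ω fn) (hs : 0 < s) (hN : 2 * s < N)
    [CompleteSpace H] [IsFiniteMeasure (volume.restrict Ω)] (hk : IsGrowthBounded (critExp N s) k) :
    ∃ Ψ : H → H, Continuous Ψ ∧
      ∀ z w, inner ℝ (Ψ z) w = ∫ x in Ω, k x (fn z x) * fn w x := by
  have hp := two_lt_critExp hs hN
  have hp1 : 1 < critExp N s := by linarith
  set p := critExp N s with hpdef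
  have hm := fun z : H =>
    hk.memLp_comp (m := volume.restrict Ω) hp1 (hE.aestronglyMeasurable_fn z).restrict
      (hE.sobolev hs hN z).1.restrict
  have hint : ∀ z w : H, Integrable (fun x => k x (fn z x) * fn w x)
      (volume.restrict Ω) := fun z w =>
    hk.integrable_mul hp1 (hE.aestronglyMeasurable_fn z).restrict
      (hE.aestronglyMeasurable_fn w).restrict
      (hE.sobolev hs hN z).1.restrict (hE.sobolev hs hN w).1.restrict
  let ℓ : H → H →L[ℝ] ℝ := fun z => LinearMap.mkContinuous
    { toFun := fun w => ∫ x in Ω, k x (fn z x) * fn w x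
      map_add' := fun v w => by
        rw [← integral_add (hint z v) (hint z w)]
        refine integral_congr_ae (ae_restrict_of_ae ?_)
        filter_upwards [hE.fn_add v w] with x hx
        rw [hx, mul_add]
      map_smul' := fun c w => by
        rw [RingHom.id_apply, smul_eq_mul, ← integral_const_mul]
        refine integral_congr_ae (ae_restrict_of_ae ?_)
        filter_upwards [hE.fn_smul c w] with x hx
        rw [hx]
        ring } _ (fun w => hE.abs_setIntegral_mul_fn_le hs hN (hm z) w)
  let Ψ : H → H := fun z =>
    (InnerProductSpace.toDual ℝ H).symm (ℓ z)
  have hΨ : ∀ z w, inner ℝ (Ψ z) w = ∫ x in Ω, k x (fn z x) * fn w x := fun z w =>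
    InnerProductSpace.toDual_symm_apply
  -- test the difference of the gradients with itself
  have hle : ∀ z v, ‖Ψ z - Ψ v‖ ≤ (∫ x in Ω, |k x (fn z x) - k x (fn v x)| ^ (p / (p - 1))) ^
      (1 / (p / (p - 1))) * Real.sqrt (sobolevConst N s) := fun z v => by
    have h1 := hE.abs_setIntegral_mul_fn_le hs hN ((hm z).sub (hm v)) (Ψ z - Ψ v)
    have h2 : ∫ x in Ω, ((fun x => k x (fn z x)) - fun x => k x (fn v x)) x * fn (Ψ z - Ψ v) x =
        ‖Ψ z - Ψ v‖ * ‖Ψ z - Ψ v‖ := by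
      rw [← real_inner_self_eq_norm_mul_norm, inner_sub_left, hΨ, hΨ,
        ← integral_sub (hint _ _) (hint _ _)]
      refine integral_congr_ae (Eventually.of_forall fun x => ?_)
      simp only [Pi.sub_apply]
      ring
    rw [h2, abs_of_nonneg (by positivity)] at h1
    rcases (norm_nonneg (Ψ z - Ψ v)).eq_or_lt with h0 | h0
    · rw [← h0]
      have : 0 ≤ ∫ x in Ω, |k x (fn z x) - k x (fn v x)| ^ (p / (p - 1)) :=
        integral_nonneg fun x => by positivity
      positivity
    · exact le_of_mul_le_mul_right h1 h0
  refine ⟨Ψ, ?_, hΨ⟩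
  rw [continuous_iff_seqContinuous]
  intro z w hz
  refine tendsto_of_subseq_tendsto fun ns hns => ?_
  obtain ⟨a, ha, hae⟩ := hE.exists_subseq_tendsto_ae (hz.comp hns)
  refine ⟨a, ?_⟩
  have hz' : Tendsto (fun n => z (ns (a n))) atTop (𝓝 w) := (hz.comp hns).comp ha.tendsto_atTop
  have hsub : ∀ n, (fun x => |fn (z (ns (a n))) x - fn w x| ^ p) =ᵐ[volume.restrict Ω]
      fun x => |fn (z (ns (a n)) - w) x| ^ p := fun n => by
    refine ae_restrict_of_ae ?_
    filter_upwards [hE.fn_sub (z (ns (a n))) w] with x hx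
    rw [hx]
  have hlim := hk.tendsto_integral_sub_rpow (m := volume.restrict Ω) hp
    (fun n => (hE.aestronglyMeasurable_fn (z (ns (a n)))).restrict)
    (hE.aestronglyMeasurable_fn w).restrict (hE.sobolev hs hN w).1.restrict
    (fun n => (hE.sobolev hs hN (z (ns (a n)) - w)).1.restrict.congr (hsub n).symm) ?_
    (ae_restrict_of_ae hae)
  · rw [tendsto_iff_norm_sub_tendsto_zero]
    refine squeeze_zero (fun n => norm_nonneg _) (fun n => hle _ _) ?_
    have h1 := (hlim.rpow_const (p := 1 / (p / (p - 1))) (Or.inr (by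
      have : 0 < p - 1 := by linarith
      positivity))).mul_const (Real.sqrt (sobolevConst N s))
    rwa [Real.zero_rpow (by
      have : 0 < p - 1 := by linarith
      positivity), zero_mul] at h1
  · have h1 : Tendsto (fun n => (Real.sqrt (sobolevConst N s) * ‖z (ns (a n)) - w‖) ^ p) atTop
        (𝓝 0) := by
      have h2 := ((tendsto_iff_norm_sub_tendsto_zero.1 hz').const_mul
        (Real.sqrt (sobolevConst N s))).rpow_const (p := p) (Or.inr (by linarith))
      rwa [mul_zero, Real.zero_rpow (by linarith)] at h2
    refine squeeze_zero (fun n => integral_nonneg fun x => by positivity) (fun n => ?_) h1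
    rw [integral_congr_ae (hsub n)]
    exact hE.setIntegral_rpow_le hs hN _

theorem hasDerivAt_superposition (hE : IsEnergySpace s Ω fn) (hs : 0 < s) (hN : 2 * s < N)
    [IsFiniteMeasure (volume.restrict Ω)] (hk : IsGrowthBounded (critExp N s) k)
    (z w : H) :
    HasDerivAt (fun h : ℝ => ∫ x in Ω, ∫ τ in (0 : ℝ)..(fn (z + h • w) x), k x τ)
      (∫ x in Ω, k x (fn z x) * fn w x) 0 := by
  have hp := two_lt_critExp hs hN
  have h := hk.hasDerivAt_integral_primitive (m := volume.restrict Ω) (by linarith)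
    (hE.aestronglyMeasurable_fn z).restrict (hE.aestronglyMeasurable_fn w).restrict
    (hE.sobolev hs hN z).1.restrict (hE.sobolev hs hN w).1.restrict
  refine h.congr_of_eventuallyEq (Eventually.of_forall fun t => ?_)
  refine integral_congr_ae (ae_restrict_of_ae ?_)
  filter_upwards [hE.fn_add z (t • w), hE.fn_smul t w] with x h1 h2
  rw [h1, h2]

end Superposition

end IsEnergySpace

/-! ### Real-variable estimates for the mountain pass -/

section RealEstimates

variable {p : ℝ}

theorem exists_sq_le_add_rpow (hp : 2 < p) {η : ℝ} (hη : 0 < η) :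
    ∃ C, 0 ≤ C ∧ ∀ t : ℝ, t ^ 2 ≤ C + η * |t| ^ p := by
  have hp2 : 0 < p - 2 := by linarith
  -- beyond this radius `η |t|^{p-2} ≥ 1`
  set R : ℝ := η⁻¹ ^ (p - 2)⁻¹ with hR
  have hR0 : 0 < R := by positivity
  refine ⟨R ^ 2, by positivity, fun t => ?_⟩
  rcases le_total |t| R with h | h
  · have h1 : t ^ 2 ≤ R ^ 2 := by rw [← sq_abs]; gcongr
    have h2 : 0 ≤ η * |t| ^ p := by positivity
    linarith
  · have ht : 0 < |t| := hR0.trans_le h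
    have h1 : η⁻¹ ≤ |t| ^ (p - 2) := by
      calc η⁻¹ = R ^ (p - 2) := by
            rw [hR, ← Real.rpow_mul (by positivity), inv_mul_cancel₀ hp2.ne', Real.rpow_one]
        _ ≤ _ := by gcongr
    have h2 : |t| ^ p = |t| ^ (p - 2) * t ^ 2 := by
      rw [← sq_abs, ← Real.rpow_two, ← Real.rpow_add ht]
      ring_nf
    have h3 : 1 ≤ η * |t| ^ (p - 2) := by
      have := mul_le_mul_of_nonneg_left h1 hη.le
      rwa [mul_inv_cancel₀ hη.ne'] at this
    rw [h2, ← mul_assoc]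
    nlinarith [sq_nonneg t, sq_nonneg R]

/-- A quadratic lower bound dominates a superquadratic perturbation on small spheres. -/
theorem exists_lt_forall_pos_le_sub_rpow (hp : 2 < p) {c R : ℝ} (hc : 0 < c) (C : ℝ)
    (hR : 0 < R) : ∃ ρ, 0 < ρ ∧ ρ < R ∧ 0 < c * ρ ^ 2 - C * ρ ^ p := by
  have h1 : Tendsto (fun ρ : ℝ => C * ρ ^ (p - 2)) (𝓝[>] 0) (𝓝 0) := by
    have h2 : Tendsto (fun ρ : ℝ => C * ρ ^ (p - 2)) (𝓝 0) (𝓝 (C * 0 ^ (p - 2))) :=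
      ((Real.continuousAt_rpow_const 0 (p - 2) (Or.inr (by linarith))).tendsto).const_mul C
    rw [Real.zero_rpow (by linarith), mul_zero] at h2
    exact h2.mono_left nhdsWithin_le_nhds
  obtain ⟨ρ, h3, h4, h5⟩ := ((h1.eventually (gt_mem_nhds hc)).and
    (eventually_mem_nhdsWithin.and (mem_nhdsWithin_of_mem_nhds (Iio_mem_nhds hR)))).exists
  have h6 : 0 < ρ := h4
  refine ⟨ρ, h6, h5, ?_⟩
  have h7 : ρ ^ p = ρ ^ (p - 2) * ρ ^ 2 := by
    rw [← Real.rpow_two, ← Real.rpow_add h6]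
    ring_nf
  rw [h7, ← mul_assoc, ← sub_mul]
  have : 0 < c - C * ρ ^ (p - 2) := by linarith
  positivity

/-- A superquadratic negative term dominates along rays. -/
theorem exists_ge_sq_sub_rpow_nonpos (hp : 2 < p) {a : ℝ} (ha : 0 < a) (q C R : ℝ) :
    ∃ T, 0 < T ∧ R ≤ T ∧ T ^ 2 * q - T ^ p * a + C ≤ 0 := by
  have h1 : Tendsto (fun T : ℝ => T ^ (p - 2) * a) atTop atTop :=
    (tendsto_rpow_atTop (by linarith)).atTop_mul_const ha
  obtain ⟨T, h2, h3, h4, h5⟩ := ((h1.eventually (eventually_ge_atTop (q + 1))).and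
    ((eventually_ge_atTop (max 1 |C|)).and ((eventually_ge_atTop R).and
      (eventually_gt_atTop 0)))).exists
  refine ⟨T, h5, h4, ?_⟩
  have h6 : T ^ p = T ^ (p - 2) * T ^ 2 := by
    rw [← Real.rpow_two, ← Real.rpow_add h5]
    ring_nf
  have h7 : 1 ≤ T := (le_max_left _ _).trans h3
  have h8 : C ≤ T := (le_abs_self C).trans ((le_max_right _ _).trans h3)
  rw [h6]
  have h9 : T ^ 2 * (q + 1) ≤ T ^ 2 * (T ^ (p - 2) * a) :=
    mul_le_mul_of_nonneg_left h2 (by positivity)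
  nlinarith

/-- Palais–Smale sequences are bounded: `r` stands for the norm, `q` for the quadratic form, `a` for
the critical integral, `b` and `d` for the integrals of the primitive of the perturbation and of the
perturbation times the function. -/
theorem exists_le_of_palaisSmale (hp : 2 < p) {c M : ℝ} (hc : 0 < c) {r q a b d : ℕ → ℝ}
    (hr : ∀ n, 0 ≤ r n) (hq : ∀ n, c * r n ^ 2 ≤ q n)
    (hbd : ∀ ε, 0 < ε → ∃ C, ∀ n, |b n| ≤ C + ε * a n ∧ |d n| ≤ C + ε * a n)
    (ha : ∀ n, 0 ≤ a n) (hJ : ∀ n, |1 / 2 * q n - 1 / p * a n - b n| ≤ M)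
    (hG : ∀ n, |q n - a n - d n| ≤ M * r n) : ∃ K, ∀ n, r n ≤ K := by
  have hp0 : 0 < p := by linarith
  have hp1 : 1 / p < 1 / 2 := one_div_lt_one_div_of_lt two_pos hp
  have hp2 : 0 < 1 / p := by positivity
  set κ := 1 / 2 - 1 / p with hκ
  have hκ0 : 0 < κ := by linarith
  obtain ⟨C, hC⟩ := hbd (κ / 3) (by positivity)
  set X := 2 * M + 2 * C + 4 / κ * (M + 3 / 2 * C) with hX
  set Y := 2 * M / κ with hY
  refine ⟨(|X| + |Y|) / c + 1, fun n => ?_⟩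
  obtain ⟨hb, hd⟩ := hC n
  have hb' := abs_le.1 hb
  have hd' := abs_le.1 hd
  have hJ' := abs_le.1 (hJ n)
  have hG' := abs_le.1 (hG n)
  have h1 : κ / 2 * a n ≤ M + M * r n / 2 + 3 / 2 * C := by
    have h2 : κ * a n = (1 / 2 * q n - 1 / p * a n - b n) - 1 / 2 * (q n - a n - d n)
        - 1 / 2 * d n + b n := by rw [hκ]; ring
    linarith
  have h3 : a n ≤ 2 / κ * (M + M * r n / 2 + 3 / 2 * C) := by
    rw [div_mul_eq_mul_div, le_div_iff₀ hκ0]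
    linarith
  have h4 : q n ≤ 2 * M + 2 * C + 2 * a n := by
    have h5 : 1 / p * a n ≤ 1 / 2 * a n := mul_le_mul_of_nonneg_right hp1.le (ha n)
    have h6 : κ / 3 * a n ≤ 1 / 2 * a n := mul_le_mul_of_nonneg_right (by linarith) (ha n)
    linarith
  -- the functional minus half of its derivative controls the critical term, hence the norm
  have h7 : c * r n ^ 2 ≤ X + Y * r n := by
    have h8 : X + Y * r n = 2 * M + 2 * C + 2 * (2 / κ * (M + M * r n / 2 + 3 / 2 * C)) := by
      rw [hX, hY]; ring
    rw [h8]
    linarith [hq n]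
  by_contra! h9
  have h10 : 1 ≤ r n := by
    have : 0 ≤ (|X| + |Y|) / c := by positivity
    linarith
  have h11 : |X| + |Y| < c * r n := by
    have h12 : (|X| + |Y|) / c < r n := by linarith
    rw [div_lt_iff₀ hc] at h12
    linarith
  have h13 : X + Y * r n ≤ (|X| + |Y|) * r n := by
    have h14 : X ≤ |X| * r n :=
      (le_abs_self X).trans (le_mul_of_one_le_right (abs_nonneg _) h10)
    have h15 : Y * r n ≤ |Y| * r n := mul_le_mul_of_nonneg_right (le_abs_self Y) (hr n)
    linarith
  nlinarith

/-- A vanishing Palais–Smale sequence has level at least the critical one. -/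
theorem le_of_vanishing_palaisSmale (hp : 2 < p) {S c : ℝ} (hS : 0 ≤ S) (hc : 0 < c)
    {q a b d e : ℕ → ℝ} (hSa : ∀ n, S * a n ^ (2 / p) ≤ q n + e n)
    (hJ : Tendsto (fun n => 1 / 2 * q n - 1 / p * a n - b n) atTop (𝓝 c))
    (hG : Tendsto (fun n => q n - a n - d n) atTop (𝓝 0)) (hb : Tendsto b atTop (𝓝 0))
    (hd : Tendsto d atTop (𝓝 0)) (he : Tendsto e atTop (𝓝 0)) :
    (1 / 2 - 1 / p) * S ^ (1 - 2 / p)⁻¹ ≤ c := by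
  have hp0 : 0 < p := by linarith
  have hp1 : 1 / p < 1 / 2 := one_div_lt_one_div_of_lt two_pos hp
  have hp2 : 2 / p < 1 := by rwa [div_lt_one hp0]
  have hp3 : 0 < 1 - 2 / p := by linarith
  set κ := 1 / 2 - 1 / p with hκ
  have hκ0 : 0 < κ := by linarith
  have ha : Tendsto a atTop (𝓝 (c / κ)) := by
    have h1 := (((hJ.sub (hG.const_mul (1 / 2))).sub (hd.const_mul (1 / 2))).add hb).div_const κ
    rw [mul_zero, sub_zero, sub_zero, add_zero] at h1
    refine h1.congr fun n => ?_
    rw [div_eq_iff hκ0.ne', hκ]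
    ring
  have hq : Tendsto q atTop (𝓝 (c / κ)) := by
    have h1 := (hG.add ha).add hd
    rw [zero_add, add_zero] at h1
    refine h1.congr fun n => ?_
    ring
  set L := c / κ with hL
  have hL0 : 0 < L := by positivity
  have h2 : S * L ^ (2 / p) ≤ L := by
    have h3 := ((ha.rpow_const (p := 2 / p) (Or.inl hL0.ne')).const_mul S)
    have h4 := hq.add he
    rw [add_zero] at h4
    exact le_of_tendsto_of_tendsto' h3 h4 hSa
  have h5 : S ≤ L ^ (1 - 2 / p) := by
    rw [Real.rpow_sub hL0, Real.rpow_one, le_div_iff₀ (by positivity)]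
    exact h2
  have h6 : S ^ (1 - 2 / p)⁻¹ ≤ L := by
    calc S ^ (1 - 2 / p)⁻¹ ≤ (L ^ (1 - 2 / p)) ^ (1 - 2 / p)⁻¹ :=
          Real.rpow_le_rpow hS h5 (by positivity)
      _ = L := by rw [← Real.rpow_mul hL0.le, mul_inv_cancel₀ hp3.ne', Real.rpow_one]
  calc κ * S ^ (1 - 2 / p)⁻¹ ≤ κ * L := by gcongr
    _ = c := by rw [hL]; field_simp

end RealEstimates

/-! ### Weak convergence in the energy space -/

theorem exists_subseq_tendsto_inner {H : Type*} [NormedAddCommGroup H] [InnerProductSpace ℝ H]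
    [CompleteSpace H] [SecondCountableTopology H] {u : ℕ → H} {M : ℝ} (hu : ∀ n, ‖u n‖ ≤ M) :
    ∃ (v : H) (a : ℕ → ℕ), StrictMono a ∧
      ∀ φ, Tendsto (fun n => inner ℝ (u (a n)) φ) atTop (𝓝 (inner ℝ v φ)) := by
  have hc := WeakDual.isSeqCompact_closedBall (𝕜 := ℝ) (E := H) 0 M
  let x : ℕ → WeakDual ℝ H := fun n =>
    StrongDual.toWeakDual (InnerProductSpace.toDual ℝ H (u n))
  have hx : ∀ n, x n ∈ WeakDual.toStrongDual ⁻¹' Metric.closedBall (0 : StrongDual ℝ H) M :=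
    fun n => by
      rw [mem_preimage, mem_closedBall_zero_iff]
      exact ((InnerProductSpace.toDual ℝ H).norm_map (u n)).trans_le (hu n)
  obtain ⟨ℓ, -, a, ha, hlim⟩ := hc hx
  refine ⟨(InnerProductSpace.toDual ℝ H).symm (WeakDual.toStrongDual ℓ), a, ha, fun φ => ?_⟩
  rw [InnerProductSpace.toDual_symm_apply]
  exact ((WeakDual.eval_continuous φ).tendsto ℓ).comp hlim

namespace IsEnergySpace

variable {N : ℕ} {s μ lam : ℝ} {Ω : Set (EuclideanSpace ℝ (Fin N))} {H : Type*}
  [NormedAddCommGroup H] [InnerProductSpace ℝ H] {fn : H → EuclideanSpace ℝ (Fin N) → ℝ}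

/-- Rellich's theorem: weakly convergent sequences converge strongly in `L²(Ω)`, and almost
everywhere along a subsequence. -/
theorem tendsto_setIntegral_sq_sub [CompleteSpace H] (hE : IsEnergySpace s Ω fn) (hs : 0 < s)
    (hΩ : MeasurableSet Ω) (hΩb : Bornology.IsBounded Ω) {u : ℕ → H} {v : H} {M : ℝ}
    (hu : ∀ n, ‖u n‖ ≤ M)
    (hw : ∀ φ, Tendsto (fun n => inner ℝ (u n) φ) atTop (𝓝 (inner ℝ v φ))) :
    Tendsto (fun n => ∫ x in Ω, fn (u n - v) x ^ 2) atTop (𝓝 0) ∧ ∃ a : ℕ → ℕ, StrictMono a ∧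
      ∀ᵐ x, Tendsto (fun n => fn (u (a n)) x) atTop (𝓝 (fn v x)) := by
  obtain ⟨P, hP, hPi⟩ := hE.exists_toL2
  have hM : ∀ n, ‖u n - v‖ ^ 2 ≤ (M + ‖v‖) ^ 2 := fun n => by
    have := (norm_sub_le (u n) v).trans (add_le_add_left (hu n) _)
    gcongr
  have h0 : Tendsto (fun n => ∫ x in Ω, fn (u n - v) x ^ 2) atTop (𝓝 0) := by
    refine tendsto_integral_sq_of_tendsto_average hs hΩb (fun n => (hE.memX0 _).1)
      (fun n => (hE.integral_sq_le _).trans (hM n))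
      (fun n => (hE.integral_gagliardoKernel_le _).trans (hM n)) fun x r => ?_
    -- averaging over a ball is a bounded functional
    set B := indicatorConstLp 2 (measurableSet_ball (x := x) (ε := r))
      (measure_ball_lt_top (μ := volume)).ne (1 : ℝ) with hB
    have h1 : ∀ n, ∫ y in Metric.ball x r, fn (u n - v) y =
        inner ℝ (u n) (ContinuousLinearMap.adjoint P B) -
          inner ℝ v (ContinuousLinearMap.adjoint P B) := fun n => by
      rw [← inner_sub_left, ContinuousLinearMap.adjoint_inner_right, real_inner_comm, hB,
        L2.inner_indicatorConstLp_one]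
      exact integral_congr_ae (ae_restrict_of_ae (hP _).symm)
    simp only [h1]
    have h2 := (hw (ContinuousLinearMap.adjoint P B)).sub_const
      (inner ℝ v (ContinuousLinearMap.adjoint P B))
    rwa [sub_self] at h2
  refine ⟨h0, ?_⟩
  have h3 : Tendsto (fun n => P (u n)) atTop (𝓝 (P v)) := by
    rw [tendsto_iff_norm_sub_tendsto_zero]
    have h4 : ∀ n, ‖P (u n) - P v‖ = Real.sqrt (∫ x in Ω, fn (u n - v) x ^ 2) := fun n => by
      rw [← map_sub, norm_eq_sqrt_real_inner, hPi,
        (hE.memX0 (u n - v)).setIntegral_eq hΩ fun x hx => by rw [hx, zero_pow two_ne_zero]]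
      simp only [sq]
    simp only [h4]
    have h5 := (Real.continuous_sqrt.tendsto 0).comp h0
    rwa [Real.sqrt_zero] at h5
  obtain ⟨a, ha, hae⟩ := (tendstoInMeasure_of_tendsto_Lp h3).exists_seq_tendsto_ae
  refine ⟨a, ha, ?_⟩
  filter_upwards [hae, hP v, ae_all_iff.2 fun n => hP (u (a n))] with x h1 h2 h3
  rw [← h2]
  exact h1.congr fun n => h3 n

/-! ### The mountain pass argument -/

theorem abs_setIntegral_le_add (hE : IsEnergySpace s Ω fn) (hs : 0 < s) (hN : 2 * s < N) {C ε : ℝ}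
    {F : EuclideanSpace ℝ (Fin N) → ℝ} (z : H)
    (hF : ∀ x, |F x| ≤ C * fn z x ^ 2 + ε * |fn z x| ^ critExp N s) :
    |∫ x in Ω, F x| ≤ C * (∫ x in Ω, fn z x ^ 2) + ε * ∫ x in Ω, |fn z x| ^ critExp N s := by
  have h1 : IntegrableOn (fun x => fn z x ^ 2) Ω := (hE.memX0 z).1.1.integrable_sq.integrableOn
  have h2 : IntegrableOn (fun x => |fn z x| ^ critExp N s) Ω := (hE.sobolev hs hN z).1.integrableOn
  rw [← integral_const_mul, ← integral_const_mul, ← integral_add (h1.const_mul C) (h2.const_mul ε)]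
  exact norm_integral_le_of_norm_le (f := F) ((h1.const_mul C).add (h2.const_mul ε))
    (Eventually.of_forall fun x => hF x)

theorem exists_setIntegral_sq_le (hE : IsEnergySpace s Ω fn) (hs : 0 < s) (hN : 2 * s < N)
    [IsFiniteMeasure (volume.restrict Ω)] {η : ℝ} (hη : 0 < η) :
    ∃ C, ∀ z, ∫ x in Ω, fn z x ^ 2 ≤ C + η * ∫ x in Ω, |fn z x| ^ critExp N s := by
  obtain ⟨C, -, hC⟩ := exists_sq_le_add_rpow (two_lt_critExp hs hN) hη
  refine ⟨∫ x in Ω, C, fun z => ?_⟩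
  have h1 : IntegrableOn (fun x => fn z x ^ 2) Ω := (hE.memX0 z).1.1.integrable_sq.integrableOn
  have h2 : IntegrableOn (fun x => |fn z x| ^ critExp N s) Ω := (hE.sobolev hs hN z).1.integrableOn
  rw [← integral_const_mul, ← integral_add (integrable_const C) (h2.const_mul η)]
  exact integral_mono h1 ((integrable_const C).add (h2.const_mul η)) fun x => hC _

theorem exists_perturbation_le (hE : IsEnergySpace s Ω fn) (hs : 0 < s) (hN : 2 * s < N)
    [IsFiniteMeasure (volume.restrict Ω)] {g : EuclideanSpace ℝ (Fin N) → ℝ → ℝ}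
    (hg : IsSubcritical (critExp N s) g) {ε : ℝ} (hε : 0 < ε) :
    ∃ C, ∀ z,
      |∫ x in Ω, ∫ τ in (0 : ℝ)..(fn z x), g x τ| ≤ C + ε * ∫ x in Ω, |fn z x| ^ critExp N s ∧
      |∫ x in Ω, g x (fn z x) * fn z x| ≤ C + ε * ∫ x in Ω, |fn z x| ^ critExp N s := by
  have hp := two_lt_critExp hs hN
  obtain ⟨C, hC0, hC⟩ := hg.abs_small_at_infinity (by linarith) (half_pos hε)
  obtain ⟨D, hD⟩ := hE.exists_setIntegral_sq_le hs hN
    (show 0 < ε / 2 / (C + 1) by positivity)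
  refine ⟨C * D, fun z => ?_⟩
  have ha : 0 ≤ ∫ x in Ω, |fn z x| ^ critExp N s := integral_nonneg fun x => by positivity
  have h1 : C * (∫ x in Ω, fn z x ^ 2) + ε / 2 * (∫ x in Ω, |fn z x| ^ critExp N s) ≤
      C * D + ε * ∫ x in Ω, |fn z x| ^ critExp N s := by
    have h2 := mul_le_mul_of_nonneg_left (hD z) hC0
    have h3 : C * (ε / 2 / (C + 1)) ≤ ε / 2 := by
      rw [mul_div_assoc', div_le_iff₀ (by positivity)]
      nlinarith
    have h4 := mul_le_mul_of_nonneg_right h3 ha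
    nlinarith
  exact ⟨(hE.abs_setIntegral_le_add hs hN z fun x => (hC x _).1).trans h1,
    (hE.abs_setIntegral_le_add hs hN z fun x => (hC x _).2).trans h1⟩

end IsEnergySpace

namespace IsEnergySpace

variable {N : ℕ} {s μ lam : ℝ} {Ω : Set (EuclideanSpace ℝ (Fin N))} {H : Type*}
  [NormedAddCommGroup H] [InnerProductSpace ℝ H] {fn : H → EuclideanSpace ℝ (Fin N) → ℝ}
  {g : EuclideanSpace ℝ (Fin N) → ℝ → ℝ}

theorem setIntegral_primitive_eq (hE : IsEnergySpace s Ω fn) (hs : 0 < s) (hN : 2 * s < N)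
    [IsFiniteMeasure (volume.restrict Ω)] (hg : IsSubcritical (critExp N s) g) (z : H) :
    ∫ x in Ω, ∫ τ in (0 : ℝ)..(fn z x), (|τ| ^ (critExp N s - 2) * τ + g x τ) =
      1 / critExp N s * (∫ x in Ω, |fn z x| ^ critExp N s) +
        ∫ x in Ω, ∫ τ in (0 : ℝ)..(fn z x), g x τ := by
  have hp := two_lt_critExp hs hN
  have hp1 : 1 < critExp N s := by linarith
  have hi := (hE.sobolev hs hN z).1.restrict (s := Ω)
  have hgi := (hg.isGrowthBounded hp).integrable_primitive hp1
    (hE.aestronglyMeasurable_fn z).restrict hi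
  rw [← integral_const_mul, ← integral_add (hi.const_mul _) hgi]
  refine integral_congr_ae (Eventually.of_forall fun x => ?_)
  have hc : Continuous fun τ : ℝ => |τ| ^ (critExp N s - 2) * τ := by
    have h1 := ((hg.isGrowthBounded_add hp).continuous x).sub (hg.continuous x)
    exact h1.congr fun τ => by simp
  simp only
  rw [intervalIntegral.integral_add (hc.intervalIntegrable _ _)
    ((hg.continuous x).intervalIntegrable _ _), integral_abs_rpow_mul hp1]

theorem setIntegral_nonlinearity_mul_self (hE : IsEnergySpace s Ω fn) (hs : 0 < s)
    (hN : 2 * s < N) [IsFiniteMeasure (volume.restrict Ω)] (hg : IsSubcritical (critExp N s) g)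
    (z : H) :
    ∫ x in Ω, (|fn z x| ^ (critExp N s - 2) * fn z x + g x (fn z x)) * fn z x =
      (∫ x in Ω, |fn z x| ^ critExp N s) + ∫ x in Ω, g x (fn z x) * fn z x := by
  have hp := two_lt_critExp hs hN
  have hi := (hE.sobolev hs hN z).1.restrict (s := Ω)
  have hm := (hE.aestronglyMeasurable_fn z).restrict (s := Ω)
  rw [← integral_add hi ((hg.isGrowthBounded hp).integrable_mul (by linarith) hm hm hi hi)]
  refine integral_congr_ae (Eventually.of_forall fun x => ?_)
  simp only
  rw [add_mul, abs_rpow_sub_two_mul_self_mul _ (by linarith)]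

/-- Below the critical level the mountain pass yields a nontrivial critical point. -/
theorem exists_critical_point [CompleteSpace H] [SecondCountableTopology H]
    (hE : IsEnergySpace s Ω fn) (hs0 : 0 < s) (hs1 : s < 1) (hN : 2 * s < N)
    (hΩ : MeasurableSet Ω) (hΩb : Bornology.IsBounded Ω) (hμ0 : 0 ≤ μ)
    (hμ1 : μ < hardyConst N s) (hlam0 : 0 < lam) (hlam1 : lam < firstEigenvalue s μ Ω)
    (hg : IsSubcritical (critExp N s) g) {z₀ : H} (hz₀ : z₀ ≠ 0)
    (hlevel : ∀ t : ℝ, 0 ≤ t → energyJ s μ lam Ω g (fn (t • z₀)) <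
      s / N * bestS N s μ ^ ((N : ℝ) / (2 * s))) :
    ∃ u : H, u ≠ 0 ∧ ∀ φ : H,
      gagliardoForm s (fn u) (fn φ) - μ * (∫ x, fn u x * fn φ x / ‖x‖ ^ (2 * s)) -
          lam * (∫ x, fn u x * fn φ x) =
        ∫ x in Ω, (|fn u x| ^ (critExp N s - 2) * fn u x + g x (fn u x)) * fn φ x := by
  have : IsFiniteMeasure (volume.restrict Ω) :=
    isFiniteMeasure_restrict.2 hΩb.measure_lt_top.ne
  have hp := two_lt_critExp hs0 hN
  have hκ := div_eq_half_sub hs0 hN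
  have hκ' := two_mul_div_eq hs0 hN
  set p := critExp N s with hpdef
  have hp0 : 0 < p := by linarith
  set k : EuclideanSpace ℝ (Fin N) → ℝ → ℝ := fun x t => |t| ^ (p - 2) * t + g x t with hkdef
  have hk : IsGrowthBounded p k := hg.isGrowthBounded_add hp
  obtain ⟨A, hA⟩ := hE.exists_energyOperator hs0 hs1 hN μ lam
  obtain ⟨Ψ, hΨc, hΨ⟩ := hE.exists_superposition hs0 hN hk
  obtain ⟨c₀, hc₀, hcoer⟩ := exists_coercive hs0 hs1 hN hμ0 hμ1 hΩ hlam0 hlam1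
  have hAsymm : ∀ z w, inner ℝ (A z) w = inner ℝ (A w) z := fun z w => by
    rw [hA, hA, gagliardoForm, gagliardoForm]
    simp only [gagliardoKernel, mul_comm]
  have hΩint : ∀ (z : H) (F : EuclideanSpace ℝ (Fin N) → ℝ), (∀ x, fn z x = 0 → F x = 0) →
      ∫ x in Ω, F x = ∫ x, F x := fun z F hF => (hE.memX0 z).setIntegral_eq hΩ hF
  have hAq : ∀ z, inner ℝ (A z) z = hardyEnergy s μ Ω (fn z) - lam * ∫ x in Ω, fn z x ^ 2 :=
    fun z => by
      rw [hA, hardyEnergy, hΩint z (fun x => |fn z x| ^ 2 / ‖x‖ ^ (2 * s)) fun x hx => by simp [hx],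
        hΩint z (fun x => fn z x ^ 2) fun x hx => by simp [hx]]
      simp only [sq, abs_mul_abs_self]
  -- quadratic form, critical term, perturbation, perturbation tested with `z`, and `L²` norm
  let q : H → ℝ := fun z => inner ℝ (A z) z
  let a : H → ℝ := fun z => ∫ x in Ω, |fn z x| ^ p
  let b : H → ℝ := fun z => ∫ x in Ω, ∫ τ in (0 : ℝ)..(fn z x), g x τ
  let d : H → ℝ := fun z => ∫ x in Ω, g x (fn z x) * fn z x
  let ℓ : H → ℝ := fun z => ∫ x in Ω, fn z x ^ 2
  let J : H → ℝ := fun z => energyJ s μ lam Ω g (fn z)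
  let G : H → H := fun z => A z - Ψ z
  have hJq : ∀ z, J z = 1 / 2 * q z - 1 / p * a z - b z := fun z => by
    simp only [J, q, a, b, energyJ, hAq, hardyEnergy, sq_abs]
    ring
  have hJk : ∀ z, J z = 1 / 2 * q z - ∫ x in Ω, ∫ τ in (0 : ℝ)..(fn z x), k x τ := fun z => by
    rw [hJq, hE.setIntegral_primitive_eq hs0 hN hg]
    ring
  have hGq : ∀ z, inner ℝ (G z) z = q z - a z - d z := fun z => by
    simp only [G, q, a, d]
    rw [inner_sub_left, hΨ, hE.setIntegral_nonlinearity_mul_self hs0 hN hg]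
    ring
  have hq : ∀ z, c₀ * ‖z‖ ^ 2 ≤ q z := fun z => by
    have h1 := hcoer (fn z) (hE.memX0 z)
    have h2 : ∫ x in Ω, |fn z x| ^ 2 = ∫ x in Ω, fn z x ^ 2 := by simp only [sq_abs]
    rw [h2] at h1
    simp only [q]
    rw [hAq, hE.norm_sq_eq, ← hΩint z (fun x => fn z x ^ 2) fun x hx => by simp [hx]]
    exact h1
  have ha0 : ∀ z, 0 ≤ a z := fun z => integral_nonneg fun x => by positivity
  have ha : ∀ z, a z ≤ (Real.sqrt (sobolevConst N s) * ‖z‖) ^ p := fun z =>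
    hE.setIntegral_rpow_le hs0 hN z
  have hℓ0 : ∀ z, 0 ≤ ℓ z := fun z => integral_nonneg fun x => sq_nonneg _
  have hℓ : ∀ z, ℓ z ≤ ‖z‖ ^ 2 := fun z => by
    simp only [ℓ]
    rw [hΩint z (fun x => fn z x ^ 2) fun x hx => by simp [hx]]
    exact hE.integral_sq_le z
  have hbd : ∀ ε, 0 < ε → ∃ C, ∀ z, |b z| ≤ C + ε * a z ∧ |d z| ≤ C + ε * a z := fun ε hε =>
    hE.exists_perturbation_le hs0 hN hg hε
  have hbd' : ∀ ε, 0 < ε → ∃ C, ∀ z, |b z| ≤ C * ℓ z + ε * a z ∧ |d z| ≤ C * ℓ z + ε * a z :=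
    fun ε hε => by
      obtain ⟨C, -, hC⟩ := hg.abs_small_at_infinity (by linarith) hε
      exact ⟨C, fun z => ⟨hE.abs_setIntegral_le_add hs0 hN z fun x => (hC x _).1,
        hE.abs_setIntegral_le_add hs0 hN z fun x => (hC x _).2⟩⟩
  have hGc : Continuous G := A.continuous.sub hΨc
  have hJG : ∀ z w, HasDerivAt (fun h : ℝ => J (z + h • w)) (inner ℝ (G z) w) 0 := fun z w => by
    have h1 := hE.hasDerivAt_superposition hs0 hN hk z w
    have h2 : HasDerivAt (fun h : ℝ => 1 / 2 * (q z + 2 * h * inner ℝ (A z) w + h ^ 2 * q w))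
        (inner ℝ (A z) w) 0 := by
      have h3 := ((((hasDerivAt_id (0 : ℝ)).const_mul 2).mul_const (inner ℝ (A z) w)).const_add
        (q z)).add ((hasDerivAt_pow 2 (0 : ℝ)).mul_const (q w)) |>.const_mul (1 / 2)
      refine h3.congr_deriv ?_
      simp
    have h4 := h2.sub h1
    rw [← hΨ, ← inner_sub_left] at h4
    refine h4.congr_of_eventuallyEq (Eventually.of_forall fun h => ?_)
    simp only [hJk, Pi.sub_apply]
    congr 2
    simp only [q, map_add, map_smul, inner_add_left, inner_add_right, real_inner_smul_left,
      real_inner_smul_right]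
    rw [hAsymm w z]
    ring
  -- the functional is positive on a small sphere
  obtain ⟨C₁, hC₁0, hC₁⟩ :=
    hg.abs_primitive_small_at_zero (by linarith) (show 0 < c₀ / 4 by positivity)
  have hlow : ∀ z, c₀ / 4 * ‖z‖ ^ 2 -
      (1 / p + C₁) * Real.sqrt (sobolevConst N s) ^ p * ‖z‖ ^ p ≤ J z := fun z => by
    have h1 : |b z| ≤ c₀ / 4 * ℓ z + C₁ * a z :=
      hE.abs_setIntegral_le_add hs0 hN z fun x => hC₁ x _
    have h2 := (abs_le.1 h1).2
    have h3 : (1 / p + C₁) * a z ≤ (1 / p + C₁) * (Real.sqrt (sobolevConst N s) ^ p * ‖z‖ ^ p) := by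
      rw [← Real.mul_rpow (by positivity) (by positivity)]
      exact mul_le_mul_of_nonneg_left (ha z) (by positivity)
    have h4 := mul_le_mul_of_nonneg_left (hℓ z) (show 0 ≤ c₀ / 4 by positivity)
    rw [hJq]
    nlinarith [hq z]
  obtain ⟨ρ, hρ0, hρ1, hρ⟩ := exists_lt_forall_pos_le_sub_rpow hp
    (show 0 < c₀ / 4 by positivity) ((1 / p + C₁) * Real.sqrt (sobolevConst N s) ^ p) one_pos
  -- the functional is nonpositive far away along the ray
  have hz₀n : 0 < ‖z₀‖ := norm_pos_iff.2 hz₀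
  have hscale : ∀ t : ℝ, 0 < t → a (t • z₀) = t ^ p * a z₀ := fun t ht => by
    simp only [a]
    rw [← integral_const_mul]
    refine integral_congr_ae (ae_restrict_of_ae ?_)
    filter_upwards [hE.fn_smul t z₀] with x hx
    rw [hx, abs_mul, Real.mul_rpow (abs_nonneg _) (abs_nonneg _), abs_of_pos ht]
  have haz₀ : 0 < a z₀ := by
    simp only [a]
    rw [hΩint z₀ (fun x => |fn z₀ x| ^ p) fun x hx => by
      simp only [hx, abs_zero]; exact Real.zero_rpow hp0.ne']
    exact integral_abs_rpow_pos hp0 (hE.sobolev hs0 hN z₀).1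
      fun h => hz₀ ((hE.fn_ae_eq_zero_iff z₀).1 h)
  obtain ⟨C₂, hC₂⟩ := hbd (1 / (2 * p)) (by positivity)
  obtain ⟨T, hT0, hT1, hT⟩ := exists_ge_sq_sub_rpow_nonpos hp
    (show 0 < 1 / (2 * p) * a z₀ by positivity) (1 / 2 * q z₀) C₂ (1 / ‖z₀‖)
  have hJT : J (T • z₀) ≤ 0 := by
    have h1 := (abs_le.1 (hC₂ (T • z₀)).1).1
    have h2 : q (T • z₀) = T ^ 2 * q z₀ := by
      simp only [q, map_smul, real_inner_smul_left, real_inner_smul_right]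
      ring
    rw [hscale T hT0] at h1
    rw [hJq, h2, hscale T hT0]
    have h3 : 1 / p * (T ^ p * a z₀) = 2 * (1 / (2 * p) * (T ^ p * a z₀)) := by
      field_simp
    nlinarith
  have hJ0 : J 0 ≤ 0 := by
    have h1 : a 0 = 0 := le_antisymm (by
      have := ha 0
      rwa [norm_zero, mul_zero, Real.zero_rpow hp0.ne'] at this) (ha0 0)
    have h2 : ℓ 0 = 0 := le_antisymm (by
      have := hℓ 0
      rwa [norm_zero, zero_pow two_ne_zero] at this) (hℓ0 0)
    obtain ⟨C, hC⟩ := hbd' 1 one_pos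
    have h3 := (hC 0).1
    rw [h1, h2, mul_zero, mul_zero, add_zero, abs_nonpos_iff] at h3
    rw [hJq, h1, h3]
    simp [q]
  have hTn : ρ < ‖T • z₀‖ := by
    rw [norm_smul, Real.norm_of_nonneg hT0.le]
    rw [div_le_iff₀ hz₀n] at hT1
    linarith
  obtain ⟨c, u, hαc, ⟨t, ht0, ht⟩, hJu, hGu⟩ := exists_palaisSmale_seq hGc hJG hJ0 hJT hρ0 hTn hρ
    fun z hz => by rw [← hz]; exact hlow z
  have hc : 0 < c := hρ.trans_le hαc
  have hcS : c < s / N * bestS N s μ ^ ((N : ℝ) / (2 * s)) := by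
    refine ht.trans_lt ?_
    rw [smul_smul]
    exact hlevel _ (by positivity)
  -- boundedness and weak limit
  obtain ⟨M₁, hM₁⟩ := (Metric.isBounded_range_of_tendsto _ hJu).exists_norm_le
  obtain ⟨M₂, hM₂⟩ := (Metric.isBounded_range_of_tendsto _ hGu).exists_norm_le
  have hGle : ∀ n, |inner ℝ (G (u n)) (u n)| ≤ M₂ * ‖u n‖ := fun n =>
    (abs_real_inner_le_norm _ _).trans
      (mul_le_mul_of_nonneg_right (hM₂ _ (mem_range_self n)) (norm_nonneg _))
  obtain ⟨K, hK⟩ := exists_le_of_palaisSmale (M := max M₁ M₂) hp hc₀ (r := fun n => ‖u n‖)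
    (q := fun n => q (u n)) (a := fun n => a (u n)) (b := fun n => b (u n))
    (d := fun n => d (u n)) (fun n => norm_nonneg _) (fun n => hq _)
    (fun ε hε => by
      obtain ⟨C, hC⟩ := hbd ε hε
      exact ⟨C, fun n => hC _⟩) (fun n => ha0 _)
    (fun n => by
      rw [← hJq]
      exact (hM₁ _ (mem_range_self n)).trans (le_max_left _ _))
    (fun n => by
      rw [← hGq]
      exact (hGle n).trans (mul_le_mul_of_nonneg_right (le_max_right _ _) (norm_nonneg _)))
  obtain ⟨v, i₁, hi₁, hw⟩ := exists_subseq_tendsto_inner hK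
  obtain ⟨hL2, i₂, hi₂, hae⟩ := hE.tendsto_setIntegral_sq_sub hs0 hΩ hΩb (fun n => hK (i₁ n)) hw
  have haK : ∀ n, a (u n) ≤ (Real.sqrt (sobolevConst N s) * K) ^ p := fun n => by
    refine (ha _).trans (Real.rpow_le_rpow (by positivity) ?_ hp0.le)
    exact mul_le_mul_of_nonneg_left (hK n) (Real.sqrt_nonneg _)
  refine ⟨v, fun hv => ?_, fun φ => ?_⟩
  · -- a vanishing weak limit forces the level up to the critical one
    subst hv
    simp only [sub_zero] at hL2
    have hsmall : ∀ F : H → ℝ, (∀ ε, 0 < ε → ∃ C, ∀ z, |F z| ≤ C * ℓ z + ε * a z) →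
        Tendsto (fun n => F (u (i₁ n))) atTop (𝓝 0) := fun F hF => by
      rw [Metric.tendsto_atTop']
      intro ε hε
      set D := (Real.sqrt (sobolevConst N s) * K) ^ p with hD
      have hD0 : 0 ≤ D := (ha0 _).trans (haK 0)
      obtain ⟨C, hC⟩ := hF (ε / 2 / (D + 1)) (by positivity)
      have h1 : Tendsto (fun n => C * ℓ (u (i₁ n))) atTop (𝓝 0) := by
        have := hL2.const_mul C
        rwa [mul_zero] at this
      obtain ⟨n₀, hn₀⟩ := Metric.tendsto_atTop'.1 h1 (ε / 2) (by positivity)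
      refine ⟨n₀, fun n hn => ?_⟩
      have h2 := hn₀ n hn
      rw [Real.dist_eq, sub_zero] at h2 ⊢
      have h3 : ε / 2 / (D + 1) * a (u (i₁ n)) ≤ ε / 2 := by
        rw [div_mul_eq_mul_div, div_le_iff₀ (by positivity)]
        have := haK (i₁ n)
        exact mul_le_mul_of_nonneg_left (by linarith) (by positivity)
      have h4 := (abs_lt.1 h2).2
      linarith [hC (u (i₁ n))]
    have hGu' : Tendsto (fun n => inner ℝ (G (u (i₁ n))) (u (i₁ n))) atTop (𝓝 0) := by
      have h1 := (hGu.comp hi₁.tendsto_atTop).norm.mul_const K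
      rw [norm_zero, zero_mul] at h1
      refine squeeze_zero_norm (fun n => ?_) h1
      exact (abs_real_inner_le_norm _ _).trans (mul_le_mul_of_nonneg_left (hK _) (norm_nonneg _))
    have hSpos := bestS_pos (μ := μ) hs0 hs1 hN hμ0 hμ1 (hE.memX0 z₀).1
      fun h => hz₀ ((hE.fn_ae_eq_zero_iff z₀).1 h)
    have h1 := le_of_vanishing_palaisSmale hp hSpos.le hc (q := fun n => q (u (i₁ n)))
      (a := fun n => a (u (i₁ n))) (b := fun n => b (u (i₁ n))) (d := fun n => d (u (i₁ n)))
      (e := fun n => lam * ℓ (u (i₁ n)))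
      (fun n => by
        have h2 := (hE.memX0 (u (i₁ n))).1.bestS_mul_le hs0 hs1 hN hμ0 hμ1
        rw [← (hE.memX0 (u (i₁ n))).hardyEnergy_eq hΩ,
          ← hΩint (u (i₁ n)) (fun x => |fn (u (i₁ n)) x| ^ p) fun x hx => by
            simp only [hx, abs_zero]; exact Real.zero_rpow hp0.ne'] at h2
        simp only [q, a, ℓ, hAq]
        linarith)
      ((hJu.comp hi₁.tendsto_atTop).congr fun n => hJq _)
      (hGu'.congr fun n => hGq _)
      (hsmall b fun ε hε => (hbd' ε hε).imp fun C hC z => (hC z).1)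
      (hsmall d fun ε hε => (hbd' ε hε).imp fun C hC z => (hC z).2)
      (by
        have := hL2.const_mul lam
        rwa [mul_zero] at this)
    rw [← hκ, ← hκ', inv_div] at h1
    exact absurd hcS (not_lt.2 h1)
  · -- passage to the limit in the equation
    rw [← hA]
    have h1 : Tendsto (fun n => inner ℝ (A (u (i₁ (i₂ n)))) φ) atTop (𝓝 (inner ℝ (A v) φ)) := by
      rw [hAsymm v φ, real_inner_comm]
      refine ((hw (A φ)).comp hi₂.tendsto_atTop).congr fun n => ?_
      rw [hAsymm _ φ, real_inner_comm]
      rfl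
    have h2 := hk.tendsto_integral_mul (m := volume.restrict Ω) (by linarith)
      (fun n => (hE.aestronglyMeasurable_fn (u (i₁ (i₂ n)))).restrict)
      (hE.aestronglyMeasurable_fn v).restrict (hE.aestronglyMeasurable_fn φ).restrict
      (hE.sobolev hs0 hN v).1.restrict (hE.sobolev hs0 hN φ).1.restrict
      (fun n => (hE.sobolev hs0 hN _).1.restrict) (fun n => haK _) (ae_restrict_of_ae hae)
    have h3 : Tendsto (fun n => inner ℝ (G (u (i₁ (i₂ n)))) φ) atTop (𝓝 0) := by
      have h4 : Tendsto (fun n => G (u (i₁ (i₂ n)))) atTop (𝓝 0) :=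
        (hGu.comp hi₁.tendsto_atTop).comp hi₂.tendsto_atTop
      have h5 := h4.inner (𝕜 := ℝ) (tendsto_const_nhds (x := φ))
      rwa [inner_zero_left] at h5
    have h5 := h1.sub h2
    have h6 := tendsto_nhds_unique h3 (h5.congr fun n => by
      rw [← hΨ, ← inner_sub_left])
    linarith

end IsEnergySpace

theorem energyJ_congr {N : ℕ} {s μ lam : ℝ} {Ω : Set (EuclideanSpace ℝ (Fin N))}
    {f g : EuclideanSpace ℝ (Fin N) → ℝ → ℝ} {u v : EuclideanSpace ℝ (Fin N) → ℝ}
    (hfg : ∀ᵐ x ∂(volume.restrict Ω), ∀ t, f x t = g x t) (huv : u =ᵐ[volume] v) :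
    energyJ s μ lam Ω f u = energyJ s μ lam Ω g v := by
  have h := ae_restrict_of_ae (s := Ω) huv
  have h1 : ∫ x in Ω, |u x| ^ 2 = ∫ x in Ω, |v x| ^ 2 :=
    integral_congr_ae (by filter_upwards [h] with x hx; rw [hx])
  have h2 : ∫ x in Ω, |u x| ^ 2 / ‖x‖ ^ (2 * s) = ∫ x in Ω, |v x| ^ 2 / ‖x‖ ^ (2 * s) :=
    integral_congr_ae (by filter_upwards [h] with x hx; rw [hx])
  have h3 : ∫ x in Ω, |u x| ^ critExp N s = ∫ x in Ω, |v x| ^ critExp N s :=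
    integral_congr_ae (by filter_upwards [h] with x hx; rw [hx])
  have h4 : ∫ x in Ω, ∫ τ in (0 : ℝ)..(u x), f x τ = ∫ x in Ω, ∫ τ in (0 : ℝ)..(v x), g x τ :=
    integral_congr_ae (by filter_upwards [h, hfg] with x hx hx'; rw [hx, funext hx'])
  rw [energyJ, energyJ, gagliardoForm_congr huv huv, h1, h2, h3, h4]

theorem theorem1p1 (N : ℕ) (s μ lam : ℝ) (hs0 : 0 < s) (hs1 : s < 1) (hN : 2 * s < (N : ℝ))
    (Ω : Set (EuclideanSpace ℝ (Fin N))) (hΩo : IsOpen Ω) (hΩb : Bornology.IsBounded Ω)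
    (hμ0 : 0 < μ) (hμ1 : μ < hardyConst N s)
    (hlam0 : 0 < lam) (hlam1 : lam < firstEigenvalue s μ Ω)
    (f : EuclideanSpace ℝ (Fin N) → ℝ → ℝ) (hf : IsLowerOrderPerturbation s Ω f)
    (u₀ : EuclideanSpace ℝ (Fin N) → ℝ) (hu₀ : MemX0 s Ω u₀) (hu₀ne : ¬ (u₀ =ᵐ[volume] 0))
    (hu₀nn : ∀ᵐ x ∂(volume.restrict Ω), 0 ≤ u₀ x)
    (hsup : (⨆ t : {t : ℝ // 0 ≤ t},
        ((energyJ s μ lam Ω f (fun x => (t : ℝ) * u₀ x) : ℝ) : EReal))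
      < ((s / (N : ℝ) * bestS N s μ ^ ((N : ℝ) / (2 * s)) : ℝ) : EReal)) :
    ∃ u : EuclideanSpace ℝ (Fin N) → ℝ,
      IsWeakSolution s μ lam Ω f u ∧ ¬ (u =ᵐ[volume] 0) := by
  have hΩ : MeasurableSet Ω := hΩo.measurableSet
  have : IsFiniteMeasure (volume.restrict Ω) :=
    isFiniteMeasure_restrict.2 hΩb.measure_lt_top.ne
  have hp := two_lt_critExp hs0 hN
  have hp1 : 1 < critExp N s := by linarith
  obtain ⟨g, hg, hfg⟩ := hf.exists_isSubcritical hs0 hN hΩ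
  have hE := isEnergySpace_fn (s := s) (Ω := Ω)
  obtain ⟨z₀, hz₀⟩ := hE.exists_fn_eq u₀ hu₀
  have hz₀ne : z₀ ≠ 0 := fun h =>
    hu₀ne (hz₀.symm.trans ((hE.fn_ae_eq_zero_iff z₀).2 h))
  obtain ⟨u, hune, hu⟩ := hE.exists_critical_point hs0 hs1 hN hΩ hΩb hμ0.le hμ1 hlam0 hlam1 hg
    hz₀ne fun t ht => by
      have h1 : energyJ s μ lam Ω f (fun x => t * u₀ x) =
          energyJ s μ lam Ω g (energySpace.fn (t • z₀)) := by
        refine energyJ_congr hfg ?_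
        filter_upwards [hz₀, hE.fn_smul t z₀] with x h2 h3
        rw [h3, h2]
      rw [← h1, ← EReal.coe_lt_coe_iff]
      exact (le_iSup (fun t : {t : ℝ // 0 ≤ t} =>
        ((energyJ s μ lam Ω f (fun x => (t : ℝ) * u₀ x) : ℝ) : EReal)) ⟨t, ht⟩).trans_lt hsup
  have hX := hE.memX0 u
  refine ⟨energySpace.fn u, ⟨hX, fun φ hφ => ?_⟩, fun h => hune ((hE.fn_ae_eq_zero_iff u).1 h)⟩
  obtain ⟨w, hw⟩ := hE.exists_fn_eq φ hφ
  have hwΩ := ae_restrict_of_ae (s := Ω) hw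
  have hum := (hE.aestronglyMeasurable_fn u).restrict (s := Ω)
  have hwm := (hE.aestronglyMeasurable_fn w).restrict (s := Ω)
  have hui := (hE.sobolev hs0 hN u).1.restrict (s := Ω)
  have hwi := (hE.sobolev hs0 hN w).1.restrict (s := Ω)
  have hgi : IntegrableOn (fun x => g x (energySpace.fn u x) * energySpace.fn w x) Ω :=
    (hg.isGrowthBounded hp).integrable_mul hp1 hum hwm hui hwi
  have hki : IntegrableOn (fun x => (|energySpace.fn u x| ^ (critExp N s - 2) *
      energySpace.fn u x + g x (energySpace.fn u x)) * energySpace.fn w x) Ω :=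
    (hg.isGrowthBounded_add hp).integrable_mul hp1 hum hwm hui hwi
  have hpi : IntegrableOn (fun x => |energySpace.fn u x| ^ (critExp N s - 2) *
      energySpace.fn u x * energySpace.fn w x) Ω :=
    (hki.sub hgi).congr (Eventually.of_forall fun x => by simp only [Pi.sub_apply]; ring)
  have hpφ : (fun x => |energySpace.fn u x| ^ (critExp N s - 2) * energySpace.fn u x *
      energySpace.fn w x) =ᵐ[volume.restrict Ω]
      fun x => |energySpace.fn u x| ^ (critExp N s - 2) * energySpace.fn u x * φ x := by
    filter_upwards [hwΩ] with x hx
    rw [hx]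
  have hgφ : (fun x => g x (energySpace.fn u x) * energySpace.fn w x) =ᵐ[volume.restrict Ω]
      fun x => f x (energySpace.fn u x) * φ x := by
    filter_upwards [hwΩ, hfg] with x hx hx'
    rw [hx, hx']
  have huφ : (fun x => energySpace.fn u x * energySpace.fn w x) =ᵐ[volume]
      fun x => energySpace.fn u x * φ x := by
    filter_upwards [hw] with x hx
    rw [hx]
  have hdφ : (fun x => energySpace.fn u x * energySpace.fn w x / ‖x‖ ^ (2 * s)) =ᵐ[volume]
      fun x => energySpace.fn u x * φ x / ‖x‖ ^ (2 * s) := by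
    filter_upwards [hw] with x hx
    rw [hx]
  refine ⟨hX.1.integrable_gagliardoKernel hφ.1,
    ((hE.integrable_fn_mul_div hs0 hs1 hN u w).congr hdφ).integrableOn,
    ((hE.integrable_fn_mul u w).congr huφ).integrableOn, hpi.congr hpφ, hgi.congr hgφ, ?_⟩
  rw [← integral_congr_ae hpφ, ← integral_congr_ae hgφ, ← integral_add hpi hgi,
    hX.setIntegral_eq hΩ (F := fun x => energySpace.fn u x * φ x / ‖x‖ ^ (2 * s))
      fun x hx => by rw [hx, zero_mul, zero_div],
    hX.setIntegral_eq hΩ (F := fun x => energySpace.fn u x * φ x)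
      fun x hx => by rw [hx, zero_mul],
    ← integral_congr_ae huφ, ← integral_congr_ae hdφ,
    ← gagliardoForm_congr (EventuallyEq.refl _ _) hw, hu w]
  exact integral_congr_ae (Eventually.of_forall fun x => by simp only; ring)
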